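/- **Proposition.** Let $\Sigma$ be a compact connected Riemann surface. A *bundle pair* $(\mathcal E,\rho)$ on $\Sigma$ consists of a holomorphic vector bundle $\mathcal E$ of rank $n$ and a meromorphic endomorphism $\rho$ of $\mathcal E$ which is holomorphic and invertible outside a finite set of points. For distinct points $z_1,\dots,z_N\in\Sigma$ and $\vec k_j=(k_{j1},\dots,k_{jn})\in\mathbb Z^n$, the pair has *type* $((\vec k_1,z_1),\dots,(\vec k_N,z_N))$ if $\{z_1,\dots,z_N\}$ is the singular set of $\rho$ and, near each $z_j$, in a coordinate $z$ centred at $z_j$ and a holomorphic trivialisation of $\mathcal E$, one has $\rho=F(z)\,\mathrm{diag}(z^{k_{j1}},\dots,z^{k_{jn}})\,G(z)$ with $F,G$ holomorphic and invertible. A holomorphic subbundle $\mathcal E'\subset\mathcal E$ is *$\rho$-invariant* if $\rho$ maps $\mathcal E'$ to itself away from the singular set; then $(\mathcal E',\rho|_{\mathcal E'})$ has in the same way a type $((\vec l_1,z_1),\dots,(\vec l_N,z_N))$ with respect to the same points, where $\vec l_j=0$ if $\rho|_{\mathcal E'}$ is holomorphic and invertible at $z_j$. Let $T>0$ and $0<t_1\le\dots\le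 t_N\le T$, and put $\vec t=(t_1,\dots,t_N,T)$. For a pair of type $((\vec k_j,z_j))_j$ and rank $n>0$ define $$\delta_{\vec t}(\mathcal E,\rho)=c_1(\mathcal E)-\frac1T\sum_{j=1}^N\Bigl(\sum_{i}k_{ji}\Bigr)t_j,\qquad \mu_{\vec t}(\mathcal E,\rho)=\frac{\delta_{\vec t}(\mathcal E,\rho)}{n},$$ where $c_1(\mathcal E)$ is the degree of $\mathcal E$. The pair is *$\vec t$-stable* if $\mu_{\vec t}(\mathcal E',\rho|_{\mathcal E'})<\mu_{\vec t}(\mathcal E,\rho)$ for every $\rho$-invariant holomorphic subbundle $\mathcal E'$ with $0<\operatorname{rank}\mathcal E'<n$. If $(\mathcal E,\rho)$ is $\vec t$-stable, then it is *simple*: every global holomorphic section of $\mathrm{End}(\mathcal E)$ that commutes with $\rho$ is a constant scalar multiple of the identity. -/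

import Mathlib

open scoped Manifold ContDiff Bundle Topology
open Bundle

noncomputable section

namespace BundlePairs

/-! ### Auxiliary facts: a Riemann surface is a smooth real surface -/

section RealStructure

variable {X : Type*} [TopologicalSpace X] [ChartedSpace ℂ X]

theorem isManifold_real [IsManifold 𝓘(ℂ) ω X] : IsManifold 𝓘(ℝ, ℂ) ∞ X := by
  refine isManifold_of_contDiffOn _ _ _ fun e e' he he' => ?_
  have h := (contDiffGroupoid ω 𝓘(ℂ)).compatible he he'
  rw [contDiffGroupoid, mem_groupoid_of_pregroupoid] at h
  have h1 : ContDiffOn ℂ ω (𝓘(ℂ) ∘ (e.symm ≫ₕ e') ∘ 𝓘(ℂ).symm)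
    (𝓘(ℂ).symm ⁻¹' (e.symm ≫ₕ e').source ∩ Set.range 𝓘(ℂ)) := h.1
  exact (h1.restrict_scalars ℝ).of_le le_top

theorem contMDiffAt_real {V : Type*} [NormedAddCommGroup V] [NormedSpace ℂ V] {f : X → V} {x : X}
    (hf : ContMDiffAt 𝓘(ℂ) 𝓘(ℂ, V) ω f x) : ContMDiffAt 𝓘(ℝ, ℂ) 𝓘(ℝ, V) ∞ f x := by
  rw [contMDiffAt_iff] at hf ⊢
  refine ⟨hf.1, ?_⟩
  have h1 := (hf.2.restrict_scalars ℝ).of_le (m := ∞) le_top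
  exact h1

end RealStructure

/-! ### Holomorphic vector bundles

Throughout, `X` is a Riemann surface and `E` is a holomorphic vector bundle over `X` with fibre
model `F`, that is, a vector bundle in the class `ContMDiffVectorBundle ω F E 𝓘(ℂ)`. -/

variable {X : Type*} [TopologicalSpace X] [ChartedSpace ℂ X]
  (F : Type*) [NormedAddCommGroup F] [NormedSpace ℂ F]
  (E : X → Type*) [TopologicalSpace (TotalSpace F E)]
  [∀ x, AddCommGroup (E x)] [∀ x, Module ℂ (E x)] [∀ x, TopologicalSpace (E x)]

section Sections

variable {E} [FiberBundle F E]

/-- `s` is a holomorphic section of `E` over `U`. -/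
def IsHolSectionOn (s : ∀ x, E x) (U : Set X) : Prop :=
  ContMDiffOn 𝓘(ℂ) (𝓘(ℂ).prod 𝓘(ℂ, F)) ω (fun x => TotalSpace.mk' F x (s x)) U

/-- `s` is a holomorphic frame over `U` of the family of subspaces `W`: the `s i` are holomorphic
sections of `E` over `U` whose values at each `x ∈ U` form a basis of `W x`. -/
structure IsHolFrameOn {r : ℕ} (W : ∀ x, Submodule ℂ (E x)) (s : Fin r → ∀ x, E x)
    (U : Set X) : Prop where
  holomorphic : ∀ i, IsHolSectionOn F (s i) U
  linearIndependent : ∀ x ∈ U, LinearIndependent ℂ (fun i => s i x)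
  span_eq : ∀ x ∈ U, Submodule.span ℂ (Set.range fun i => s i x) = W x

end Sections

/-- A holomorphic subbundle of rank `r` of `E`: a family of subspaces of the fibres admitting
holomorphic frames (with `r` elements) near every point. -/
structure HolSubbundle [FiberBundle F E] (r : ℕ) where
  carrier : ∀ x, Submodule ℂ (E x)
  exists_frame : ∀ x, ∃ U : Set X, IsOpen U ∧ x ∈ U ∧
    ∃ s : Fin r → ∀ y, E y, IsHolFrameOn F carrier s U

/-- `E` as a subbundle of itself. -/
def HolSubbundle.full [FiniteDimensional ℂ F] [FiberBundle F E] [VectorBundle ℂ F E]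
    [ContMDiffVectorBundle ω F E 𝓘(ℂ)] : HolSubbundle F E (Module.finrank ℂ F) where
  carrier _ := ⊤
  exists_frame x := by
    have h := (trivializationAt F E x).isLocalFrameOn_localFrame_baseSet 𝓘(ℂ) ω
      (Module.finBasis ℂ F)
    exact ⟨(trivializationAt F E x).baseSet, (trivializationAt F E x).open_baseSet,
      FiberBundle.mem_baseSet_trivializationAt F E x,
      (trivializationAt F E x).localFrame (Module.finBasis ℂ F),
      fun i => h.contMDiffOn i, fun y hy => h.linearIndependent hy,
      fun y hy => top_le_iff.1 (h.generating hy)⟩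

/-! ### The degree (first Chern number), by Chern–Weil theory -/

/-- A smooth Hermitian metric on `E`, conjugate-linear in the first variable. -/
structure HermitianMetric [FiberBundle F E] where
  inner : ∀ x, E x →ₗ⋆[ℂ] E x →ₗ[ℂ] ℂ
  conj_symm : ∀ x v w, star (inner x v w) = inner x w v
  pos : ∀ x v, v ≠ 0 → 0 < (inner x v v).re
  smooth : ∀ (U : Set X) (s t : ∀ x, E x), IsOpen U → IsHolSectionOn F s U →
    IsHolSectionOn F t U →
    ContMDiffOn 𝓘(ℝ, ℂ) 𝓘(ℝ, ℂ) ∞ (fun x => inner x (s x) (t x)) U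

variable (X) in
/-- A smooth partition of unity on `X` subordinate to the cover by the domains of the
preferred charts. -/
def ChartPartition : Type _ :=
  {P : SmoothPartitionOfUnity X 𝓘(ℝ, ℂ) X Set.univ //
    P.IsSubordinate fun x => (chartAt ℂ x).source}

theorem nonempty_chartPartition [IsManifold 𝓘(ℂ) ω X] [T2Space X] [SigmaCompactSpace X] :
    Nonempty (ChartPartition X) := by
  have : IsManifold 𝓘(ℝ, ℂ) ∞ X := isManifold_real
  obtain ⟨P, hP⟩ := SmoothPartitionOfUnity.exists_isSubordinate_chartAt_source 𝓘(ℝ, ℂ) X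
  exact ⟨⟨P, hP⟩⟩

theorem nonempty_hermitianMetric [IsManifold 𝓘(ℂ) ω X] [T2Space X] [CompactSpace X]
    [FiniteDimensional ℂ F] [FiberBundle F E] [VectorBundle ℂ F E]
    [ContMDiffVectorBundle ω F E 𝓘(ℂ)] : Nonempty (HermitianMetric F E) := by
  have : IsManifold 𝓘(ℝ, ℂ) ∞ X := isManifold_real
  let e := fun i : X => trivializationAt F E i
  obtain ⟨P, hP⟩ := SmoothPartitionOfUnity.exists_isSubordinate 𝓘(ℝ, ℂ)
    (isClosed_univ (X := X)) (fun i => (e i).baseSet) (fun i => (e i).open_baseSet)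
    (fun x _ => Set.mem_iUnion.2 ⟨x, FiberBundle.mem_baseSet_trivializationAt F E x⟩)
  let S : Finset X := P.locallyFinite.finite_nonempty_of_compact.toFinset
  have hS : ∀ i, i ∉ S → ∀ x, P i x = 0 := by
    intro i hi x
    by_contra h
    exact hi ((Set.Finite.mem_toFinset _).2 ⟨x, h⟩)
  let φ : F ≃L[ℂ] EuclideanSpace ℂ (Fin (Module.finrank ℂ F)) :=
    ContinuousLinearEquiv.ofFinrankEq (by simp)
  let L : ∀ i x, E x →ₗ[ℂ] EuclideanSpace ℂ (Fin (Module.finrank ℂ F)) :=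
    fun i x => φ.toLinearMap ∘ₗ (e i).linearMapAt ℂ x
  let f : ∀ x, E x → E x → ℂ := fun x v w => ∑ i ∈ S, (P i x : ℂ) * inner ℂ (L i x v) (L i x w)
  refine ⟨⟨fun x => LinearMap.mk₂'ₛₗ _ _ (f x) ?_ ?_ ?_ ?_, ?_, ?_, ?_⟩⟩
  · intro v v' w
    simp only [f, map_add, inner_add_left, mul_add, Finset.sum_add_distrib]
  · intro c v w
    simp only [f, map_smul, inner_smul_left, smul_eq_mul, Finset.mul_sum]
    exact Finset.sum_congr rfl fun i _ => by ring
  · intro v w w'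
    simp only [f, map_add, inner_add_right, mul_add, Finset.sum_add_distrib]
  · intro c v w
    simp only [f, map_smul, inner_smul_right, smul_eq_mul, Finset.mul_sum, RingHom.id_apply]
    exact Finset.sum_congr rfl fun i _ => by ring
  · intro x v w
    simp only [LinearMap.mk₂'ₛₗ_apply, f, star_sum]
    refine Finset.sum_congr rfl fun i _ => ?_
    rw [Complex.star_def, map_mul, Complex.conj_ofReal, inner_conj_symm]
  · intro x v hv
    simp only [LinearMap.mk₂'ₛₗ_apply, f, Complex.re_sum, Complex.re_ofReal_mul]
    have hnn : ∀ i ∈ S, 0 ≤ P i x * (inner ℂ (L i x v) (L i x v)).re := fun i _ =>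
      mul_nonneg (P.nonneg i x) (inner_self_nonneg (𝕜 := ℂ) (x := L i x v))
    obtain ⟨i, hi⟩ := P.exists_pos_of_mem (Set.mem_univ x)
    refine Finset.sum_pos' hnn ⟨i, ?_, mul_pos hi ?_⟩
    · by_contra h
      exact hi.ne' (hS i h x)
    · have hx : x ∈ (e i).baseSet := hP i (subset_tsupport _ hi.ne')
      have hne : L i x v ≠ 0 := by
        intro h0
        apply hv
        have h1 : (e i).linearMapAt ℂ x v = 0 := φ.injective (by simpa [L] using h0)
        have h2 := (e i).symmₗ_linearMapAt (R := ℂ) hx v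
        rw [h1, map_zero] at h2
        exact h2.symm
      have h1 : (inner ℂ (L i x v) (L i x v)).re = ‖L i x v‖ ^ 2 :=
        inner_self_eq_norm_sq (𝕜 := ℂ) (L i x v)
      rw [h1]
      exact pow_pos (norm_pos_iff.2 hne) 2
  · intro U s t hU hs ht x hx
    apply ContMDiffAt.contMDiffWithinAt
    simp only [LinearMap.mk₂'ₛₗ_apply, f]
    refine ContMDiffAt.sum fun i _ => ?_
    by_cases hxi : x ∈ tsupport (P i)
    · have hb : x ∈ (e i).baseSet := hP i hxi
      have key : ∀ s : ∀ x, E x, IsHolSectionOn F s U →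
          ContMDiffAt 𝓘(ℝ, ℂ) 𝓘(ℝ, EuclideanSpace ℂ (Fin (Module.finrank ℂ F))) ∞
            (fun y => L i y (s y)) x := by
        intro s hs
        have h1 := ((e i).contMDiffAt_section_iff (IB := 𝓘(ℂ)) (n := ω) hb).1
          ((hs x hx).contMDiffAt (hU.mem_nhds hx))
        have h2 := contMDiffAt_real h1
        have h3 : ContMDiffAt 𝓘(ℝ, ℂ) 𝓘(ℝ, EuclideanSpace ℂ (Fin (Module.finrank ℂ F))) ∞
            (fun y => φ ((e i) ⟨y, s y⟩).2) x :=
          ((φ.toContinuousLinearMap.restrictScalars ℝ).contDiff.contDiffAt.contMDiffAt).comp x h2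
        refine h3.congr_of_eventuallyEq ?_
        filter_upwards [(e i).open_baseSet.mem_nhds hb] with y hy
        simp [L, (e i).coe_linearMapAt_of_mem (R := ℂ) hy]
      have hPi : ContMDiffAt 𝓘(ℝ, ℂ) 𝓘(ℝ, ℂ) ∞ (fun y => (P i y : ℂ)) x :=
        (Complex.ofRealCLM.contDiff.contDiffAt.contMDiffAt).comp x ((P i).contMDiff x)
      have hin : ContDiff ℝ ∞ (fun p : EuclideanSpace ℂ (Fin (Module.finrank ℂ F)) ×
          EuclideanSpace ℂ (Fin (Module.finrank ℂ F)) => (inner ℂ p.1 p.2 : ℂ)) := contDiff_inner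
      have h4 : ContMDiffAt 𝓘(ℝ, ℂ) 𝓘(ℝ, ℂ) ∞
          (fun y => (inner ℂ (L i y (s y)) (L i y (t y)) : ℂ)) x :=
        (hin.contDiffAt.contMDiffAt).comp x ((key s hs).prodMk_space (key t ht))
      have hmul : ContDiff ℝ ∞ (fun p : ℂ × ℂ => p.1 * p.2) := contDiff_mul
      exact (hmul.contDiffAt.contMDiffAt).comp x (hPi.prodMk_space h4)
    · have h0 : (fun y => (P i y : ℂ) * inner ℂ (L i y (s y)) (L i y (t y))) =ᶠ[𝓝 x]
          fun _ => (0 : ℂ) := by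
        filter_upwards [(isClosed_tsupport (P i)).isOpen_compl.mem_nhds hxi] with y hy
        rw [image_eq_zero_of_notMem_tsupport hy]
        simp
      exact contMDiffAt_const.congr_of_eventuallyEq h0

section Degree

variable {F E} [FiberBundle F E]

/-- The Gram determinant `det (h (s i) (s j))` at `x`. -/
def gramDet (h : HermitianMetric F E) {r : ℕ} (s : Fin r → ∀ x, E x) (x : X) : ℝ :=
  (Matrix.det (Matrix.of fun i j => h.inner x (s i x) (s j x))).re

/-- A holomorphic frame of `W` near `x`. -/
def HolSubbundle.frame {r : ℕ} (W : HolSubbundle F E r) (x : X) : Fin r → ∀ y, E y :=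
  (W.exists_frame x).choose_spec.2.2.choose

/-- The first Chern form `(i / 2π) ∂̄∂ log det (h (s i) (s j))` of `W`, for the metric induced by
`h`, is `chernDensity h W i z dx ∧ dy` in the chart at `i`, where `z = x + √-1 y`. Here `s` is any
holomorphic frame of `W` near the point under consideration (the form does not depend on it),
and `(i / 2π) ∂̄∂ u = - (1 / 4π) Δu dx ∧ dy`. -/
def chernDensity (h : HermitianMetric F E) {r : ℕ} (W : HolSubbundle F E r) (i : X) (z : ℂ) : ℝ :=
  -(1 / (4 * Real.pi)) * Laplacian.laplacian
    (fun w => Real.log (gramDet h (W.frame ((chartAt ℂ i).symm z)) ((chartAt ℂ i).symm w))) z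

/-- The integral over `X` of the first Chern form of `W`, computed with a Hermitian metric `h` and
a partition of unity `P`. -/
def chernNumber (h : HermitianMetric F E) (P : ChartPartition X) {r : ℕ}
    (W : HolSubbundle F E r) : ℝ :=
  ∑ᶠ i : X, ∫ z in (chartAt ℂ i).target, P.1 i ((chartAt ℂ i).symm z) * chernDensity h W i z

/-- The degree `c₁(W)` of a holomorphic subbundle `W` of `E` (in particular of `E` itself): the
integral of its first Chern form. It does not depend on the metric or on the partition of unity;
we use some choice of them. -/
def HolSubbundle.degree [IsManifold 𝓘(ℂ) ω X] [T2Space X] [CompactSpace X]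
    [FiniteDimensional ℂ F] [VectorBundle ℂ F E] [ContMDiffVectorBundle ω F E 𝓘(ℂ)]
    {r : ℕ} (W : HolSubbundle F E r) : ℝ :=
  chernNumber (Classical.choice (nonempty_hermitianMetric F E))
    (Classical.choice nonempty_chartPartition) W

end Degree

/-! ### Bundle pairs -/

variable [FiberBundle F E] [VectorBundle ℂ F E]
  [∀ x, IsTopologicalAddGroup (E x)] [∀ x, ContinuousSMul ℂ (E x)]

/-- `A` is a holomorphic section of the bundle `End(E)` over `U`. -/
def IsHolEndOn {E : X → Type*} [TopologicalSpace (TotalSpace F E)]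
    [∀ x, AddCommGroup (E x)] [∀ x, Module ℂ (E x)] [∀ x, TopologicalSpace (E x)]
    [FiberBundle F E] [VectorBundle ℂ F E]
    [∀ x, IsTopologicalAddGroup (E x)] [∀ x, ContinuousSMul ℂ (E x)]
    (A : ∀ x, E x →L[ℂ] E x) (U : Set X) : Prop :=
  ContMDiffOn 𝓘(ℂ) (𝓘(ℂ).prod 𝓘(ℂ, F →L[ℂ] F)) ω
    (fun x => TotalSpace.mk' (F →L[ℂ] F) (E := fun x => E x →L[ℂ] E x) x (A x)) U

/-- A bundle pair `(E, ρ)`: a meromorphic endomorphism `ρ` of `E` which is holomorphic and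
invertible outside a finite set `sing`. The values of `ρ` at the points of `sing`
carry no information. -/
structure BundlePair where
  ρ : ∀ x, E x →L[ℂ] E x
  sing : Set X
  finite_sing : sing.Finite
  holomorphic : IsHolEndOn F ρ singᶜ
  bijective : ∀ x ∉ sing, Function.Bijective (ρ x)
  meromorphic : ∀ p ∈ sing, ∃ U : Set X, IsOpen U ∧ p ∈ U ∧ U ⊆ (chartAt ℂ p).source ∧
    ∃ (m : ℕ) (A : ∀ x, E x →L[ℂ] E x), IsHolEndOn F A U ∧
      ∀ x ∈ U, x ≠ p → A x = (chartAt ℂ p x - chartAt ℂ p p) ^ m • ρ x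

namespace BundlePair

variable {F E}
variable (Q : BundlePair F E)

/-- `W` is `ρ`-invariant: `ρ` restricts to a meromorphic endomorphism of `W`. -/
def Invariant {r : ℕ} (W : HolSubbundle F E r) : Prop :=
  ∀ x ∉ Q.sing, ∀ v ∈ W.carrier x, Q.ρ x v ∈ W.carrier x

/-- Near `p`, the restriction of `ρ` to `W` has the form `G(z) diag(z ^ k₁, …, z ^ k_r) H(z)` with
`G` and `H` holomorphic and invertible, `z` being a coordinate centred at `p`. Equivalently, there
are holomorphic frames `s`, `s'` of `W` near `p` with `ρ (s a) = z ^ (k a) • s' a` off `p`. -/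
def HasExponentsAt {r : ℕ} (W : HolSubbundle F E r) (p : X) (k : Fin r → ℤ) : Prop :=
  ∃ U : Set X, IsOpen U ∧ p ∈ U ∧ U ⊆ (chartAt ℂ p).source ∧
    ∃ s s' : Fin r → ∀ x, E x, IsHolFrameOn F W.carrier s U ∧ IsHolFrameOn F W.carrier s' U ∧
      ∀ x ∈ U, x ≠ p → ∀ a, Q.ρ x (s a x) = (chartAt ℂ p x - chartAt ℂ p p) ^ k a • s' a x

/-- `(W, ρ|_W)` has type `((k₁, z₁), …, (k_N, z_N))`, where the `z j` are distinct points and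
enumerate the singular set of `ρ`. (If `ρ|_W` is regular at `z j`, then `k j = 0`.) -/
structure HasType {r N : ℕ} (W : HolSubbundle F E r) (z : Fin N → X)
    (k : Fin N → Fin r → ℤ) : Prop where
  injective : Function.Injective z
  range_eq : Set.range z = Q.sing
  exponents : ∀ j, Q.HasExponentsAt W (z j) (k j)

section Stability

variable [IsManifold 𝓘(ℂ) ω X] [T2Space X] [CompactSpace X]
  [FiniteDimensional ℂ F] [ContMDiffVectorBundle ω F E 𝓘(ℂ)]

/-- The `t`-degree `c₁(W) - (∑ⱼ tr(kⱼ) tⱼ) / T` of a pair `(W, ρ|_W)` of type `(k, z)`. -/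
def tDegree {r N : ℕ} (t : Fin N → ℝ) (T : ℝ) (W : HolSubbundle F E r)
    (k : Fin N → Fin r → ℤ) : ℝ :=
  W.degree - (∑ j, ((∑ a, k j a : ℤ) : ℝ) * t j) / T

/-- The `t`-slope: the `t`-degree divided by the rank. -/
def tSlope {r N : ℕ} (t : Fin N → ℝ) (T : ℝ) (W : HolSubbundle F E r)
    (k : Fin N → Fin r → ℤ) : ℝ :=
  tDegree t T W k / r

/-- `t`-stability of a bundle pair `(E, ρ)` of type `(k, z)`: every `ρ`-invariant
subbundle `W` with `0 < rank W < rank E` has `t`-slope smaller than that of `E`. -/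
def IsStable {N : ℕ} (t : Fin N → ℝ) (T : ℝ) (z : Fin N → X)
    (k : Fin N → Fin (Module.finrank ℂ F) → ℤ) : Prop :=
  ∀ r : ℕ, 0 < r → r < Module.finrank ℂ F → ∀ W : HolSubbundle F E r, Q.Invariant W →
    ∀ l : Fin N → Fin r → ℤ, Q.HasType W z l →
      tSlope t T W l < tSlope t T (HolSubbundle.full F E) k

end Stability

/-- `(E, ρ)` is simple: every holomorphic section of `End(E)` commuting with `ρ` is a constant
multiple of the identity. -/
def IsSimple : Prop :=
  ∀ σ : ∀ x, E x →L[ℂ] E x, IsHolEndOn F σ Set.univ →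
    (∀ x ∉ Q.sing, (σ x).comp (Q.ρ x) = (Q.ρ x).comp (σ x)) →
    ∃ c : ℂ, ∀ x, σ x = c • ContinuousLinearMap.id ℂ (E x)

end BundlePair

end BundlePairs

end

/-! Stability leaves no room for a nonzero endomorphism that commutes with `ρ` and has vanishing
determinant. If `σ` commutes with `ρ` and `c` is an eigenvalue of `σ` in one fibre, put `τ = σ - c`.
The function `det τ` is holomorphic on a compact connected surface, hence constant
(`det_eq_of_holEndAt`), hence zero, and `τ = 0` follows (`IsStable.eq_zero_of_det_eq_zero`).

Germs of analytic functions form a discrete valuation ring, so near each point `τ` is diagonal in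
two frames `v` and `p`, with `r` entries `0` and `m` entries `z ^ d a`. Connectedness makes `r` and
`m` global (`exists_forall_hasSmithFormAt`). The kernel and image of `τ` may jump where some `d a`
is positive, but the kernel part of `v` and the image part of `p` stay independent there and span
the saturations `K` and `I`. These are `ρ`-invariant subbundles of ranks `r` and `m`, with `r + m =
n`. Since `det τ = 0`, `r > 0`. If also `m > 0`, stability bounds both slopes strictly by that of
`E`, so `δ(K) + δ(I) < δ(E)`.

The opposite inequality (`tDegree_le_add`) has two halves. The exponents of `ρ` add up at each
singular point, because nearby `det ρ` is the product of its determinants on `ker τ` and on `im τ ≅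
E / ker τ` (`sum_exponents_eq`). And `deg E ≤ deg K + deg I` (`chernNumber_le_add`), because `τ`
induces a map `E / K → I` whose determinant is not identically zero.

For the degree as an integral of Chern forms, the squared norm of that determinant is a global
function `f`, locally `|m|² g` with `m` holomorphic and `g > 0`, and `-(1 / 4π) Δ log g` is the
Chern density of `K` plus that of `I` minus that of `E`. It remains to see that `Δ log g` has
nonpositive integral (`ChartPartition.sum_integral_nonpos`). Off the zeros of `f` it equals `Δ log
f`. Since `Δ log (f + ε) ≥ f / (f + ε) · Δ log f`, and `Δ log (f + ε)` integrates to zero by Stokes,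
the limit `ε → 0` gives the claim without counting zeros. -/

set_option linter.unusedSectionVars false

noncomputable section

namespace BundlePairs

/-! ### Smith normal form for analytic matrices -/

section Smith

/-- The ring of germs at `z₀` of analytic functions on `ℂ`. -/
def analyticGerms (z₀ : ℂ) : Subring ((𝓝 z₀).Germ ℂ) where
  carrier := {g | ∃ f : ℂ → ℂ, AnalyticAt ℂ f z₀ ∧ (f : (𝓝 z₀).Germ ℂ) = g}
  mul_mem' := by
    rintro _ _ ⟨f, hf, rfl⟩ ⟨g, hg, rfl⟩
    exact ⟨f * g, hf.mul hg, rfl⟩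
  one_mem' := ⟨1, analyticAt_const, rfl⟩
  add_mem' := by
    rintro _ _ ⟨f, hf, rfl⟩ ⟨g, hg, rfl⟩
    exact ⟨f + g, hf.add hg, rfl⟩
  zero_mem' := ⟨0, analyticAt_const, rfl⟩
  neg_mem' := by
    rintro _ ⟨f, hf, rfl⟩
    exact ⟨-f, hf.neg, rfl⟩

/-- The type of germs at `z₀` of analytic functions on `ℂ`. -/
abbrev AnalyticGerm (z₀ : ℂ) : Type := analyticGerms z₀

namespace AnalyticGerm

variable {z₀ : ℂ}

/-- The germ of an analytic function. -/
def mk (f : ℂ → ℂ) (hf : AnalyticAt ℂ f z₀) : AnalyticGerm z₀ := ⟨f, f, hf, rfl⟩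

/-- A function representing a germ. -/
def rep (g : AnalyticGerm z₀) : ℂ → ℂ := g.2.choose

theorem analyticAt_rep (g : AnalyticGerm z₀) : AnalyticAt ℂ g.rep z₀ := g.2.choose_spec.1

theorem coe_rep (g : AnalyticGerm z₀) : (g.rep : (𝓝 z₀).Germ ℂ) = g := g.2.choose_spec.2

theorem eq_iff {g h : AnalyticGerm z₀} : g = h ↔ g.rep =ᶠ[𝓝 z₀] h.rep := by
  rw [← Filter.Germ.coe_eq, coe_rep, coe_rep, Subtype.ext_iff]

theorem rep_mk {f : ℂ → ℂ} (hf : AnalyticAt ℂ f z₀) : (mk f hf).rep =ᶠ[𝓝 z₀] f := by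
  rw [← Filter.Germ.coe_eq, coe_rep]; rfl

theorem rep_add (g h : AnalyticGerm z₀) : (g + h).rep =ᶠ[𝓝 z₀] g.rep + h.rep := by
  rw [← Filter.Germ.coe_eq, coe_rep, Filter.Germ.coe_add, coe_rep, coe_rep]; rfl

theorem rep_mul (g h : AnalyticGerm z₀) : (g * h).rep =ᶠ[𝓝 z₀] g.rep * h.rep := by
  rw [← Filter.Germ.coe_eq, coe_rep, Filter.Germ.coe_mul, coe_rep, coe_rep]; rfl

theorem rep_zero : (0 : AnalyticGerm z₀).rep =ᶠ[𝓝 z₀] 0 := by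
  rw [← Filter.Germ.coe_eq, coe_rep]; rfl

theorem rep_one : (1 : AnalyticGerm z₀).rep =ᶠ[𝓝 z₀] 1 := by
  rw [← Filter.Germ.coe_eq, coe_rep]; rfl

theorem rep_sum {ι : Type*} (s : Finset ι) (g : ι → AnalyticGerm z₀) :
    (∑ i ∈ s, g i).rep =ᶠ[𝓝 z₀] ∑ i ∈ s, (g i).rep := by
  classical
  induction s using Finset.induction_on with
  | empty => simpa using rep_zero
  | insert a s ha ih =>
    rw [Finset.sum_insert ha, Finset.sum_insert ha]
    exact (rep_add _ _).trans (Filter.EventuallyEq.rfl.add ih)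

/-- Evaluation of a germ at the base point. -/
def eval : AnalyticGerm z₀ →+* ℂ where
  toFun g := g.rep z₀
  map_one' := rep_one.self_of_nhds
  map_mul' g h := (rep_mul g h).self_of_nhds
  map_zero' := rep_zero.self_of_nhds
  map_add' g h := (rep_add g h).self_of_nhds

theorem eval_apply (g : AnalyticGerm z₀) : eval g = g.rep z₀ := rfl

theorem isUnit_of_eval_ne_zero {g : AnalyticGerm z₀} (hg : eval g ≠ 0) : IsUnit g := by
  have hg' : g.rep z₀ ≠ 0 := hg
  refine IsUnit.of_mul_eq_one (mk _ (g.analyticAt_rep.inv hg')) (eq_iff.2 ?_)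
  filter_upwards [rep_mul g (mk _ (g.analyticAt_rep.inv hg')), rep_mk (g.analyticAt_rep.inv hg'),
    rep_one (z₀ := z₀), g.analyticAt_rep.continuousAt.eventually_ne hg'] with z h1 h2 h3 h4
  rw [h1, h3, Pi.mul_apply, h2]
  exact mul_inv_cancel₀ h4

/-- The germ of the coordinate centred at the base point. -/
def coord : AnalyticGerm z₀ := mk (fun z => z - z₀) (analyticAt_id.sub analyticAt_const)

theorem rep_coord_pow (n : ℕ) :
    (coord ^ n : AnalyticGerm z₀).rep =ᶠ[𝓝 z₀] fun z => (z - z₀) ^ n := by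
  induction n with
  | zero =>
    simp only [pow_zero]
    exact rep_one
  | succ n ih =>
    rw [pow_succ]
    filter_upwards [rep_mul (coord ^ n) (coord (z₀ := z₀)), ih,
      rep_mk (analyticAt_id.sub analyticAt_const : AnalyticAt ℂ (fun z => z - z₀) z₀)] with z h1 h2 h3
    rw [h1, Pi.mul_apply, h2, pow_succ]
    exact congrArg _ h3

/-- Factor out the order of vanishing at `z₀`: what remains is nonzero there, hence a unit. This
factorization drives the valuation ring structure and supplies the powers `z ^ d` of the Smith form.
-/
theorem exists_associated {g : AnalyticGerm z₀} (hg : g ≠ 0) :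
    ∃ n : ℕ, Associated (coord ^ n) g := by
  have h1 : ¬ ∀ᶠ z in 𝓝 z₀, g.rep z = 0 := fun h =>
    hg (eq_iff.2 (Filter.EventuallyEq.trans h rep_zero.symm))
  obtain ⟨n, u, hu, hu0, hn⟩ := g.analyticAt_rep.exists_eventuallyEq_pow_smul_nonzero_iff.2 h1
  have hU : IsUnit (mk u hu) := isUnit_of_eval_ne_zero (by
    rw [eval_apply, (rep_mk hu).self_of_nhds]; exact hu0)
  refine ⟨n, hU.unit, eq_iff.2 ?_⟩
  filter_upwards [rep_mul (coord ^ n) (mk u hu), rep_coord_pow (z₀ := z₀) n, rep_mk hu, hn]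
    with z h1 h2 h3 h4
  rw [IsUnit.unit_spec, h1, Pi.mul_apply, h2, h3, h4, smul_eq_mul]

theorem coord_ne_zero : (coord : AnalyticGerm z₀) ≠ 0 := by
  intro h
  have h1 := (rep_coord_pow (z₀ := z₀) 1).symm
  rw [pow_one, h] at h1
  have h2 := (h1.trans rep_zero).deriv_eq
  simp at h2

/-- If two factors both vanished at `z₀`, their product would have derivative zero there, while the
coordinate has derivative one. -/
theorem irreducible_coord : Irreducible (coord : AnalyticGerm z₀) := by
  have hrep := (rep_coord_pow (z₀ := z₀) 1)
  rw [pow_one] at hrep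
  refine ⟨fun h => ?_, fun a b hab => ?_⟩
  · have h1 := h.map (eval (z₀ := z₀))
    rw [eval_apply, hrep.self_of_nhds] at h1
    simp at h1
  · by_contra! hcon
    have ha : a.rep z₀ = 0 := by_contra fun h => hcon.1 (isUnit_of_eval_ne_zero h)
    have hb : b.rep z₀ = 0 := by_contra fun h => hcon.2 (isUnit_of_eval_ne_zero h)
    have h1 := (hrep.symm.trans (hab ▸ rep_mul a b)).deriv_eq
    rw [deriv_mul a.analyticAt_rep.differentiableAt b.analyticAt_rep.differentiableAt, ha, hb] at h1
    simp at h1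

instance : IsDomain (AnalyticGerm z₀) := by
  have : Nontrivial (AnalyticGerm z₀) := ⟨⟨_, _, coord_ne_zero⟩⟩
  have : NoZeroDivisors (AnalyticGerm z₀) := by
    refine ⟨fun {a b} hab => ?_⟩
    by_contra! hcon
    obtain ⟨n, u, hu⟩ := exists_associated hcon.1
    obtain ⟨m, v, hv⟩ := exists_associated hcon.2
    -- A product of two nonzero germs is a unit times a power of the coordinate, so if it vanishes
    -- then so does that power.
    have h1 : (coord : AnalyticGerm z₀) ^ (n + m) = 0 := by
      have : (coord : AnalyticGerm z₀) ^ (n + m) * (u * v : (AnalyticGerm z₀)ˣ) = 0 := by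
        rw [← hab, ← hu, ← hv]; push_cast; ring
      exact (Units.mul_left_eq_zero _).1 this
    have h2 := (rep_coord_pow (z₀ := z₀) (n + m)).symm
    rw [h1] at h2
    have h3 : ∀ᶠ z in 𝓝[≠] z₀, (z - z₀) ^ (n + m) = 0 :=
      (h2.trans rep_zero).filter_mono nhdsWithin_le_nhds
    obtain ⟨z, h4, h5⟩ := (h3.and self_mem_nhdsWithin).exists
    exact pow_ne_zero _ (sub_ne_zero.2 h5) h4
  exact NoZeroDivisors.to_isDomain _

instance : IsDiscreteValuationRing (AnalyticGerm z₀) :=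
  IsDiscreteValuationRing.ofHasUnitMulPowIrreducibleFactorization
    ⟨coord, irreducible_coord, fun {_} hx => exists_associated hx⟩

end AnalyticGerm

open Module in
/-- Smith normal form of an endomorphism of a free module over a discrete valuation ring. -/
theorem exists_basis_smith {R M : Type*} [CommRing R] [IsDomain R] [IsDiscreteValuationRing R]
    [AddCommGroup M] [Module R M] [Module.Free R M] [Module.Finite R M] {ϖ : R}
    (hϖ : ∀ x : R, x ≠ 0 → ∃ n : ℕ, Associated (ϖ ^ n) x) (A : M →ₗ[R] M) :
    ∃ (r m : ℕ) (b c : Basis (Fin r ⊕ Fin m) R M) (d : Fin m → ℕ),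
      (∀ a, A (b (Sum.inl a)) = 0) ∧ ∀ a, A (b (Sum.inr a)) = ϖ ^ d a • c (Sum.inr a) := by
  classical
  let b₀ := Module.Free.chooseBasis R M
  obtain ⟨m, snf⟩ := Submodule.smithNormalForm b₀ (LinearMap.range A)
  -- The range is free, so `A` splits over it: lifts of a basis of the range and a basis of the
  -- kernel together form a basis of `M`.
  have hlift : ∀ a, ∃ q, A q = snf.bN a := fun a => (snf.bN a).2
  choose q hq using hlift
  let K := LinearMap.ker A
  let bK := Module.finBasis R K
  have hli : LinearIndependent R (fun a => A (q a)) := by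
    simp only [hq]
    exact snf.bN.linearIndependent.map' (Submodule.subtype _) (Submodule.ker_subtype _)
  have hsum : LinearIndependent R (Sum.elim (fun a => (bK a : M)) q) := by
    refine LinearIndependent.sum_type
      (bK.linearIndependent.map' K.subtype (Submodule.ker_subtype _)) (LinearIndependent.of_comp A hli) ?_
    rw [Submodule.disjoint_def]
    intro x hx1 hx2
    have hxK : A x = 0 := by
      have : Submodule.span R (Set.range fun a => (bK a : M)) ≤ K :=
        Submodule.span_le.2 (by rintro _ ⟨a, rfl⟩; exact (bK a).2)
      exact this hx1
    obtain ⟨g, rfl⟩ := (Submodule.mem_span_range_iff_exists_fun R).1 hx2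
    rw [map_sum] at hxK
    simp only [map_smul] at hxK
    have := Fintype.linearIndependent_iff.1 hli g hxK
    simp [this]
  have hspan : ⊤ ≤ Submodule.span R (Set.range (Sum.elim (fun a => (bK a : M)) q)) := by
    intro x _
    rw [Set.Sum.elim_range, Submodule.span_union]
    have h1 : (⟨A x, x, rfl⟩ : LinearMap.range A) = ∑ a, snf.bN.repr ⟨A x, x, rfl⟩ a • snf.bN a :=
      (snf.bN.sum_repr _).symm
    set g := snf.bN.repr ⟨A x, x, rfl⟩
    have h2 : A (x - ∑ a, g a • q a) = 0 := by
      have := congrArg Subtype.val h1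
      simp only [Submodule.coe_sum, Submodule.coe_smul] at this
      rw [map_sub, map_sum, this, sub_eq_zero]
      exact Finset.sum_congr rfl fun a _ => by rw [map_smul, hq]
    have h3 : x = (x - ∑ a, g a • q a) + ∑ a, g a • q a := by abel
    rw [h3]
    refine Submodule.add_mem_sup ?_ (Submodule.sum_mem _ fun a _ =>
      Submodule.smul_mem _ _ (Submodule.subset_span ⟨a, rfl⟩))
    have h4 := bK.sum_repr ⟨_, h2⟩
    have h5 := congrArg Subtype.val h4
    simp only [Submodule.coe_sum, Submodule.coe_smul] at h5
    rw [← h5]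
    exact Submodule.sum_mem _ fun a _ => Submodule.smul_mem _ _ (Submodule.subset_span ⟨a, rfl⟩)
  let b : Basis (Fin (finrank R K) ⊕ Fin m) R M := Basis.mk hsum hspan
  have ha : ∀ a, snf.a a ≠ 0 := by
    intro a h0
    have := snf.snf a
    rw [h0, zero_smul] at this
    exact snf.bN.ne_zero a (Subtype.ext this)
  choose d u hu using fun a => hϖ _ (ha a)
  -- There are as many vectors of `snf.bM` outside the image of `snf.f` as kernel vectors, so both
  -- bases can share one index type.
  have hcard : Fintype.card {j // j ∉ Set.range snf.f} = finrank R K := by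
    have h1 : finrank R M = finrank R K + m := by
      rw [finrank_eq_card_basis b]; simp
    have h2 : finrank R M = Fintype.card (Free.ChooseBasisIndex R M) := finrank_eq_card_basis b₀
    have h3 : Fintype.card {j // j ∈ Set.range snf.f} = m := by
      rw [← Fintype.card_congr (Equiv.ofInjective _ snf.f.injective), Fintype.card_fin]
    have h4 := Fintype.card_subtype_compl (fun j => j ∈ Set.range snf.f)
    omega
  let e : Free.ChooseBasisIndex R M ≃ Fin (finrank R K) ⊕ Fin m :=
    (Equiv.sumCompl (fun j => j ∈ Set.range snf.f)).symm.trans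
      ((Equiv.sumComm _ _).trans (Equiv.sumCongr (Fintype.equivFinOfCardEq hcard)
        (Equiv.ofInjective _ snf.f.injective).symm))
  have he : ∀ a, e.symm (Sum.inr a) = snf.f a := fun a => by
    simp [e]
  -- Rescaling by the units `u` makes the elementary divisors exact powers of `ϖ`.
  let c : Basis (Fin (finrank R K) ⊕ Fin m) R M :=
    (snf.bM.reindex e).unitsSMul (Sum.elim (fun _ => 1) u)
  refine ⟨_, m, b, c, d, fun a => ?_, fun a => ?_⟩
  · simp only [b, Basis.mk_apply, Sum.elim_inl]
    exact (bK a).2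
  · simp only [b, Basis.mk_apply, Sum.elim_inr, c, Basis.unitsSMul_apply, Basis.reindex_apply, he]
    rw [hq, snf.snf, Units.smul_def, smul_smul, hu]

/-- Smith normal form of a matrix of analytic functions near a point. -/
theorem exists_analytic_smith {n : ℕ} {z₀ : ℂ} (A : Fin n → Fin n → ℂ → ℂ)
    (hA : ∀ i j, AnalyticAt ℂ (A i j) z₀) :
    ∃ (r m : ℕ) (Q P : Fin r ⊕ Fin m → Fin n → ℂ → ℂ) (d : Fin m → ℕ),
      r + m = n ∧ (∀ a j, AnalyticAt ℂ (Q a j) z₀) ∧ (∀ a j, AnalyticAt ℂ (P a j) z₀) ∧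
      LinearIndependent ℂ (fun a j => Q a j z₀) ∧ LinearIndependent ℂ (fun a j => P a j z₀) ∧
      ∀ᶠ z in 𝓝 z₀, (∀ a i, ∑ j, A i j z * Q (Sum.inl a) j z = 0) ∧
        ∀ a i, ∑ j, A i j z * Q (Sum.inr a) j z = (z - z₀) ^ d a * P (Sum.inr a) i z := by
  classical
  let A' : Matrix (Fin n) (Fin n) (AnalyticGerm z₀) :=
    Matrix.of fun i j => AnalyticGerm.mk (A i j) (hA i j)
  obtain ⟨r, m, b, c, d, h0, h1⟩ := exists_basis_smith (ϖ := AnalyticGerm.coord)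
    (fun _ h => AnalyticGerm.exists_associated h) A'.toLin'
  have hcard : r + m = n := by
    have h2 := Module.finrank_eq_card_basis b
    have h3 := Module.finrank_eq_card_basis (Pi.basisFun (AnalyticGerm z₀) (Fin n))
    simp only [Fintype.card_sum, Fintype.card_fin] at h2 h3
    omega
  let e : Fin n ≃ Fin r ⊕ Fin m := (finCongr hcard.symm).trans finSumFinEquiv.symm
  -- A basis over the germs has unit determinant, and evaluation at `z₀` keeps it a unit.
  have hind : ∀ b : Module.Basis (Fin r ⊕ Fin m) (AnalyticGerm z₀) (Fin n → AnalyticGerm z₀),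
      LinearIndependent ℂ (fun a j => (b a j).rep z₀) := by
    intro b
    let B : Matrix (Fin n) (Fin n) (AnalyticGerm z₀) := Matrix.of fun i j => b (e i) j
    have h2 : IsUnit B.det := by
      have h3 := (Pi.basisFun (AnalyticGerm z₀) (Fin n)).isUnit_det (b.reindex e.symm)
      rw [Module.Basis.det_apply, ← Matrix.det_transpose] at h3
      convert h3 using 2
      ext i j
      simp [B, Module.Basis.toMatrix_apply, Matrix.transpose_apply]
    have h3 := h2.map (AnalyticGerm.eval (z₀ := z₀))
    rw [RingHom.map_det, ← Matrix.isUnit_iff_isUnit_det,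
      ← Matrix.linearIndependent_rows_iff_isUnit] at h3
    have h4 := h3.comp e.symm e.symm.injective
    have h5 : ((AnalyticGerm.eval (z₀ := z₀)).mapMatrix B).row ∘ e.symm =
        fun a j => (b a j).rep z₀ := by
      ext a j
      have : e (e.symm a) = a := e.apply_symm_apply a
      change AnalyticGerm.eval (b (e (e.symm a)) j) = _
      rw [this]
      rfl
    exact h5 ▸ h4
  have key : ∀ (i : Fin n) (v : Fin n → AnalyticGerm z₀), ∀ᶠ z in 𝓝 z₀,
      ∑ j, A i j z * (v j).rep z = (A'.toLin' v i).rep z := by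
    intro i v
    have h2 : A'.toLin' v i = ∑ j, AnalyticGerm.mk (A i j) (hA i j) * v j := rfl
    rw [h2]
    have h3 : ∀ᶠ z in 𝓝 z₀, ∀ j, (AnalyticGerm.mk (A i j) (hA i j) * v j).rep z
        = A i j z * (v j).rep z := by
      refine Filter.eventually_all.2 fun j => ?_
      filter_upwards [AnalyticGerm.rep_mul (AnalyticGerm.mk (A i j) (hA i j)) (v j),
        AnalyticGerm.rep_mk (hA i j)] with z h4 h5
      rw [h4, Pi.mul_apply, h5]
    filter_upwards [h3, AnalyticGerm.rep_sum Finset.univ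
      fun j => AnalyticGerm.mk (A i j) (hA i j) * v j] with z h4 h5
    rw [h5, Finset.sum_apply]
    exact Finset.sum_congr rfl fun j _ => (h4 j).symm
  refine ⟨r, m, fun a j => (b a j).rep, fun a j => (c a j).rep, d, hcard,
    fun a j => AnalyticGerm.analyticAt_rep _, fun a j => AnalyticGerm.analyticAt_rep _,
    hind b, hind c, ?_⟩
  have k0 : ∀ᶠ z in 𝓝 z₀, ∀ a i, ∑ j, A i j z * (b (Sum.inl a) j).rep z = 0 := by
    refine Filter.eventually_all.2 fun a => Filter.eventually_all.2 fun i => ?_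
    filter_upwards [key i (b (Sum.inl a)), AnalyticGerm.rep_zero (z₀ := z₀)] with z h2 h3
    rw [h2, h0, Pi.zero_apply, h3, Pi.zero_apply]
  have k1 : ∀ᶠ z in 𝓝 z₀, ∀ a i, ∑ j, A i j z * (b (Sum.inr a) j).rep z =
      (z - z₀) ^ d a * (c (Sum.inr a) i).rep z := by
    refine Filter.eventually_all.2 fun a => Filter.eventually_all.2 fun i => ?_
    filter_upwards [key i (b (Sum.inr a)), AnalyticGerm.rep_mul (AnalyticGerm.coord ^ d a)
      (c (Sum.inr a) i), AnalyticGerm.rep_coord_pow (z₀ := z₀) (d a)] with z h2 h3 h4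
    rw [h2, h1, Pi.smul_apply, smul_eq_mul, h3, Pi.mul_apply, h4]
  exact k0.and k1

end Smith

/-! ### Holomorphic functions and frames near a point -/

section Functions

variable {X : Type*} [TopologicalSpace X] [ChartedSpace ℂ X]

/-- `c` is holomorphic near `x`. -/
abbrev HolFunAt (c : X → ℂ) (x : X) : Prop := ContMDiffAt 𝓘(ℂ) 𝓘(ℂ) ω c x

theorem HolFunAt.mul {c d : X → ℂ} {x : X} (hc : HolFunAt c x) (hd : HolFunAt d x) :
    HolFunAt (fun y => c y * d y) x :=
  (contDiff_mul.contDiffAt.contMDiffAt (n := ω)).comp x (hc.prodMk_space hd)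

theorem HolFunAt.sum {ι : Type*} {s : Finset ι} {c : ι → X → ℂ} {x : X}
    (hc : ∀ i ∈ s, HolFunAt (c i) x) : HolFunAt (fun y => ∑ i ∈ s, c i y) x :=
  ContMDiffAt.sum hc

theorem HolFunAt.prod {ι : Type*} {s : Finset ι} {c : ι → X → ℂ} {x : X}
    (hc : ∀ i ∈ s, HolFunAt (c i) x) : HolFunAt (fun y => ∏ i ∈ s, c i y) x := by
  classical
  induction s using Finset.induction_on with
  | empty => simpa using contMDiffAt_const
  | insert a s ha ih =>
    simp only [Finset.prod_insert ha]
    exact (hc a (Finset.mem_insert_self _ _)).mul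
      (ih fun i hi => hc i (Finset.mem_insert_of_mem hi))

theorem HolFunAt.det {ι : Type*} [Fintype ι] [DecidableEq ι] {C : X → Matrix ι ι ℂ} {x : X}
    (hC : ∀ i j, HolFunAt (fun y => C y i j) x) : HolFunAt (fun y => (C y).det) x := by
  simp only [Matrix.det_apply']
  exact HolFunAt.sum fun σ _ => contMDiffAt_const.mul (HolFunAt.prod fun i _ => hC _ _)

theorem HolFunAt.inv {c : X → ℂ} {x : X} (hc : HolFunAt c x) (h0 : c x ≠ 0) :
    HolFunAt (fun y => (c y)⁻¹) x :=
  ((contDiffAt_inv ℂ h0).contMDiffAt (n := ω)).comp x hc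

theorem HolFunAt.matrix_inv {ι : Type*} [Fintype ι] [DecidableEq ι] {C : X → Matrix ι ι ℂ} {x : X}
    (hC : ∀ i j, HolFunAt (fun y => C y i j) x) (h0 : (C x).det ≠ 0) (i j : ι) :
    HolFunAt (fun y => (C y)⁻¹ i j) x := by
  -- Cramer's rule.
  have h1 : (fun y => (C y)⁻¹ i j) = fun y => ((C y).det)⁻¹ * ((C y).updateRow j (Pi.single i 1)).det := by
    ext y
    rw [Matrix.inv_def, Matrix.smul_apply, Matrix.adjugate_apply, smul_eq_mul, Ring.inverse_eq_inv]
  rw [h1]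
  refine ((HolFunAt.det hC).inv h0).mul (HolFunAt.det fun a b => ?_)
  by_cases h : a = j
  · subst h
    simpa using contMDiffAt_const
  · simpa [Matrix.updateRow_ne h] using hC a b

variable [IsManifold 𝓘(ℂ) ω X]

theorem holFunAt_chart {x y : X} (hy : y ∈ (chartAt ℂ x).source) :
    HolFunAt (fun z => chartAt ℂ x z) y :=
  contMDiffAt_extChartAt' (I := 𝓘(ℂ)) hy

theorem holFunAt_comp_chart {g : ℂ → ℂ} {x y : X} (hy : y ∈ (chartAt ℂ x).source)
    (hg : AnalyticAt ℂ g (chartAt ℂ x y)) : HolFunAt (fun z => g (chartAt ℂ x z)) y :=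
  (hg.contDiffAt.contMDiffAt (n := ω)).comp y (holFunAt_chart hy)

theorem HolFunAt.analyticAt {c : X → ℂ} {i x : X} (hx : x ∈ (chartAt ℂ i).source)
    (hc : HolFunAt c x) :
    AnalyticAt ℂ (fun w => c ((chartAt ℂ i).symm w)) (chartAt ℂ i x) := by
  have h1 : ContMDiffAt 𝓘(ℂ) 𝓘(ℂ) ω (chartAt ℂ i).symm (chartAt ℂ i x) :=
    contMDiffOn_chart_symm.contMDiffAt
      ((chartAt ℂ i).open_target.mem_nhds ((chartAt ℂ i).map_source hx))
  have h2 : ContMDiffAt 𝓘(ℂ) 𝓘(ℂ) ω (c ∘ (chartAt ℂ i).symm) (chartAt ℂ i x) := by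
    refine ContMDiffAt.comp _ ?_ h1
    rwa [(chartAt ℂ i).left_inv hx]
  exact h2.contDiffAt.analyticAt

-- Points of `ℂ` are not isolated, and charts carry this to `X`. Limits along punctured
-- neighbourhoods, and the choice of points in them, depend on it.
omit [IsManifold 𝓘(ℂ) ω X] in
theorem neBot_nhdsNE (x : X) : (𝓝[≠] x).NeBot := by
  rw [← mem_closure_iff_nhdsWithin_neBot]
  rw [mem_closure_iff_nhds]
  intro U hU
  have h1 : (chartAt ℂ x).symm ⁻¹' U ∈ 𝓝 (chartAt ℂ x x) :=
    (chartAt ℂ x).tendsto_symm (mem_chart_source ℂ x) hU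
  have h2 := (chartAt ℂ x).open_target.mem_nhds (mem_chart_target ℂ x)
  obtain ⟨w, ⟨hw1, hw2⟩, hw3⟩ :=
    ((eventually_nhdsWithin_of_eventually_nhds (Filter.inter_mem h1 h2)).and
      (self_mem_nhdsWithin : _ ∈ 𝓝[≠] (chartAt ℂ x x))).exists
  refine ⟨_, hw1, fun h => hw3 ?_⟩
  rw [Set.mem_singleton_iff, ← (chartAt ℂ x).right_inv hw2, h]

end Functions

/-! ### Sections and frames of a holomorphic bundle near a point -/

section Frames

variable {X : Type*} [TopologicalSpace X] [ChartedSpace ℂ X]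
  (F : Type*) [NormedAddCommGroup F] [NormedSpace ℂ F]
  {E : X → Type*} [TopologicalSpace (TotalSpace F E)]
  [∀ x, AddCommGroup (E x)] [∀ x, Module ℂ (E x)] [∀ x, TopologicalSpace (E x)]
  [FiberBundle F E]

/-- `s` is a holomorphic section of `E` near `x`. -/
def HolAt (s : ∀ x, E x) (x : X) : Prop :=
  ContMDiffAt 𝓘(ℂ) (𝓘(ℂ).prod 𝓘(ℂ, F)) ω (fun y => TotalSpace.mk' F y (s y)) x

/-- `A` maps holomorphic sections near `x` to holomorphic sections near `x`. -/
def HolEndAt (A : ∀ x, E x →ₗ[ℂ] E x) (x : X) : Prop :=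
  ∀ s : ∀ x, E x, HolAt F s x → HolAt F (fun y => A y (s y)) x

/-- `s` is a holomorphic frame near `x` of the family of subspaces `W`. -/
structure IsFrameAt {ι : Type*} (W : ∀ x, Submodule ℂ (E x)) (s : ι → ∀ x, E x) (x : X) :
    Prop where
  holAt : ∀ i, HolAt F (s i) x
  basis : ∀ᶠ y in 𝓝 x, LinearIndependent ℂ (fun i => s i y) ∧
    Submodule.span ℂ (Set.range fun i => s i y) = W y

variable {F}

theorem IsHolSectionOn.holAt {s : ∀ x, E x} {U : Set X} (hs : IsHolSectionOn F s U) {x : X}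
    (hU : U ∈ 𝓝 x) : HolAt F s x :=
  ContMDiffOn.contMDiffAt hs hU

theorem IsHolFrameOn.isFrameAt {r : ℕ} {W : ∀ x, Submodule ℂ (E x)} {s : Fin r → ∀ x, E x}
    {U : Set X} (h : IsHolFrameOn F W s U) (hU : IsOpen U) {x : X} (hx : x ∈ U) :
    IsFrameAt F W s x where
  holAt i := (h.holomorphic i).holAt (hU.mem_nhds hx)
  basis := by
    filter_upwards [hU.mem_nhds hx] with y hy
    exact ⟨h.linearIndependent y hy, h.span_eq y hy⟩

theorem IsFrameAt.congr {ι : Type*} {W W' : ∀ x, Submodule ℂ (E x)} {s : ι → ∀ x, E x} {x : X}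
    (h : IsFrameAt F W s x) (hW : ∀ᶠ y in 𝓝 x, W y = W' y) : IsFrameAt F W' s x where
  holAt := h.holAt
  basis := by
    filter_upwards [h.basis, hW] with y h1 h2
    exact ⟨h1.1, h1.2.trans h2⟩

theorem IsFrameAt.reindex {ι κ : Type*} {W : ∀ x, Submodule ℂ (E x)} {s : ι → ∀ x, E x} {x : X}
    (h : IsFrameAt F W s x) (e : κ ≃ ι) : IsFrameAt F W (fun i => s (e i)) x where
  holAt i := h.holAt (e i)
  basis := by
    filter_upwards [h.basis] with y h1
    refine ⟨h1.1.comp e e.injective, ?_⟩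
    rw [← h1.2]
    congr 1
    exact e.surjective.range_comp fun i => s i y

theorem HolSubbundle.isFrameAt {r : ℕ} (W : HolSubbundle F E r) (x : X) :
    IsFrameAt F W.carrier (W.frame x) x :=
  (W.exists_frame x).choose_spec.2.2.choose_spec.isFrameAt (W.exists_frame x).choose_spec.1
    (W.exists_frame x).choose_spec.2.1

section Eventually

variable [IsManifold 𝓘(ℂ) ω X] [VectorBundle ℂ F E] [ContMDiffVectorBundle ω F E 𝓘(ℂ)]

theorem HolAt.eventually {s : ∀ x, E x} {x : X} (hs : HolAt F s x) :
    ∀ᶠ y in 𝓝 x, HolAt F s y :=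
  (contMDiffAt_iff_contMDiffAt_nhds (by simp)).1 hs

theorem IsFrameAt.eventually {ι : Type*} [Finite ι] {W : ∀ x, Submodule ℂ (E x)}
    {s : ι → ∀ x, E x} {x : X} (h : IsFrameAt F W s x) : ∀ᶠ y in 𝓝 x, IsFrameAt F W s y := by
  filter_upwards [Filter.eventually_all.2 fun i => (h.holAt i).eventually,
    h.basis.eventually_nhds] with y h1 h2
  exact ⟨h1, h2⟩

theorem IsFrameAt.exists_isHolFrameOn {r : ℕ} {W : ∀ x, Submodule ℂ (E x)}
    {s : Fin r → ∀ x, E x} {x : X} (h : IsFrameAt F W s x) :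
    ∃ U : Set X, IsOpen U ∧ x ∈ U ∧ IsHolFrameOn F W s U := by
  obtain ⟨U, hU, hUo, hx⟩ := eventually_nhds_iff.1 h.eventually
  exact ⟨U, hUo, hx, fun i y hy => ((hU y hy).holAt i).contMDiffWithinAt,
    fun y hy => (hU y hy).basis.self_of_nhds.1, fun y hy => (hU y hy).basis.self_of_nhds.2⟩

end Eventually

theorem IsHolFrameOn.mono {r : ℕ} {W : ∀ x, Submodule ℂ (E x)} {s : Fin r → ∀ x, E x}
    {U V : Set X} (h : IsHolFrameOn F W s U) (hV : V ⊆ U) : IsHolFrameOn F W s V where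
  holomorphic i := ContMDiffOn.mono (h.holomorphic i) hV
  linearIndependent x hx := h.linearIndependent x (hV hx)
  span_eq x hx := h.span_eq x (hV hx)

section Operations

variable [VectorBundle ℂ F E]

theorem HolAt.sum_smul {ι : Type*} [Fintype ι] {c : ι → X → ℂ} {s : ι → ∀ x, E x} {x : X}
    (hc : ∀ i, HolFunAt (c i) x) (hs : ∀ i, HolAt F (s i) x) :
    HolAt F (fun y => ∑ i, c i y • s i y) x :=
  ContMDiffAt.sum_section fun i _ => ContMDiffAt.smul_section (hc i) (hs i)

theorem HolAt.smul {c : X → ℂ} {s : ∀ x, E x} {x : X}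
    (hc : HolFunAt c x) (hs : HolAt F s x) : HolAt F (fun y => c y • s y) x :=
  ContMDiffAt.smul_section hc hs

theorem HolAt.add {s t : ∀ x, E x} {x : X} (hs : HolAt F s x) (ht : HolAt F t x) :
    HolAt F (fun y => s y + t y) x :=
  ContMDiffAt.add_section hs ht

theorem HolAt.sub {s t : ∀ x, E x} {x : X} (hs : HolAt F s x) (ht : HolAt F t x) :
    HolAt F (fun y => s y - t y) x :=
  ContMDiffAt.sub_section hs ht

theorem HolAt.zero {x : X} : HolAt F (fun y => (0 : E y)) x := by
  have := HolAt.sum_smul (F := F) (E := E) (ι := Fin 0) (x := x) (c := fun _ _ => 0)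
    (s := fun _ _ => 0) (fun i => i.elim0) (fun i => i.elim0)
  simpa using this

variable (F E) in
theorem finrank_fiber (x : X) : Module.finrank ℂ (E x) = Module.finrank ℂ F :=
  ((trivializationAt F E x).linearEquivAt ℂ x
    (FiberBundle.mem_baseSet_trivializationAt F E x)).finrank_eq

variable (F E) in
theorem finiteDimensional_fiber [FiniteDimensional ℂ F] (x : X) : FiniteDimensional ℂ (E x) :=
  ((trivializationAt F E x).linearEquivAt ℂ x
    (FiberBundle.mem_baseSet_trivializationAt F E x)).symm.finiteDimensional

end Operations

/-! ### Dual frames, holomorphic coefficients and the local Smith form -/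

section Dual

variable [FiniteDimensional ℂ F] [VectorBundle ℂ F E] [ContMDiffVectorBundle ω F E 𝓘(ℂ)]

variable (F E) in
/-- Existence of a holomorphic frame of `E` near a point together with its dual frame. -/
theorem exists_frame_dual (x : X) : ∃ (e : Fin (Module.finrank ℂ F) → ∀ y, E y)
    (l : Fin (Module.finrank ℂ F) → ∀ y, E y →ₗ[ℂ] ℂ), (∀ i, HolAt F (e i) x) ∧
    (∀ i t, HolAt F t x → HolFunAt (fun y => l i y (t y)) x) ∧
    ∀ᶠ y in 𝓝 x, (∀ i j, l i y (e j y) = if i = j then 1 else 0) ∧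
      ∀ v : E y, v = ∑ i, l i y v • e i y := by
  let e := trivializationAt F E x
  let b := Module.finBasis ℂ F
  have hx : x ∈ e.baseSet := FiberBundle.mem_baseSet_trivializationAt F E x
  refine ⟨e.localFrame b, e.localFrameCoeff 𝓘(ℂ) b,
    fun i => contMDiffAt_localFrame_of_mem ω e b i hx,
    fun i t ht => contMDiffAt_localFrameCoeff b hx ht i, ?_⟩
  filter_upwards [e.open_baseSet.mem_nhds hx] with y hy
  refine ⟨fun i j => ?_, fun v => ?_⟩
  · rw [e.localFrameCoeff_apply_of_mem_baseSet b hy, e.localFrame_apply_of_mem_baseSet b hy,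
      Module.Basis.repr_self, Finsupp.single_apply]
    simp only [eq_comm]
  · classical
    have := Trivialization.eq_sum_localFrameCoeff_smul (I := 𝓘(ℂ)) (e := e) (b := b)
      (s := Function.update 0 y v) hy
    simpa using this

/-- A family of holomorphic sections which is a basis at `x` has a holomorphic dual frame
near `x`. -/
theorem exists_dual_frame {ι : Type*} [Fintype ι] [DecidableEq ι] {s : ι → ∀ y, E y} {x : X}
    (hs : ∀ i, HolAt F (s i) x) (hli : LinearIndependent ℂ fun i => s i x)
    (hcard : Fintype.card ι = Module.finrank ℂ F) :
    ∃ l : ι → ∀ y, E y →ₗ[ℂ] ℂ,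
      (∀ i t, HolAt F t x → HolFunAt (fun y => l i y (t y)) x) ∧
      ∀ᶠ y in 𝓝 x, (∀ i j, l i y (s j y) = if i = j then 1 else 0) ∧
        ∀ v : E y, v = ∑ i, l i y v • s i y := by
  obtain ⟨e, k, he, hk, hek⟩ := exists_frame_dual F E x
  let ε : ι ≃ Fin (Module.finrank ℂ F) := Fintype.equivFinOfCardEq hcard
  -- Column `j` holds the coordinates of `s j` in the auxiliary frame `e`; the inverse matrix takes
  -- the dual frame of `e` to that of `s`.
  let C : X → Matrix ι ι ℂ := fun y => Matrix.of fun i j => k (ε i) y (s j y)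
  have hC : ∀ i j, HolFunAt (fun y => C y i j) x := fun i j => hk _ _ (hs j)
  have hdet : (C x).det ≠ 0 := by
    intro h0
    obtain ⟨c, hc, hc0⟩ := Matrix.exists_mulVec_eq_zero_iff.2 h0
    apply hc
    refine funext fun j => Fintype.linearIndependent_iff.1 hli c ?_ j
    rw [hek.self_of_nhds.2 (∑ j, c j • s j x)]
    refine Finset.sum_eq_zero fun i _ => ?_
    have h1 := congrFun hc0 (ε.symm i)
    simp only [Matrix.mulVec, dotProduct, C, Matrix.of_apply, Equiv.apply_symm_apply,
      Pi.zero_apply] at h1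
    rw [map_sum]
    simp only [map_smul, smul_eq_mul]
    simp only [mul_comm] at h1 ⊢
    rw [h1, zero_smul]
  have hinv := HolFunAt.matrix_inv hC hdet
  refine ⟨fun i y => ∑ j, (C y)⁻¹ i j • k (ε j) y, fun i t ht => ?_, ?_⟩
  · simp only [LinearMap.sum_apply, LinearMap.smul_apply, smul_eq_mul]
    exact HolFunAt.sum fun j _ => (hinv i j).mul (hk _ _ ht)
  · filter_upwards [hek, (HolFunAt.det hC).continuousAt.eventually_ne hdet] with y h1 h2
    have hu : IsUnit (C y).det := isUnit_iff_ne_zero.2 h2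
    generalize hl : (fun i => ∑ j, (C y)⁻¹ i j • k (ε j) y) = l
    have hli : ∀ i, ∑ j, (C y)⁻¹ i j • k (ε j) y = l i := fun i => congrFun hl i
    simp only [hli]
    have h3 : ∀ i j, l i (s j y) = if i = j then 1 else 0 := by
      intro i j
      rw [← hli]
      have h3 := congrFun (congrFun (Matrix.nonsing_inv_mul (C y) hu) i) j
      rw [Matrix.mul_apply, Matrix.one_apply] at h3
      simpa [C] using h3
    refine ⟨h3, fun v => ?_⟩
    have h4 : LinearIndependent ℂ fun i => s i y := by
      refine Fintype.linearIndependent_iff.2 fun g hg i => ?_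
      have h5 := congrArg (l i) hg
      rw [map_sum, map_zero] at h5
      simpa only [map_smul, h3, smul_eq_mul, mul_ite, mul_one, mul_zero, Finset.sum_ite_eq,
        Finset.mem_univ, if_true] using h5
    have := finiteDimensional_fiber F E y
    have h5 : v ∈ Submodule.span ℂ (Set.range fun i => s i y) := by
      rw [h4.span_eq_top_of_card_eq_finrank' (by rw [hcard, finrank_fiber F E y])]
      trivial
    obtain ⟨g, rfl⟩ := (Submodule.mem_span_range_iff_exists_fun ℂ).1 h5
    refine Finset.sum_congr rfl fun i _ => ?_
    rw [map_sum]
    simp only [map_smul, h3, smul_eq_mul, mul_ite, mul_one, mul_zero, Finset.sum_ite_eq,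
      Finset.mem_univ, if_true]

variable (F) in
/-- Every vector extends to a holomorphic section. -/
theorem exists_holAt_eq {x : X} (v : E x) : ∃ s : ∀ y, E y, HolAt F s x ∧ s x = v := by
  obtain ⟨e, k, he, hk, hek⟩ := exists_frame_dual F E x
  exact ⟨fun y => ∑ i, k i x v • e i y, HolAt.sum_smul (fun i => contMDiffAt_const) he,
    (hek.self_of_nhds.2 v).symm⟩

/-- Independent holomorphic sections can be completed to a frame near a point. -/
theorem exists_frame_completion {ι : Type*} [Fintype ι] {s : ι → ∀ y, E y} {x : X}
    (hli : LinearIndependent ℂ fun i => s i x) :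
    ∃ (m : ℕ) (w : Fin m → ∀ y, E y), Fintype.card ι + m = Module.finrank ℂ F ∧
      (∀ i, HolAt F (w i) x) ∧ LinearIndependent ℂ fun i => Sum.elim s w i x := by
  have := finiteDimensional_fiber F E x
  obtain ⟨C, hC⟩ := Submodule.exists_isCompl (Submodule.span ℂ (Set.range fun i => s i x))
  let b := Module.finBasis ℂ C
  choose w hw hwx using fun i => exists_holAt_eq F (b i : E x)
  have h1 : LinearIndependent ℂ fun i => (b i : E x) :=
    b.linearIndependent.map' C.subtype (Submodule.ker_subtype _)
  have h2 : LinearIndependent ℂ (Sum.elim (fun i => s i x) fun i => (b i : E x)) := by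
    refine hli.sum_type h1 (hC.disjoint.mono_right (Submodule.span_le.2 ?_))
    rintro _ ⟨i, rfl⟩
    exact (b i).2
  have h3 : (fun i => Sum.elim s w i x) = Sum.elim (fun i => s i x) fun i => (b i : E x) := by
    ext i
    cases i <;> simp [hwx]
  refine ⟨Module.finrank ℂ C, w, ?_, hw, h3 ▸ h2⟩
  rw [← finrank_fiber F E x, ← Submodule.finrank_add_eq_of_isCompl hC, finrank_span_eq_card hli]

/-- A holomorphic frame of `W` near `x` is part of a frame of `E`. In terms of the dual frame:
there are holomorphic coordinates for `W`, and holomorphic linear equations defining `W`. -/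
theorem IsFrameAt.exists_dual {ι : Type*} [Fintype ι] [DecidableEq ι]
    {W : ∀ x, Submodule ℂ (E x)} {s : ι → ∀ x, E x} {x : X} (hs : IsFrameAt F W s x) :
    ∃ (m : ℕ) (l : ι ⊕ Fin m → ∀ y, E y →ₗ[ℂ] ℂ),
      (∀ i t, HolAt F t x → HolFunAt (fun y => l i y (t y)) x) ∧
      ∀ᶠ y in 𝓝 x, (∀ i j, l (Sum.inl i) y (s j y) = if i = j then 1 else 0) ∧
        (∀ v, v ∈ W y ↔ ∀ j, l (Sum.inr j) y v = 0) ∧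
        ∀ v ∈ W y, v = ∑ i, l (Sum.inl i) y v • s i y := by
  obtain ⟨m, w, hm, hw, hli⟩ := exists_frame_completion (F := F) hs.basis.self_of_nhds.1
  obtain ⟨l, hl, h⟩ := exists_dual_frame (F := F) (s := Sum.elim s w) (x := x)
    (by rintro (i | i); exacts [hs.holAt i, hw i]) hli (by simpa using hm)
  refine ⟨m, l, hl, ?_⟩
  filter_upwards [h, hs.basis] with y h1 h2
  have h3 : ∀ v, v ∈ W y ↔ ∀ j, l (Sum.inr j) y v = 0 := by
    intro v
    refine ⟨fun hv j => ?_, fun hv => ?_⟩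
    · have : W y ≤ LinearMap.ker (l (Sum.inr j) y) := by
        rw [← h2.2, Submodule.span_le]
        rintro _ ⟨i, rfl⟩
        simpa using h1.1 (Sum.inr j) (Sum.inl i)
      exact this hv
    · rw [h1.2 v, Fintype.sum_sum_type]
      simp only [hv, zero_smul, Finset.sum_const_zero, add_zero, Sum.elim_inl]
      rw [← h2.2]
      exact Submodule.sum_mem _ fun i _ => Submodule.smul_mem _ _ (Submodule.subset_span ⟨i, rfl⟩)
  refine ⟨fun i j => by simpa using h1.1 (Sum.inl i) (Sum.inl j), h3, fun v hv => ?_⟩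
  conv_lhs => rw [h1.2 v, Fintype.sum_sum_type]
  simp [(h3 v).1 hv]

/-- A holomorphic section near `x` whose values off `x` lie in `W` is a holomorphic combination of
a frame of `W`. -/
theorem IsFrameAt.exists_coeff {ι : Type*} [Fintype ι]
    {W : ∀ x, Submodule ℂ (E x)} {s : ι → ∀ x, E x} {x : X} (hs : IsFrameAt F W s x)
    {t : ∀ x, E x} (ht : HolAt F t x) (htW : ∀ᶠ y in 𝓝[≠] x, t y ∈ W y) :
    ∃ c : ι → X → ℂ, (∀ i, HolFunAt (c i) x) ∧ ∀ᶠ y in 𝓝 x, t y = ∑ i, c i y • s i y := by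
  classical
  obtain ⟨m, l, hl, h⟩ := hs.exists_dual
  refine ⟨fun i y => l (Sum.inl i) y (t y), fun i => hl _ _ ht, ?_⟩
  have h1 : ∀ᶠ y in 𝓝[≠] x, ∀ j, l (Sum.inr j) y (t y) = 0 := by
    filter_upwards [h.filter_mono nhdsWithin_le_nhds, htW] with y h1 h2
    exact (h1.2.1 _).1 h2
  -- The equations of `W` hold along `t` off `x`, and by continuity at `x`.
  have h2 : ∀ j, l (Sum.inr j) x (t x) = 0 := by
    intro j
    have := neBot_nhdsNE x
    have h3 := (hl (Sum.inr j) t ht).continuousAt.tendsto.mono_left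
      (nhdsWithin_le_nhds (s := {x}ᶜ))
    exact tendsto_nhds_unique_of_eventuallyEq h3 tendsto_const_nhds (h1.mono fun y hy => hy j)
  have h3 : ∀ᶠ y in 𝓝 x, t y ∈ W y := by
    rw [eventually_nhdsWithin_iff] at htW
    filter_upwards [htW, h] with y h4 h5
    by_cases hy : y = x
    · subst hy
      exact (h5.2.1 _).2 h2
    · exact h4 hy
  filter_upwards [h, h3] with y h4 h5
  exact h4.2.2 _ h5

/-- Two frames of `W` differ by a holomorphic invertible matrix. -/
theorem IsFrameAt.exists_matrix {ι : Type*} [Fintype ι] [DecidableEq ι]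
    {W : ∀ x, Submodule ℂ (E x)} {s s' : ι → ∀ x, E x} {x : X} (hs : IsFrameAt F W s x)
    (hs' : IsFrameAt F W s' x) :
    ∃ C : X → Matrix ι ι ℂ, (∀ i j, HolFunAt (fun y => C y i j) x) ∧ (C x).det ≠ 0 ∧
      ∀ᶠ y in 𝓝 x, ∀ a, s' a y = ∑ b, C y b a • s b y := by
  have h1 : ∀ a, ∃ c : ι → X → ℂ, (∀ i, HolFunAt (c i) x) ∧
      ∀ᶠ y in 𝓝 x, s' a y = ∑ i, c i y • s i y := fun a =>
    hs.exists_coeff (hs'.holAt a) (by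
      filter_upwards [hs'.basis.filter_mono nhdsWithin_le_nhds] with y hy
      rw [← hy.2]
      exact Submodule.subset_span ⟨a, rfl⟩)
  choose c hc hcs using h1
  refine ⟨fun y => Matrix.of fun i a => c a i y, fun i j => hc j i, fun h0 => ?_,
    Filter.eventually_all.2 hcs⟩
  obtain ⟨u, hu, hu0⟩ := Matrix.exists_mulVec_eq_zero_iff.2 h0
  refine hu (funext fun j => Fintype.linearIndependent_iff.1 hs'.basis.self_of_nhds.1 u ?_ j)
  simp only [(hcs _).self_of_nhds, Finset.smul_sum, smul_smul]
  rw [Finset.sum_comm]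
  simp only [← Finset.sum_smul]
  refine Finset.sum_eq_zero fun i _ => ?_
  have := congrFun hu0 i
  simp only [Matrix.mulVec, dotProduct, Matrix.of_apply, Pi.zero_apply] at this
  simp only [mul_comm] at this ⊢
  rw [this, zero_smul]

/-- Subbundles are closed: the coefficients of `t` in the frame extend across `x`. -/
theorem IsFrameAt.mem_of_holAt {ι : Type*} [Fintype ι]
    {W : ∀ x, Submodule ℂ (E x)} {s : ι → ∀ x, E x} {x : X} (hs : IsFrameAt F W s x)
    {t : ∀ x, E x} (ht : HolAt F t x) (htW : ∀ᶠ y in 𝓝[≠] x, t y ∈ W y) : t x ∈ W x := by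
  obtain ⟨c, -, hc⟩ := hs.exists_coeff ht htW
  rw [hc.self_of_nhds, ← hs.basis.self_of_nhds.2]
  exact Submodule.sum_mem _ fun i _ => Submodule.smul_mem _ _ (Submodule.subset_span ⟨i, rfl⟩)

omit [FiniteDimensional ℂ F] [ContMDiffVectorBundle ω F E 𝓘(ℂ)] in
/-- Change of frame. -/
theorem IsFrameAt.change {ι κ : Type*} [Fintype ι] [Fintype κ]
    {W : ∀ x, Submodule ℂ (E x)} {s : ι → ∀ x, E x} {x : X} (hs : IsFrameAt F W s x)
    (hcard : Fintype.card κ = Fintype.card ι) {Q : κ → ι → X → ℂ}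
    (hQ : ∀ a i, HolFunAt (Q a i) x) (hli : LinearIndependent ℂ fun a i => Q a i x) :
    IsFrameAt F W (fun a y => ∑ i, Q a i y • s i y) x where
  holAt a := HolAt.sum_smul (hQ a) hs.holAt
  basis := by
    have h1 : ∀ᶠ y in 𝓝 x, LinearIndependent ℂ fun a i => Q a i y := by
      have hc : ContinuousAt (fun y a i => Q a i y) x :=
        continuousAt_pi.2 fun a => continuousAt_pi.2 fun i => (hQ a i).continuousAt
      exact hc.eventually (isOpen_setOfPred_linearIndependent.mem_nhds hli)
    filter_upwards [h1, hs.basis] with y h2 h3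
    let L : (ι → ℂ) →ₗ[ℂ] E y := Fintype.linearCombination ℂ fun i => s i y
    have hL : (fun a => ∑ i, Q a i y • s i y) = fun a => L (fun i => Q a i y) := by
      ext a
      simp [L, Fintype.linearCombination_apply]
    rw [hL]
    refine ⟨h2.map' L (LinearMap.ker_eq_bot.2
      (linearIndependent_iff_injective_fintypeLinearCombination.1 h3.1)), ?_⟩
    have h4 : (Set.range fun a => L fun i => Q a i y) = L '' Set.range fun a i => Q a i y := by
      rw [← Set.range_comp]; rfl
    rw [h4, ← Submodule.map_span, h2.span_eq_top_of_card_eq_finrank' (by simp [hcard]),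
      Submodule.map_top, Fintype.range_linearCombination, h3.2]

variable [IsManifold 𝓘(ℂ) ω X]

/-- Smith normal form of a holomorphic endomorphism of `W` near a point. -/
theorem IsFrameAt.exists_smith {n : ℕ} {W : ∀ x, Submodule ℂ (E x)} {s : Fin n → ∀ x, E x} {x : X}
    (hs : IsFrameAt F W s x) {A : ∀ x, E x →ₗ[ℂ] E x} (hA : HolEndAt F A x)
    (hAW : ∀ᶠ y in 𝓝[≠] x, ∀ v ∈ W y, A y v ∈ W y) :
    ∃ (r m : ℕ) (v p : Fin r ⊕ Fin m → ∀ y, E y) (d : Fin m → ℕ), r + m = n ∧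
      IsFrameAt F W v x ∧ IsFrameAt F W p x ∧ ∀ᶠ y in 𝓝 x,
        (∀ a, A y (v (Sum.inl a) y) = 0) ∧ ∀ a, A y (v (Sum.inr a) y) =
          (chartAt ℂ x y - chartAt ℂ x x) ^ d a • p (Sum.inr a) y := by
  have hsW : ∀ᶠ y in 𝓝 x, ∀ j, s j y ∈ W y := by
    filter_upwards [hs.basis] with y hy j
    rw [← hy.2]
    exact Submodule.subset_span ⟨j, rfl⟩
  have h1 : ∀ j, ∃ c : Fin n → X → ℂ, (∀ i, HolFunAt (c i) x) ∧
      ∀ᶠ y in 𝓝 x, A y (s j y) = ∑ i, c i y • s i y := fun j =>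
    hs.exists_coeff (hA _ (hs.holAt j)) (by
      filter_upwards [hAW, hsW.filter_mono nhdsWithin_le_nhds] with y h2 h3
      exact h2 _ (h3 j))
  choose c hc hcs using h1
  have hx := mem_chart_source ℂ x
  -- The matrix of `A` in the frame `s`, read in the chart, is put in Smith form; `Q` and `P` are
  -- the coordinates of the two new frames.
  obtain ⟨r, m, Q, P, d, hrm, hQ, hP, hQi, hPi, h⟩ := exists_analytic_smith
    (fun i j w => c j i ((chartAt ℂ x).symm w)) fun i j => (hc j i).analyticAt hx
  refine ⟨r, m, fun a y => ∑ i, Q a i (chartAt ℂ x y) • s i y,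
    fun a y => ∑ i, P a i (chartAt ℂ x y) • s i y, d, hrm,
    hs.change (by simp [hrm]) (fun a i => holFunAt_comp_chart hx (hQ a i)) hQi,
    hs.change (by simp [hrm]) (fun a i => holFunAt_comp_chart hx (hP a i)) hPi, ?_⟩
  have h2 := ((chartAt ℂ x).continuousAt hx).eventually h
  filter_upwards [h2, Filter.eventually_all.2 hcs, (chartAt ℂ x).open_source.mem_nhds hx]
    with y h3 h4 h5
  have key : ∀ q : Fin n → ℂ, A y (∑ j, q j • s j y) = ∑ i, (∑ j, c j i y * q j) • s i y := by
    intro q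
    rw [map_sum]
    simp only [map_smul, h4, Finset.smul_sum, Finset.sum_smul, smul_smul]
    rw [Finset.sum_comm]
    simp only [mul_comm]
  rw [(chartAt ℂ x).left_inv h5] at h3
  refine ⟨fun a => ?_, fun a => ?_⟩
  · rw [key]
    simp [h3.1 a]
  · rw [key]
    simp only [h3.2 a, Finset.smul_sum, smul_smul]

end Dual

end Frames

/-! ### Saturated kernel and image of a holomorphic endomorphism -/

section Saturation

variable {X : Type*} [TopologicalSpace X] [ChartedSpace ℂ X]
  {F : Type*} [NormedAddCommGroup F] [NormedSpace ℂ F]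
  {E : X → Type*} [TopologicalSpace (TotalSpace F E)]
  [∀ x, AddCommGroup (E x)] [∀ x, Module ℂ (E x)] [∀ x, TopologicalSpace (E x)]
  [FiberBundle F E] [VectorBundle ℂ F E]

variable (F) in
/-- The saturation of a family of subspaces `V`: the values at `x` of the holomorphic sections
near `x` that lie in `V` off `x`. -/
def saturation (V : ∀ x, Submodule ℂ (E x)) (x : X) : Submodule ℂ (E x) where
  carrier := {v | ∃ s : ∀ y, E y, HolAt F s x ∧ s x = v ∧ ∀ᶠ y in 𝓝[≠] x, s y ∈ V y}
  add_mem' := by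
    rintro _ _ ⟨s, hs, rfl, hsV⟩ ⟨t, ht, rfl, htV⟩
    refine ⟨_, hs.add ht, rfl, ?_⟩
    filter_upwards [hsV, htV] with y h1 h2 using (V y).add_mem h1 h2
  zero_mem' := ⟨_, HolAt.zero, rfl, Filter.Eventually.of_forall fun y => (V y).zero_mem⟩
  smul_mem' := by
    rintro c _ ⟨s, hs, rfl, hsV⟩
    refine ⟨_, HolAt.smul (c := fun _ => c) contMDiffAt_const hs, rfl, ?_⟩
    filter_upwards [hsV] with y h1 using (V y).smul_mem _ h1

theorem saturation_invariant {V : ∀ x, Submodule ℂ (E x)} {A : ∀ x, E x →ₗ[ℂ] E x} {x : X}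
    (hA : HolEndAt F A x) (hAV : ∀ᶠ y in 𝓝[≠] x, ∀ v ∈ V y, A y v ∈ V y) {v : E x}
    (hv : v ∈ saturation F V x) : A x v ∈ saturation F V x := by
  obtain ⟨s, hs, rfl, hsV⟩ := hv
  refine ⟨_, hA s hs, rfl, ?_⟩
  filter_upwards [hsV, hAV] with y h1 h2 using h2 _ h1

/-- An open punctured neighbourhood of `x` is a full neighbourhood of each of its points. Generic
properties thus pass from `x` to the points around it. -/
theorem eventually_eventually_nhdsNE {X : Type*} [TopologicalSpace X] [T1Space X] {p : X → Prop}
    {x : X} (h : ∀ᶠ y in 𝓝[≠] x, p y) : ∀ᶠ y in 𝓝 x, ∀ᶠ z in 𝓝[≠] y, p z := by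
  rw [eventually_nhdsWithin_iff] at h
  filter_upwards [h.eventually_nhds] with y hy
  by_cases hxy : y = x
  · subst hxy
    exact eventually_nhdsWithin_iff.2 hy
  · refine Filter.Eventually.filter_mono nhdsWithin_le_nhds ?_
    filter_upwards [hy, isOpen_compl_singleton.mem_nhds hxy] with z h1 h2 using h1 h2

variable [FiniteDimensional ℂ F] [ContMDiffVectorBundle ω F E 𝓘(ℂ)]

/-- A section lying in `W` off `x` lies in `W` at `x`, by `IsFrameAt.mem_of_holAt`; conversely a
vector of `W x` extends with constant coefficients in the frame. -/
theorem IsFrameAt.saturation_eq {ι : Type*} [Fintype ι] {V W : ∀ x, Submodule ℂ (E x)}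
    {s : ι → ∀ y, E y} {x : X} (hs : IsFrameAt F W s x) (hV : ∀ᶠ y in 𝓝[≠] x, W y = V y) :
    saturation F V x = W x := by
  apply le_antisymm
  · rintro _ ⟨t, ht, rfl, htV⟩
    refine hs.mem_of_holAt ht ?_
    filter_upwards [htV, hV] with y h1 h2
    rwa [h2]
  · intro v hv
    rw [← hs.basis.self_of_nhds.2] at hv
    obtain ⟨c, rfl⟩ := (Submodule.mem_span_range_iff_exists_fun ℂ).1 hv
    refine ⟨_, HolAt.sum_smul (c := fun i _ => c i) (fun i => contMDiffAt_const) hs.holAt, rfl, ?_⟩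
    filter_upwards [hV, hs.basis.filter_mono nhdsWithin_le_nhds] with y h1 h2
    rw [← h1, ← h2.2]
    exact Submodule.sum_mem _ fun i _ => Submodule.smul_mem _ _ (Submodule.subset_span ⟨i, rfl⟩)

variable [T1Space X] [IsManifold 𝓘(ℂ) ω X]

theorem IsFrameAt.eventually_saturation_eq {ι : Type*} [Fintype ι] {V W : ∀ x, Submodule ℂ (E x)}
    {s : ι → ∀ y, E y} {x : X} (hs : IsFrameAt F W s x) (hV : ∀ᶠ y in 𝓝[≠] x, W y = V y) :
    ∀ᶠ y in 𝓝 x, saturation F V y = W y := by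
  filter_upwards [hs.eventually, eventually_eventually_nhdsNE hV] with y h1 h2
  exact h1.saturation_eq h2

variable (F) in
/-- In suitable holomorphic frames of `E` near `x`, `τ` is diagonal of generic rank `m`. -/
def HasSmithFormAt (τ : ∀ x, E x →ₗ[ℂ] E x) (r m : ℕ) (x : X) : Prop :=
  ∃ (v p : Fin r ⊕ Fin m → ∀ y, E y) (d : Fin m → ℕ), IsFrameAt F (fun _ => ⊤) v x ∧
    IsFrameAt F (fun _ => ⊤) p x ∧ ∀ᶠ y in 𝓝 x, (∀ a, τ y (v (Sum.inl a) y) = 0) ∧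
      ∀ a, τ y (v (Sum.inr a) y) = (chartAt ℂ x y - chartAt ℂ x x) ^ d a • p (Sum.inr a) y

variable (F E) in
theorem exists_isFrameAt_top (x : X) :
    ∃ e : Fin (Module.finrank ℂ F) → ∀ y, E y, IsFrameAt F (fun _ => ⊤) e x :=
  ⟨_, HolSubbundle.isFrameAt (HolSubbundle.full F E) x⟩

theorem exists_hasSmithFormAt {τ : ∀ x, E x →ₗ[ℂ] E x} {x : X} (hτ : HolEndAt F τ x) :
    ∃ r m, r + m = Module.finrank ℂ F ∧ HasSmithFormAt F τ r m x := by
  obtain ⟨e, he⟩ := exists_isFrameAt_top F E x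
  obtain ⟨r, m, v, p, d, h1, h2, h3, h4⟩ := he.exists_smith hτ
    (Filter.Eventually.of_forall fun _ _ _ => trivial)
  exact ⟨r, m, h1, v, p, d, h2, h3, h4⟩

theorem eventually_chart_ne (x : X) :
    ∀ᶠ y in 𝓝[≠] x, chartAt ℂ x y - chartAt ℂ x x ≠ 0 := by
  filter_upwards [self_mem_nhdsWithin, nhdsWithin_le_nhds ((chartAt ℂ x).open_source.mem_nhds
    (mem_chart_source ℂ x))] with y h1 h2
  rw [sub_ne_zero]
  exact fun h => h1 ((chartAt ℂ x).injOn h2 (mem_chart_source ℂ x) h)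

/-- The kernel and the image of an endomorphism which is diagonal in suitable bases. -/
theorem ker_range_of_diagonal {V ι κ : Type*} [AddCommGroup V] [Module ℂ V] [Fintype ι] [Fintype κ]
    {f : V →ₗ[ℂ] V} {v p : ι ⊕ κ → V} (hv : Submodule.span ℂ (Set.range v) = ⊤)
    (hp : LinearIndependent ℂ p) {c : κ → ℂ} (hc : ∀ a, c a ≠ 0)
    (h0 : ∀ a, f (v (Sum.inl a)) = 0) (h1 : ∀ a, f (v (Sum.inr a)) = c a • p (Sum.inr a)) :
    Submodule.span ℂ (Set.range fun a => v (Sum.inl a)) = LinearMap.ker f ∧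
      Submodule.span ℂ (Set.range fun a => p (Sum.inr a)) = LinearMap.range f := by
  have hf : ∀ g : ι ⊕ κ → ℂ, f (∑ a, g a • v a) = ∑ a, (g (Sum.inr a) * c a) • p (Sum.inr a) := by
    intro g
    rw [map_sum, Fintype.sum_sum_type]
    simp [h0, h1, smul_smul]
  have hx : ∀ x : V, ∃ g : ι ⊕ κ → ℂ, ∑ a, g a • v a = x := fun x =>
    (Submodule.mem_span_range_iff_exists_fun ℂ).1 (hv ▸ Submodule.mem_top)
  constructor
  · apply le_antisymm
    · rw [Submodule.span_le]
      rintro _ ⟨a, rfl⟩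
      exact h0 a
    · intro x hx0
      obtain ⟨g, rfl⟩ := hx x
      have h2 : ∑ a, (g (Sum.inr a) * c a) • p (Sum.inr a) = 0 := by
        rw [← hf]; exact hx0
      have h3 := Fintype.linearIndependent_iff.1 (hp.comp Sum.inr Sum.inr_injective) _ h2
      have h4 : ∀ a, g (Sum.inr a) = 0 := fun a => (mul_eq_zero.1 (h3 a)).resolve_right (hc a)
      rw [Fintype.sum_sum_type]
      simp only [h4, zero_smul, Finset.sum_const_zero, add_zero]
      exact Submodule.sum_mem _ fun i _ => Submodule.smul_mem _ _ (Submodule.subset_span ⟨i, rfl⟩)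
  · apply le_antisymm
    · rw [Submodule.span_le]
      rintro _ ⟨a, rfl⟩
      exact ⟨(c a)⁻¹ • v (Sum.inr a), by rw [map_smul, h1, smul_smul, inv_mul_cancel₀ (hc a), one_smul]⟩
    · rintro _ ⟨x, rfl⟩
      obtain ⟨g, rfl⟩ := hx x
      rw [hf]
      exact Submodule.sum_mem _ fun i _ => Submodule.smul_mem _ _ (Submodule.subset_span ⟨i, rfl⟩)

/-- Part of a frame of `E` is a frame of the subbundle it spans. -/
theorem IsFrameAt.comp_injective {ι κ : Type*} {v : ι → ∀ y, E y} {x : X}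
    (hv : IsFrameAt F (fun _ => ⊤) v x) {f : κ → ι} (hf : Function.Injective f) :
    IsFrameAt F (fun y => Submodule.span ℂ (Set.range fun a => v (f a) y)) (fun a => v (f a)) x where
  holAt a := hv.holAt _
  basis := by
    filter_upwards [hv.basis] with y hy
    exact ⟨hy.1.comp f hf, rfl⟩

/-- Near `x` the entries `z ^ d a` can vanish only at `x`. So `m` is an invariant of `τ`, not of the
chosen frames. -/
theorem HasSmithFormAt.finrank_range {τ : ∀ x, E x →ₗ[ℂ] E x} {r m : ℕ} {x : X}
    (h : HasSmithFormAt F τ r m x) :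
    ∀ᶠ y in 𝓝[≠] x, Module.finrank ℂ (LinearMap.range (τ y)) = m := by
  obtain ⟨v, p, d, hv, hp, h⟩ := h
  filter_upwards [hv.basis.filter_mono nhdsWithin_le_nhds, hp.basis.filter_mono nhdsWithin_le_nhds,
    h.filter_mono nhdsWithin_le_nhds, eventually_chart_ne x] with y h1 h2 h3 h4
  rw [← (ker_range_of_diagonal h1.2 h2.1 (fun a => pow_ne_zero (d a) h4) h3.1 h3.2).2,
    finrank_span_eq_card (b := fun a => p (Sum.inr a) y) (h2.1.comp Sum.inr Sum.inr_injective),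
    Fintype.card_fin]

/-- On a connected Riemann surface the generic rank of a holomorphic endomorphism is constant. -/
theorem exists_forall_hasSmithFormAt [ConnectedSpace X] {τ : ∀ x, E x →ₗ[ℂ] E x}
    (hτ : ∀ x, HolEndAt F τ x) :
    ∃ r m, r + m = Module.finrank ℂ F ∧ ∀ x, HasSmithFormAt F τ r m x := by
  choose r m hrm h using fun x => exists_hasSmithFormAt (hτ x)
  -- Punctured neighbourhoods of `x` and of a nearby `y` share a point `z`, where the rank of `τ` is
  -- both `m x` and `m y`.
  have hloc : IsLocallyConstant m := by
    rw [IsLocallyConstant.iff_eventually_eq]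
    intro x
    filter_upwards [eventually_eventually_nhdsNE (h x).finrank_range] with y h1
    have := neBot_nhdsNE y
    obtain ⟨z, h2, h3⟩ := (h1.and (h y).finrank_range).exists
    exact h3.symm.trans h2
  obtain ⟨x₀⟩ := (inferInstance : Nonempty X)
  have hm : ∀ x, m x = m x₀ := fun x => hloc.apply_eq_of_preconnectedSpace x x₀
  refine ⟨r x₀, m x₀, hrm x₀, fun x => ?_⟩
  have hr : r x = r x₀ := by have h1 := hrm x; have h2 := hrm x₀; have h3 := hm x; omega
  rw [← hm x, ← hr]
  exact h x

/-- Off `x` the first vectors of `v` span the kernel and the last vectors of `p` the image. At `x`,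
where kernel and image may jump, both families are still independent as parts of frames, so they
frame the saturations. -/
theorem HasSmithFormAt.eventually_saturation {τ : ∀ x, E x →ₗ[ℂ] E x} {r m : ℕ} {x : X}
    {v p : Fin r ⊕ Fin m → ∀ y, E y} {d : Fin m → ℕ} (hv : IsFrameAt F (fun _ => ⊤) v x)
    (hp : IsFrameAt F (fun _ => ⊤) p x)
    (h : ∀ᶠ y in 𝓝 x, (∀ a, τ y (v (Sum.inl a) y) = 0) ∧
      ∀ a, τ y (v (Sum.inr a) y) = (chartAt ℂ x y - chartAt ℂ x x) ^ d a • p (Sum.inr a) y) :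
    IsFrameAt F (saturation F fun y => LinearMap.ker (τ y)) (fun a => v (Sum.inl a)) x ∧
    IsFrameAt F (saturation F fun y => LinearMap.range (τ y)) (fun a => p (Sum.inr a)) x ∧
    ∀ᶠ y in 𝓝[≠] x, (saturation F fun y => LinearMap.ker (τ y)) y = LinearMap.ker (τ y) ∧
      (saturation F fun y => LinearMap.range (τ y)) y = LinearMap.range (τ y) := by
  have hvK := hv.comp_injective (f := Sum.inl) Sum.inl_injective
  have hpI := hp.comp_injective (f := Sum.inr) Sum.inr_injective
  have key : ∀ᶠ y in 𝓝[≠] x,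
      Submodule.span ℂ (Set.range fun a => v (Sum.inl a) y) = LinearMap.ker (τ y) ∧
      Submodule.span ℂ (Set.range fun a => p (Sum.inr a) y) = LinearMap.range (τ y) := by
    filter_upwards [hv.basis.filter_mono nhdsWithin_le_nhds,
      hp.basis.filter_mono nhdsWithin_le_nhds,
      h.filter_mono nhdsWithin_le_nhds, eventually_chart_ne x] with y h1 h2 h3 h4
    exact ker_range_of_diagonal h1.2 h2.1 (fun a => pow_ne_zero (d a) h4) h3.1 h3.2
  have hK := hvK.eventually_saturation_eq (key.mono fun y hy => hy.1)
  have hI := hpI.eventually_saturation_eq (key.mono fun y hy => hy.2)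
  refine ⟨hvK.congr (hK.mono fun y hy => hy.symm), hpI.congr (hI.mono fun y hy => hy.symm), ?_⟩
  filter_upwards [key, hK.filter_mono nhdsWithin_le_nhds, hI.filter_mono nhdsWithin_le_nhds]
    with y h1 h2 h3
  exact ⟨h2.trans h1.1, h3.trans h1.2⟩

/-- The saturated kernel of a holomorphic endomorphism. -/
def kerBundle {τ : ∀ x, E x →ₗ[ℂ] E x} {r m : ℕ} (h : ∀ x, HasSmithFormAt F τ r m x) :
    HolSubbundle F E r where
  carrier := saturation F fun y => LinearMap.ker (τ y)
  exists_frame x := by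
    obtain ⟨v, p, d, hv, hp, hvp⟩ := h x
    obtain ⟨U, h1, h2, h3⟩ :=
      (HasSmithFormAt.eventually_saturation hv hp hvp).1.exists_isHolFrameOn
    exact ⟨U, h1, h2, _, h3⟩

/-- The saturated image of a holomorphic endomorphism. -/
def rangeBundle {τ : ∀ x, E x →ₗ[ℂ] E x} {r m : ℕ} (h : ∀ x, HasSmithFormAt F τ r m x) :
    HolSubbundle F E m where
  carrier := saturation F fun y => LinearMap.range (τ y)
  exists_frame x := by
    obtain ⟨v, p, d, hv, hp, hvp⟩ := h x
    obtain ⟨U, h1, h2, h3⟩ :=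
      (HasSmithFormAt.eventually_saturation hv hp hvp).2.1.exists_isHolFrameOn
    exact ⟨U, h1, h2, _, h3⟩

end Saturation

/-! ### Exponents of invariant subbundles -/

section Linear

variable {V : Type*} [AddCommGroup V] [Module ℂ V]

/-- The determinant of the restriction of `f` to `W`, from its values on a basis of `W`. -/
theorem det_restrict_eq {ι : Type*} [Fintype ι] [DecidableEq ι] {W : Submodule ℂ V} {s : ι → V}
    (hs : LinearIndependent ℂ s) (hW : Submodule.span ℂ (Set.range s) = W) {f : V →ₗ[ℂ] V}
    (h : ∀ v ∈ W, f v ∈ W) {c : Matrix ι ι ℂ} {l : ι → ℂ}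
    (hf : ∀ a, f (s a) = l a • ∑ b, c b a • s b) :
    LinearMap.det (f.restrict h) = (∏ a, l a) * c.det := by
  subst hW
  let b := Module.Basis.span hs
  have h1 : f.restrict h = Matrix.toLin b b (c * Matrix.diagonal l) := by
    refine b.ext fun a => Subtype.ext ?_
    rw [Matrix.toLin_self]
    simp only [LinearMap.coe_restrict_apply, b, Module.Basis.span_apply, hf, Submodule.coe_sum,
      Submodule.coe_smul, Matrix.mul_diagonal, Finset.smul_sum, smul_smul]
    exact Finset.sum_congr rfl fun i _ => by rw [mul_comm]
  rw [h1, LinearMap.det_toLin, Matrix.det_mul, Matrix.det_diagonal, mul_comm]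

/-- If `f` commutes with `g`, the determinant of `f` is the product of its determinants on the
kernel and on the range of `g`. -/
theorem det_eq_det_ker_mul_det_range [FiniteDimensional ℂ V] {f g : V →ₗ[ℂ] V}
    (hfg : ∀ v, g (f v) = f (g v))
    (hK : ∀ v ∈ LinearMap.ker g, f v ∈ LinearMap.ker g)
    (hI : ∀ v ∈ LinearMap.range g, f v ∈ LinearMap.range g) :
    LinearMap.det f = LinearMap.det (f.restrict hK) * LinearMap.det (f.restrict hI) := by
  rw [LinearMap.det_eq_det_mul_det (LinearMap.ker g) f hK]
  congr 1
  -- The factor on `V / ker g` is carried to the range by the isomorphism that `g` induces; since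
  -- `f` and `g` commute, it becomes the restriction of `f`.
  rw [← LinearMap.det_conj ((LinearMap.ker g).mapQ _ f hK) g.quotKerEquivRange]
  congr 1
  ext ⟨_, x, rfl⟩
  have h1 : g.quotKerEquivRange.symm ⟨g x, x, rfl⟩ = (LinearMap.ker g).mkQ x := by
    rw [LinearEquiv.symm_apply_eq]
    rfl
  simp only [LinearMap.comp_apply, LinearEquiv.coe_coe, h1, LinearMap.coe_restrict_apply]
  exact hfg x

end Linear

section Exponents

variable {X : Type*} [TopologicalSpace X] [ChartedSpace ℂ X]
  {F : Type*} [NormedAddCommGroup F] [NormedSpace ℂ F]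
  {E : X → Type*} [TopologicalSpace (TotalSpace F E)]
  [∀ x, AddCommGroup (E x)] [∀ x, Module ℂ (E x)] [∀ x, TopologicalSpace (E x)]
  [FiberBundle F E] [VectorBundle ℂ F E]
  [∀ x, IsTopologicalAddGroup (E x)] [∀ x, ContinuousSMul ℂ (E x)]

theorem IsHolEndOn.holEndAt {A : ∀ x, E x →L[ℂ] E x} {U : Set X} (hA : IsHolEndOn F A U) {x : X}
    (hU : U ∈ 𝓝 x) : HolEndAt F (fun y => (A y).toLinearMap) x := fun _ hs =>
  ContMDiffAt.clm_bundle_apply (ContMDiffOn.contMDiffAt hA hU) hs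

theorem eventually_notMem_of_finite {X : Type*} [TopologicalSpace X] [T1Space X] {S : Set X}
    (hS : S.Finite) (x : X) : ∀ᶠ y in 𝓝[≠] x, y ∉ S := by
  have h1 : (S \ {x})ᶜ ∈ 𝓝 x := (hS.sdiff).isClosed.isOpen_compl.mem_nhds (by simp)
  filter_upwards [self_mem_nhdsWithin, nhdsWithin_le_nhds h1] with y h2 h3 h4
  exact h3 ⟨h4, h2⟩

variable [FiniteDimensional ℂ F] [ContMDiffVectorBundle ω F E 𝓘(ℂ)] [T1Space X]

omit [T1Space X] in
theorem tendsto_chart_sub (p : X) :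
    Filter.Tendsto (fun y => chartAt ℂ p y - chartAt ℂ p p) (𝓝[≠] p) (𝓝 0) := by
  have h := ((chartAt ℂ p).continuousAt (mem_chart_source ℂ p)).tendsto.sub_const (chartAt ℂ p p)
  rw [sub_self] at h
  exact h.mono_left nhdsWithin_le_nhds

/-- If `a < b`, dividing by `z ^ a` gives `g = z ^ (b - a) * h`, which tends to `0`, against `g₀ ≠
0`. Used in both directions, this compares the orders of determinants at a point. -/
theorem le_of_zpow_mul_eventuallyEq {α : Type*} {f : Filter α} [f.NeBot] {z g h : α → ℂ} {a b : ℤ}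
    (hz : Filter.Tendsto z f (𝓝 0)) (hz0 : ∀ᶠ y in f, z y ≠ 0) {g₀ h₀ : ℂ}
    (hg : Filter.Tendsto g f (𝓝 g₀)) (hg0 : g₀ ≠ 0) (hh : Filter.Tendsto h f (𝓝 h₀))
    (heq : ∀ᶠ y in f, z y ^ a * g y = z y ^ b * h y) : b ≤ a := by
  by_contra! hab
  obtain ⟨n, hn⟩ := Int.eq_ofNat_of_zero_le (sub_nonneg.2 hab.le)
  have hn0 : n ≠ 0 := by omega
  have h1 : Filter.Tendsto (fun y => z y ^ n * h y) f (𝓝 0) := by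
    have := (hz.pow n).mul hh
    rwa [zero_pow hn0, zero_mul] at this
  refine hg0 (tendsto_nhds_unique_of_eventuallyEq hg h1 ?_)
  filter_upwards [heq, hz0] with y h2 h3
  have h4 : b = a + n := by omega
  rw [h4, zpow_add₀ h3, zpow_natCast, mul_assoc] at h2
  exact mul_left_cancel₀ (zpow_ne_zero _ h3) h2

namespace BundlePair

variable (Q : BundlePair F E)

theorem holEndAt {x : X} (hx : x ∉ Q.sing) : HolEndAt F (fun y => (Q.ρ y).toLinearMap) x :=
  Q.holomorphic.holEndAt (Q.finite_sing.isClosed.isOpen_compl.mem_nhds hx)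

variable {Q}

/-- As `sing` is finite, `V` is invariant throughout a punctured neighbourhood of `x`, and the
saturation at `x` sees nothing else of `V`. -/
theorem invariant_of_saturation {r : ℕ} {W : HolSubbundle F E r} {V : ∀ x, Submodule ℂ (E x)}
    (hW : W.carrier = saturation F V) (hV : ∀ x ∉ Q.sing, ∀ v ∈ V x, Q.ρ x v ∈ V x) :
    Q.Invariant W := by
  intro x hx v hv
  rw [hW] at hv ⊢
  refine saturation_invariant (Q.holEndAt hx) ?_ hv
  filter_upwards [eventually_notMem_of_finite Q.finite_sing x] with y hy using hV y hy

variable [IsManifold 𝓘(ℂ) ω X]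

/-- The restriction of `ρ` to an invariant subbundle has exponents at every singular point. -/
theorem Invariant.exists_hasExponentsAt {r : ℕ} {W : HolSubbundle F E r} (hW : Q.Invariant W)
    {p : X} (hp : p ∈ Q.sing) : ∃ k, Q.HasExponentsAt W p k := by
  obtain ⟨U, hU, hpU, hUc, n, A, hA, hAρ⟩ := Q.meromorphic p hp
  have hsing := eventually_notMem_of_finite Q.finite_sing p
  have hAρ' : ∀ᶠ y in 𝓝[≠] p, A y = (chartAt ℂ p y - chartAt ℂ p p) ^ n • Q.ρ y := by
    filter_upwards [self_mem_nhdsWithin, nhdsWithin_le_nhds (hU.mem_nhds hpU)] with y h1 h2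
    exact hAρ y h2 h1
  have hAW : ∀ᶠ y in 𝓝[≠] p, ∀ v ∈ W.carrier y, A y v ∈ W.carrier y := by
    filter_upwards [hAρ', hsing] with y h1 h2 v hv
    rw [h1]
    exact Submodule.smul_mem _ _ (hW y h2 v hv)
  -- The holomorphic `A = z ^ n ρ` has a Smith form on `W`; dividing by `z ^ n` will give the
  -- exponents `d a - n`.
  obtain ⟨r', m, v, q, d, hrm, hv, hq, h⟩ :=
    (W.isFrameAt p).exists_smith (hA.holEndAt (hU.mem_nhds hpU)) hAW
  -- A zero diagonal entry would put a nonzero vector in the kernel of `ρ` at a nearby regular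
  -- point.
  have hr' : r' = 0 := by
    by_contra h0
    have := neBot_nhdsNE p
    obtain ⟨y, h1, h2, h3, h4, h5⟩ := (hAρ'.and (hsing.and ((eventually_chart_ne p).and
      ((h.filter_mono nhdsWithin_le_nhds).and
        (hv.basis.filter_mono nhdsWithin_le_nhds))))).exists
    let a : Fin r' := ⟨0, by omega⟩
    have h6 : A y (v (Sum.inl a) y) = 0 := h4.1 a
    rw [h1, smul_apply, smul_eq_zero] at h6
    have h7 := h6.resolve_left (pow_ne_zero _ h3)
    exact h5.1.ne_zero (Sum.inl a) ((Q.bijective y h2).1 (h7.trans (map_zero _).symm))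
  subst hr'
  obtain rfl : m = r := by omega
  let e : Fin m ≃ Fin 0 ⊕ Fin m := (Equiv.emptySum _ _).symm
  obtain ⟨U₁, hU₁, hp₁, hs₁⟩ := (hv.reindex e).exists_isHolFrameOn
  obtain ⟨U₂, hU₂, hp₂, hs₂⟩ := (hq.reindex e).exists_isHolFrameOn
  obtain ⟨U₃, h3, hU₃, hp₃⟩ := eventually_nhds_iff.1 h
  refine ⟨fun a => (d a : ℤ) - n, U ∩ U₁ ∩ U₂ ∩ U₃, ((hU.inter hU₁).inter hU₂).inter hU₃,
    ⟨⟨⟨hpU, hp₁⟩, hp₂⟩, hp₃⟩, fun y hy => hUc hy.1.1.1, _, _, hs₁.mono fun y hy => hy.1.1.2,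
    hs₂.mono fun y hy => hy.1.2, fun y hy hyp a => ?_⟩
  have hz : chartAt ℂ p y - chartAt ℂ p p ≠ 0 := sub_ne_zero.2 fun h =>
    hyp ((chartAt ℂ p).injOn (hUc hy.1.1.1) (mem_chart_source ℂ p) h)
  have h4 : A y (v (Sum.inr a) y) = _ := (h3 y hy.2).2 a
  rw [hAρ y hy.1.1.1 hyp, smul_apply] at h4
  change Q.ρ y (v (Sum.inr a) y) = _ • q (Sum.inr a) y
  rw [zpow_sub₀ hz, zpow_natCast, zpow_natCast, div_eq_inv_mul, ← smul_smul, ← h4, smul_smul,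
    inv_mul_cancel₀ (pow_ne_zero _ hz), one_smul]

/-- The determinant of the restriction of `ρ` to `W` near a point with given exponents. -/
theorem HasExponentsAt.exists_det {r : ℕ} {W : HolSubbundle F E r} {p : X} {k : Fin r → ℤ}
    (h : Q.HasExponentsAt W p k) :
    ∃ g : X → ℂ, ContinuousAt g p ∧ g p ≠ 0 ∧ ∀ᶠ y in 𝓝[≠] p,
      ∀ hy : ∀ v ∈ W.carrier y, (Q.ρ y).toLinearMap v ∈ W.carrier y,
        LinearMap.det ((Q.ρ y).toLinearMap.restrict hy) =
          (chartAt ℂ p y - chartAt ℂ p p) ^ (∑ a, k a) * g y := by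
  obtain ⟨U, hU, hpU, -, s, s', hs, hs', hρ⟩ := h
  have hf := hs.isFrameAt hU hpU
  have hf' := hs'.isFrameAt hU hpU
  obtain ⟨C, hC, hC0, hCs⟩ := hf.exists_matrix hf'
  refine ⟨fun y => (C y).det, (HolFunAt.det hC).continuousAt, hC0, ?_⟩
  · filter_upwards [self_mem_nhdsWithin, nhdsWithin_le_nhds (hU.mem_nhds hpU),
      hf.basis.filter_mono nhdsWithin_le_nhds,
      hCs.filter_mono nhdsWithin_le_nhds, eventually_chart_ne p]
      with y h2 h3 h4 h5 h6 hy
    rw [det_restrict_eq h4.1 h4.2 hy (c := C y)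
      (l := fun a => (chartAt ℂ p y - chartAt ℂ p p) ^ k a)]
    · congr 1
      -- Integer powers of a nonzero number turn sums into products, so this is `map_sum` for a
      -- homomorphism into the additive copy of `ℂ`.
      exact (map_sum (⟨⟨fun n : Multiplicative ℤ => (chartAt ℂ p y - chartAt ℂ p p) ^ n.toAdd,
        zpow_zero _⟩, fun a b => zpow_add₀ h6 _ _⟩ : Multiplicative ℤ →* ℂ).toAdditive _ _).symm
    · intro a
      rw [ContinuousLinearMap.coe_coe, hρ y h3 h2 a, h5 a]

/-- The exponents of `ρ` on `E` and on the saturated kernel and image of an endomorphism commuting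
with `ρ` have the same sum. -/
theorem sum_exponents_eq {τ : ∀ x, E x →ₗ[ℂ] E x} {r m n : ℕ} {p : X}
    (hτ : HasSmithFormAt F τ r m p) (hcomm : ∀ x ∉ Q.sing, ∀ v, τ x (Q.ρ x v) = Q.ρ x (τ x v))
    {K : HolSubbundle F E r} {I : HolSubbundle F E m} {W : HolSubbundle F E n}
    (hK : K.carrier = saturation F fun y => LinearMap.ker (τ y))
    (hI : I.carrier = saturation F fun y => LinearMap.range (τ y))
    (hW : ∀ x, W.carrier x = ⊤) {kK : Fin r → ℤ} {kI : Fin m → ℤ} {k : Fin n → ℤ}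
    (heK : Q.HasExponentsAt K p kK) (heI : Q.HasExponentsAt I p kI)
    (hk : Q.HasExponentsAt W p k) : ∑ a, k a = ∑ a, kK a + ∑ a, kI a := by
  obtain ⟨gK, hgK, hgK0, hdK⟩ := heK.exists_det
  obtain ⟨gI, hgI, hgI0, hdI⟩ := heI.exists_det
  obtain ⟨g, hg, hg0, hd⟩ := hk.exists_det
  obtain ⟨v, q, d, hv, hq, hvq⟩ := hτ
  have hsat := (HasSmithFormAt.eventually_saturation hv hq hvq).2.2
  rw [← hK, ← hI] at hsat
  -- Off `p` the determinant of `ρ` splits by `det_eq_det_ker_mul_det_range`; comparing orders at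
  -- `p` then gives the sum.
  have key : ∀ᶠ y in 𝓝[≠] p, (chartAt ℂ p y - chartAt ℂ p p) ^ (∑ a, k a) * g y =
      (chartAt ℂ p y - chartAt ℂ p p) ^ (∑ a, kK a + ∑ a, kI a) * (gK y * gI y) := by
    filter_upwards [hdK, hdI, hd, hsat, eventually_notMem_of_finite Q.finite_sing p,
      eventually_chart_ne p] with y h1 h2 h3 h4 h5 h6
    have := finiteDimensional_fiber F E y
    rw [h4.1] at h1
    rw [h4.2] at h2
    rw [hW] at h3
    have hcK : ∀ v ∈ LinearMap.ker (τ y), (Q.ρ y).toLinearMap v ∈ LinearMap.ker (τ y) := by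
      intro v hv
      rw [LinearMap.mem_ker] at hv ⊢
      rw [ContinuousLinearMap.coe_coe, hcomm y h5, hv, map_zero]
    have hcI : ∀ v ∈ LinearMap.range (τ y), (Q.ρ y).toLinearMap v ∈ LinearMap.range (τ y) := by
      rintro _ ⟨v, rfl⟩
      exact ⟨Q.ρ y v, hcomm y h5 v⟩
    have h7 := det_eq_det_ker_mul_det_range (f := (Q.ρ y).toLinearMap) (g := τ y) (hcomm y h5)
      hcK hcI
    have h8 : LinearMap.det ((Q.ρ y).toLinearMap.restrict
        (fun v (_ : v ∈ (⊤ : Submodule ℂ (E y))) => Submodule.mem_top (x := Q.ρ y v))) =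
        LinearMap.det (Q.ρ y).toLinearMap := by
      rw [← LinearMap.det_conj (Q.ρ y).toLinearMap Submodule.topEquiv.symm]
      rfl
    rw [← h3 (fun v _ => Submodule.mem_top), h8, h7, h1 hcK, h2 hcI, zpow_add₀ h6]
    ring
  have := neBot_nhdsNE p
  have hg' := hg.tendsto.mono_left (nhdsWithin_le_nhds (s := {p}ᶜ))
  have hKI := (hgK.mul hgI).tendsto.mono_left (nhdsWithin_le_nhds (s := {p}ᶜ))
  exact le_antisymm
    (le_of_zpow_mul_eventuallyEq (tendsto_chart_sub p) (eventually_chart_ne p) hKI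
      (mul_ne_zero hgK0 hgI0) hg' (key.mono fun y hy => hy.symm))
    (le_of_zpow_mul_eventuallyEq (tendsto_chart_sub p) (eventually_chart_ne p) hg' hg0 hKI key)

end BundlePair

end Exponents

/-! ### The Laplacian on the complex plane -/

section LaplacianPlane

open Laplacian InnerProductSpace MeasureTheory

theorem two_le_infty : (1 : ℕ∞ω) + 1 ≤ ∞ := by
  rw [one_add_one_eq_two]
  exact WithTop.coe_le_coe.2 (le_top (a := (2 : ℕ∞)))

theorem laplacian_eq_fderiv_fderiv (u : ℂ → ℝ) (z : ℂ) :
    Δ u z = fderiv ℝ (fderiv ℝ u) z 1 1 + fderiv ℝ (fderiv ℝ u) z Complex.I Complex.I := by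
  rw [laplacian_eq_iteratedFDeriv_complexPlane]
  simp [iteratedFDeriv_two_apply]

theorem laplacian_congr {u v : ℂ → ℝ} {z : ℂ} (h : ∀ᶠ w in 𝓝 z, u w = v w) : Δ u z = Δ v z :=
  (laplacian_congr_nhds h).self_of_nhds

theorem continuousAt_laplacian {u : ℂ → ℝ} {z : ℂ} (hu : ContDiffAt ℝ ∞ u z) :
    ContinuousAt (Δ u) z := by
  have h1 : ContDiffAt ℝ 0 (fderiv ℝ (fderiv ℝ u)) z :=
    (hu.fderiv_right (m := 1) two_le_infty).fderiv_right (by norm_num)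
  have h2 := h1.continuousAt
  have h3 : Δ u = fun z => fderiv ℝ (fderiv ℝ u) z 1 1 +
      fderiv ℝ (fderiv ℝ u) z Complex.I Complex.I := funext (laplacian_eq_fderiv_fderiv u)
  rw [h3]
  exact ((h2.clm_apply continuousAt_const).clm_apply continuousAt_const).add
    ((h2.clm_apply continuousAt_const).clm_apply continuousAt_const)

/-- Integration by parts against the constant `1`. -/
theorem integral_fderiv_eq_zero {g : ℂ → ℝ} (hg : ContDiff ℝ 1 g) (hc : HasCompactSupport g)
    (v : ℂ) : ∫ z, fderiv ℝ g z v = 0 := by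
  have h1 : Continuous fun z => fderiv ℝ g z v :=
    (hg.continuous_fderiv one_ne_zero).clm_apply continuous_const
  have h2 : HasCompactSupport fun z => fderiv ℝ g z v := (hc.fderiv_apply ℝ v)
  have h := integral_mul_fderiv_eq_neg_fderiv_mul_of_integrable (μ := volume) (v := v)
    (f := fun _ : ℂ => (1 : ℝ)) (g := g) (by simp)
    (by simpa using h1.integrable_of_hasCompactSupport h2)
    (by simpa using hg.continuous.integrable_of_hasCompactSupport hc)
    (fun _ _ => differentiableAt_const _) (fun z _ => hg.differentiable one_ne_zero z)
  simpa using h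

theorem integral_laplacian_eq_zero {u : ℂ → ℝ} (hu : ContDiff ℝ ∞ u) (hc : HasCompactSupport u) :
    ∫ z, Δ u z = 0 := by
  have h1 : ContDiff ℝ 1 (fderiv ℝ u) := hu.fderiv_right two_le_infty
  have h2 : ∀ v, ContDiff ℝ 1 fun z => fderiv ℝ u z v := fun v => h1.clm_apply contDiff_const
  have h3 : ∀ v, HasCompactSupport fun z => fderiv ℝ u z v := fun v => hc.fderiv_apply ℝ v
  have h4 : ∀ v z, fderiv ℝ (fderiv ℝ u) z v v = fderiv ℝ (fun z => fderiv ℝ u z v) z v := by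
    intro v z
    rw [fderiv_clm_apply (h1.differentiable one_ne_zero z) (differentiableAt_const _)]
    simp
  have h5 : ∀ v, Integrable fun z => fderiv ℝ (fun z => fderiv ℝ u z v) z v := fun v =>
    (((h2 v).continuous_fderiv one_ne_zero).clm_apply continuous_const).integrable_of_hasCompactSupport
      ((h3 v).fderiv_apply ℝ v)
  simp only [laplacian_eq_fderiv_fderiv, h4]
  rw [integral_add (h5 1) (h5 Complex.I), integral_fderiv_eq_zero (h2 _) (h3 _),
    integral_fderiv_eq_zero (h2 _) (h3 _), add_zero]

/-- The second derivative of `φ ∘ u`. -/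
theorem fderiv_fderiv_comp_real {u : ℂ → ℝ} {z : ℂ} (hu : ContDiffAt ℝ ∞ u z) {φ φ' : ℝ → ℝ}
    {φ'' : ℝ} (h1 : ∀ᶠ w in 𝓝 z, HasDerivAt φ (φ' (u w)) (u w)) (h2 : HasDerivAt φ' φ'' (u z))
    (a : ℂ) : fderiv ℝ (fderiv ℝ fun w => φ (u w)) z a a =
      φ' (u z) * fderiv ℝ (fderiv ℝ u) z a a + φ'' * (fderiv ℝ u z a) ^ 2 := by
  have hd : ∀ᶠ w in 𝓝 z, DifferentiableAt ℝ u w := by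
    filter_upwards [(hu.of_le (m := 1) (by exact_mod_cast le_top)).eventually (by simp)] with w hw
    exact hw.differentiableAt one_ne_zero
  have h3 : fderiv ℝ (fun w => φ (u w)) =ᶠ[𝓝 z] fun w => φ' (u w) • fderiv ℝ u w := by
    filter_upwards [h1, hd] with w hw hw'
    exact (hw.comp_hasFDerivAt w hw'.hasFDerivAt).fderiv
  rw [h3.fderiv_eq]
  have h4 : DifferentiableAt ℝ (fderiv ℝ u) z :=
    (hu.fderiv_right (m := 1) two_le_infty).differentiableAt one_ne_zero
  have h5 : HasFDerivAt (fun w => φ' (u w)) (φ'' • fderiv ℝ u z) z :=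
    h2.comp_hasFDerivAt z hd.self_of_nhds.hasFDerivAt
  have h6 := (h5.smul h4.hasFDerivAt).fderiv
  simp only [Pi.smul_def'] at h6
  rw [h6]
  simp
  ring

/-- `log (f + ε)` is almost as subharmonic as `log f`. -/
theorem le_laplacian_log_add {f : ℂ → ℝ} {z : ℂ} (hf : ContDiffAt ℝ ∞ f z) (h0 : 0 < f z) {ε : ℝ}
    (hε : 0 < ε) : f z / (f z + ε) * Δ (fun w => Real.log (f w)) z ≤
      Δ (fun w => Real.log (f w + ε)) z := by
  set u := fun w => Real.log (f w) with hu_def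
  have hu : ContDiffAt ℝ ∞ u z := hf.log h0.ne'
  have hpos : ∀ᶠ w in 𝓝 z, 0 < f w := hf.continuousAt.eventually (lt_mem_nhds h0)
  -- With `u = log f`, `log (f + ε)` is `φ ∘ u` for the convex function `φ t = log (exp t + ε)`. Its
  -- Laplacian is `φ'(u) Δu`, where `φ'(u) = f / (f + ε)`, plus `φ''(u) |∇u|² ≥ 0`.
  have h1 : Δ (fun w => Real.log (f w + ε)) z = Δ (fun w => Real.log (Real.exp (u w) + ε)) z := by
    refine laplacian_congr ?_
    filter_upwards [hpos] with w hw
    rw [hu_def, Real.exp_log hw]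
  have hpos' : ∀ t, Real.exp t + ε ≠ 0 := fun t => by positivity
  have hd1 : ∀ t, HasDerivAt (fun t => Real.log (Real.exp t + ε))
      (Real.exp t / (Real.exp t + ε)) t := fun t =>
    ((Real.hasDerivAt_exp t).add_const ε).log (hpos' t)
  have hd2 : HasDerivAt (fun t => Real.exp t / (Real.exp t + ε))
      (Real.exp (u z) * ε / (Real.exp (u z) + ε) ^ 2) (u z) := by
    have := (Real.hasDerivAt_exp (u z)).div ((Real.hasDerivAt_exp (u z)).add_const ε) (hpos' _)
    refine this.congr_deriv ?_
    congr 1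
    ring
  have key := fderiv_fderiv_comp_real hu (Filter.Eventually.of_forall fun w => hd1 (u w)) hd2
  rw [h1, laplacian_eq_fderiv_fderiv, laplacian_eq_fderiv_fderiv, key, key]
  have h2 : Real.exp (u z) = f z := Real.exp_log h0
  rw [h2]
  have h3 : 0 ≤ f z * ε / (f z + ε) ^ 2 := by positivity
  nlinarith [mul_nonneg h3 (sq_nonneg (fderiv ℝ u z 1)),
    mul_nonneg h3 (sq_nonneg (fderiv ℝ u z Complex.I))]

/-- Conformal change of variables in the Laplacian. -/
theorem laplacian_comp_analytic {u : ℂ → ℝ} {ψ : ℂ → ℂ} {z : ℂ} (hψ : AnalyticAt ℂ ψ z)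
    (hu : ContDiffAt ℝ ∞ u (ψ z)) :
    Δ (fun w => u (ψ w)) z = Complex.normSq (deriv ψ z) * Δ u (ψ z) := by
  have hd : ∀ᶠ w in 𝓝 (ψ z), DifferentiableAt ℝ u w := by
    filter_upwards [(hu.of_le (m := 1) (by exact_mod_cast le_top)).eventually (by simp)] with w hw
    exact hw.differentiableAt one_ne_zero
  have hψr : ∀ {g : ℂ → ℂ} {w : ℂ}, AnalyticAt ℂ g w →
      HasFDerivAt g ((ContinuousLinearMap.mul ℝ ℂ) (deriv g w)) w := by
    intro g w hg
    have h := hg.differentiableAt.hasDerivAt.hasFDerivAt.restrictScalars ℝ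
    refine h.congr_fderiv ?_
    ext
    simp [mul_comm]
  have h3 : fderiv ℝ (fun w => u (ψ w)) =ᶠ[𝓝 z] fun w =>
      (fderiv ℝ u (ψ w)).comp ((ContinuousLinearMap.mul ℝ ℂ) (deriv ψ w)) := by
    filter_upwards [hψ.continuousAt.eventually hd, hψ.eventually_analyticAt] with w hw hw'
    exact (hw.hasFDerivAt.comp w (hψr hw')).fderiv
  have h4 : HasFDerivAt (fderiv ℝ u) (fderiv ℝ (fderiv ℝ u) (ψ z)) (ψ z) :=
    ((hu.fderiv_right (m := 1) two_le_infty).differentiableAt one_ne_zero).hasFDerivAt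
  have h5 := h4.comp z (hψr hψ)
  have h6 : HasFDerivAt (fun w => (ContinuousLinearMap.mul ℝ ℂ) (deriv ψ w))
      ((ContinuousLinearMap.mul ℝ ℂ).comp ((ContinuousLinearMap.mul ℝ ℂ) (deriv (deriv ψ) z))) z :=
    (ContinuousLinearMap.mul ℝ ℂ).hasFDerivAt.comp z (hψr hψ.deriv)
  have h7 := (h5.clm_comp h6).fderiv
  rw [laplacian_eq_fderiv_fderiv, laplacian_eq_fderiv_fderiv, h3.fderiv_eq]
  simp only [Function.comp_def] at h7
  rw [h7]
  set c := deriv ψ z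
  set B := fderiv ℝ (fderiv ℝ u) (ψ z)
  have hc : c = c.re • (1 : ℂ) + c.im • Complex.I := by
    simp [Complex.re_add_im]
  have hcI : c * Complex.I = (-c.im) • (1 : ℂ) + c.re • Complex.I := by
    apply Complex.ext <;> simp
  -- The terms with the second derivative of `ψ` cancel because `1 + I * I = 0`.
  have e1 : fderiv ℝ u (ψ z) (deriv (deriv ψ) z) +
      fderiv ℝ u (ψ z) (deriv (deriv ψ) z * Complex.I * Complex.I) = 0 := by
    rw [← map_add, mul_assoc, Complex.I_mul_I]
    simp
  -- Multiplication by `c` is a rotation scaled by `|c|`, so it scales the trace of `B` by `|c|²`.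
  have e2 : B c c + B (c * Complex.I) (c * Complex.I) =
      Complex.normSq c * (B 1 1 + B Complex.I Complex.I) := by
    rw [hcI]
    have : B c c = B (c.re • (1 : ℂ) + c.im • Complex.I) (c.re • (1 : ℂ) + c.im • Complex.I) := by
      rw [← hc]
    rw [this]
    simp only [map_add, map_smul, add_apply, smul_apply,
      smul_eq_mul, Complex.normSq_apply]
    ring
  simp only [add_apply, ContinuousLinearMap.comp_apply,
    ContinuousLinearMap.compL_apply, ContinuousLinearMap.flip_apply, ContinuousLinearMap.mul_apply',
    mul_one]
  linarith

/-- A holomorphic factor does not change the Laplacian of the logarithm. -/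
theorem laplacian_log_normSq_mul {m : ℂ → ℂ} {g : ℂ → ℝ} {z : ℂ} (hm : AnalyticAt ℂ m z)
    (hm0 : m z ≠ 0) (hg : ContDiffAt ℝ ∞ g z) (hg0 : 0 < g z) :
    Δ (fun w => Real.log (Complex.normSq (m w) * g w)) z = Δ (fun w => Real.log (g w)) z := by
  -- `log |m|²` is twice the harmonic function `log ‖m‖` and contributes nothing.
  have h1 := hm.harmonicAt_log_norm hm0
  have hlog : ContDiffAt ℝ 2 (fun w => Real.log (g w)) z :=
    (hg.log hg0.ne').of_le (one_add_one_eq_two (R := ℕ∞ω) ▸ two_le_infty)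
  have h2 : Δ (fun w => Real.log (Complex.normSq (m w) * g w)) z =
      Δ ((2 : ℝ) • (fun w => Real.log ‖m w‖) + fun w => Real.log (g w)) z := by
    refine laplacian_congr ?_
    filter_upwards [hm.continuousAt.eventually_ne hm0,
      hg.continuousAt.eventually (lt_mem_nhds hg0)] with w hw hw'
    rw [Real.log_mul (by simpa using hw) hw'.ne', Complex.normSq_eq_norm_sq, Real.log_pow]
    simp
  have h3 : ContDiffAt ℝ 2 ((2 : ℝ) • fun w => Real.log ‖m w‖) z := h1.1.const_smul (2 : ℝ)
  rw [h2, h3.laplacian_add hlog, laplacian_smul _ h1.1]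
  simp [h1.2.self_of_nhds]

end LaplacianPlane

/-! ### Stokes' theorem on a compact Riemann surface -/

section Stokes

open Laplacian InnerProductSpace MeasureTheory

variable {X : Type*} [TopologicalSpace X] [ChartedSpace ℂ X]

/-- `u` is a smooth real function near `x`. -/
abbrev SmoothFunAt (u : X → ℝ) (x : X) : Prop := ContMDiffAt 𝓘(ℝ, ℂ) 𝓘(ℝ, ℝ) ∞ u x

variable [IsManifold 𝓘(ℂ) ω X]

theorem SmoothFunAt.contDiffAt {u : X → ℝ} {i x : X} (hx : x ∈ (chartAt ℂ i).source)
    (hu : SmoothFunAt u x) :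
    ContDiffAt ℝ ∞ (fun w => u ((chartAt ℂ i).symm w)) (chartAt ℂ i x) := by
  have : IsManifold 𝓘(ℝ, ℂ) ∞ X := isManifold_real
  have h1 : ContMDiffAt 𝓘(ℝ, ℂ) 𝓘(ℝ, ℂ) ∞ (chartAt ℂ i).symm (chartAt ℂ i x) :=
    contMDiffOn_chart_symm.contMDiffAt
      ((chartAt ℂ i).open_target.mem_nhds ((chartAt ℂ i).map_source hx))
  have h2 : ContMDiffAt 𝓘(ℝ, ℂ) 𝓘(ℝ, ℝ) ∞ (u ∘ (chartAt ℂ i).symm) (chartAt ℂ i x) := by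
    refine ContMDiffAt.comp _ ?_ h1
    rwa [(chartAt ℂ i).left_inv hx]
  exact h2.contDiffAt

theorem SmoothFunAt.contDiffAt_symm {u : X → ℝ} {i : X} {z : ℂ} (hz : z ∈ (chartAt ℂ i).target)
    (hu : SmoothFunAt u ((chartAt ℂ i).symm z)) :
    ContDiffAt ℝ ∞ (fun w => u ((chartAt ℂ i).symm w)) z := by
  have h := SmoothFunAt.contDiffAt ((chartAt ℂ i).map_target hz) hu
  rwa [(chartAt ℂ i).right_inv hz] at h

/-- The transition map between two charts. -/
def transition (i j : X) (z : ℂ) : ℂ := chartAt ℂ j ((chartAt ℂ i).symm z)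

theorem analyticAt_transition {i j : X} {z : ℂ} (hz : z ∈ (chartAt ℂ i).target)
    (hj : (chartAt ℂ i).symm z ∈ (chartAt ℂ j).source) : AnalyticAt ℂ (transition i j) z := by
  have h := (holFunAt_chart hj).analyticAt ((chartAt ℂ i).map_target hz)
  rwa [(chartAt ℂ i).right_inv hz] at h

theorem eventually_mem_source {i : X} {z : ℂ} (hz : z ∈ (chartAt ℂ i).target) {U : Set X}
    (hU : U ∈ 𝓝 ((chartAt ℂ i).symm z)) : ∀ᶠ w in 𝓝 z, (chartAt ℂ i).symm w ∈ U :=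
  ((chartAt ℂ i).continuousAt_symm hz).eventually hU

theorem laplacian_chart_change {u : X → ℝ} {i j : X} {z : ℂ} (hz : z ∈ (chartAt ℂ i).target)
    (hj : (chartAt ℂ i).symm z ∈ (chartAt ℂ j).source)
    (hu : SmoothFunAt u ((chartAt ℂ i).symm z)) :
    Δ (fun w => u ((chartAt ℂ i).symm w)) z = Complex.normSq (deriv (transition i j) z) *
      Δ (fun w => u ((chartAt ℂ j).symm w)) (transition i j z) := by
  rw [← laplacian_comp_analytic (analyticAt_transition hz hj) (hu.contDiffAt hj)]
  refine laplacian_congr ?_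
  filter_upwards [eventually_mem_source hz ((chartAt ℂ j).open_source.mem_nhds hj)]
    with w hw
  rw [transition, (chartAt ℂ j).left_inv hw]

/-- The Jacobian of a holomorphic change of chart. It matches the factor by which the Laplacian
changes, so `Δ v dx ∧ dy` does not depend on the chart. -/
theorem det_mul_left (c : ℂ) :
    ((ContinuousLinearMap.toSpanSingleton ℂ c).restrictScalars ℝ).det = Complex.normSq c := by
  rw [ContinuousLinearMap.det, ← LinearMap.det_toMatrix Complex.basisOneI, Matrix.det_fin_two]
  simp [LinearMap.toMatrix_apply, Complex.normSq_apply]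

theorem laplacian_eq_zero_of_notMem_tsupport {v : X → ℝ} {i : X} {z : ℂ}
    (hz : z ∈ (chartAt ℂ i).target) (hv : (chartAt ℂ i).symm z ∉ tsupport v) :
    Δ (fun w => v ((chartAt ℂ i).symm w)) z = 0 := by
  have h : Δ (fun w => v ((chartAt ℂ i).symm w)) z = Δ (fun _ : ℂ => (0 : ℝ)) z := by
    refine laplacian_congr ?_
    filter_upwards [eventually_mem_source hz
      ((isClosed_tsupport v).isOpen_compl.mem_nhds hv)] with w hw
    exact image_eq_zero_of_notMem_tsupport hw
  rw [h, laplacian_const]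
  rfl

/-- The integral of `P · Δ v` does not depend on the chart. -/
theorem integral_laplacian_chart_change {P v : X → ℝ} {i j : X}
    (hP : tsupport P ⊆ (chartAt ℂ i).source) (hv : tsupport v ⊆ (chartAt ℂ j).source)
    (hsm : ∀ x, SmoothFunAt v x) :
    ∫ z in (chartAt ℂ i).target, P ((chartAt ℂ i).symm z) *
        Δ (fun w => v ((chartAt ℂ i).symm w)) z =
      ∫ z in (chartAt ℂ j).target, P ((chartAt ℂ j).symm z) *
        Δ (fun w => v ((chartAt ℂ j).symm w)) z := by
  let e := (chartAt ℂ i).symm ≫ₕ chartAt ℂ j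
  have hsrc : ∀ z, z ∈ e.source ↔ z ∈ (chartAt ℂ i).target ∧
      (chartAt ℂ i).symm z ∈ (chartAt ℂ j).source := fun z => by
    simp [e]
  have htgt : ∀ z, z ∈ e.target ↔ z ∈ (chartAt ℂ j).target ∧
      (chartAt ℂ j).symm z ∈ (chartAt ℂ i).source := fun z => by
    simp [e]
  -- Both integrals reduce to the overlap of the charts: outside it, `Δ v` vanishes on the `i` side
  -- and `P` on the `j` side.
  have h1 := setIntegral_eq_of_subset_of_forall_sdiff_eq_zero (μ := volume)
    (f := fun z => P ((chartAt ℂ i).symm z) * Δ (fun w => v ((chartAt ℂ i).symm w)) z)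
    (chartAt ℂ i).open_target.measurableSet (s := e.source) (fun z hz => ((hsrc z).1 hz).1)
    (fun z hz => by
      have h2 : (chartAt ℂ i).symm z ∉ (chartAt ℂ j).source := fun h => hz.2 ((hsrc z).2 ⟨hz.1, h⟩)
      rw [laplacian_eq_zero_of_notMem_tsupport hz.1 fun h => h2 (hv h), mul_zero])
  have h2 := setIntegral_eq_of_subset_of_forall_sdiff_eq_zero (μ := volume)
    (f := fun z => P ((chartAt ℂ j).symm z) * Δ (fun w => v ((chartAt ℂ j).symm w)) z)
    (chartAt ℂ j).open_target.measurableSet (s := e.target) (fun z hz => ((htgt z).1 hz).1)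
    (fun z hz => by
      have h2 : (chartAt ℂ j).symm z ∉ (chartAt ℂ i).source := fun h => hz.2 ((htgt z).2 ⟨hz.1, h⟩)
      rw [image_eq_zero_of_notMem_tsupport fun h => h2 (hP h), zero_mul])
  rw [h1, h2, ← e.image_source_eq_target,
    integral_image_eq_integral_abs_det_fderiv_smul volume e.open_source.measurableSet
      (f' := fun z => (ContinuousLinearMap.toSpanSingleton ℂ
        (deriv (transition i j) z)).restrictScalars ℝ) _ e.injOn]
  · refine setIntegral_congr_fun e.open_source.measurableSet fun z hz => ?_
    have hz' := (hsrc z).1 hz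
    rw [det_mul_left, abs_of_nonneg (Complex.normSq_nonneg _),
      laplacian_chart_change hz'.1 hz'.2 (hsm _)]
    have h3 : e z = transition i j z := rfl
    have h4 : (chartAt ℂ j).symm (transition i j z) = (chartAt ℂ i).symm z :=
      (chartAt ℂ j).left_inv hz'.2
    rw [h3, h4, smul_eq_mul]
    ring
  · intro z hz
    have hz' := (hsrc z).1 hz
    exact ((analyticAt_transition hz'.1 hz'.2).differentiableAt.hasDerivAt.hasFDerivAt.restrictScalars
      ℝ).hasFDerivWithinAt

variable [CompactSpace X]

theorem isCompact_image_tsupport {v : X → ℝ} {i : X} (hv : tsupport v ⊆ (chartAt ℂ i).source) :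
    IsCompact (chartAt ℂ i '' tsupport v) :=
  (isClosed_tsupport v).isCompact.image_of_continuousOn ((chartAt ℂ i).continuousOn.mono hv)

variable [T2Space X]

/-- The support of `v` is compact inside the chart, so extension by zero gives a smooth compactly
supported function on `ℂ`. -/
theorem integral_chart_laplacian_eq_zero {v : X → ℝ} {i : X}
    (hv : tsupport v ⊆ (chartAt ℂ i).source) (hsm : ∀ x, SmoothFunAt v x) :
    ∫ z in (chartAt ℂ i).target, Δ (fun w => v ((chartAt ℂ i).symm w)) z = 0 := by
  classical
  let u : ℂ → ℝ := (chartAt ℂ i).target.indicator fun w => v ((chartAt ℂ i).symm w)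
  have hC := isCompact_image_tsupport hv
  have hut : ∀ z ∈ (chartAt ℂ i).target, ∀ᶠ w in 𝓝 z, u w = v ((chartAt ℂ i).symm w) := by
    intro z hz
    filter_upwards [(chartAt ℂ i).open_target.mem_nhds hz] with w hw
    exact Set.indicator_of_mem hw _
  have hu0 : ∀ z ∉ chartAt ℂ i '' tsupport v, u z = 0 := by
    intro z hz
    by_cases hzt : z ∈ (chartAt ℂ i).target
    · simp only [u, Set.indicator_of_mem hzt]
      refine image_eq_zero_of_notMem_tsupport fun h => hz ⟨_, h, (chartAt ℂ i).right_inv hzt⟩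
    · exact Set.indicator_of_notMem hzt _
  have hu0' : ∀ z ∉ chartAt ℂ i '' tsupport v, ∀ᶠ w in 𝓝 z, u w = 0 := by
    intro z hz
    filter_upwards [hC.isClosed.isOpen_compl.mem_nhds hz] with w hw using hu0 w hw
  have hut' : chartAt ℂ i '' tsupport v ⊆ (chartAt ℂ i).target := by
    rintro _ ⟨x, hx, rfl⟩
    exact (chartAt ℂ i).map_source (hv hx)
  have hsmu : ContDiff ℝ ∞ u := by
    rw [contDiff_iff_contDiffAt]
    intro z
    by_cases hz : z ∈ chartAt ℂ i '' tsupport v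
    · exact (SmoothFunAt.contDiffAt_symm (hut' hz) (hsm _)).congr_of_eventuallyEq (hut z (hut' hz))
    · exact contDiffAt_const.congr_of_eventuallyEq (hu0' z hz)
  have hcs : HasCompactSupport u := HasCompactSupport.intro hC hu0
  rw [← integral_laplacian_eq_zero hsmu hcs, ← setIntegral_univ (μ := volume) (f := Δ u)]
  rw [setIntegral_eq_of_subset_of_forall_sdiff_eq_zero (μ := volume) (s := (chartAt ℂ i).target)
    MeasurableSet.univ (Set.subset_univ _)]
  · refine setIntegral_congr_fun (chartAt ℂ i).open_target.measurableSet fun z hz => ?_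
    exact (laplacian_congr (hut z hz)).symm
  · intro z hz
    have h : Δ u z = Δ (fun _ : ℂ => (0 : ℝ)) z :=
      laplacian_congr (hu0' z fun h => hz.2 (hut' h))
    rw [h, laplacian_const]
    rfl

/-- The target of a chart may be unbounded; vanishing off the compact image of `K` is what gives
integrability. -/
theorem integrableOn_of_eq_zero {K : Set X} {i : X} (hK : IsClosed K)
    (hKi : K ⊆ (chartAt ℂ i).source) {q : ℂ → ℝ} (hq : ContinuousOn q (chartAt ℂ i).target)
    (h0 : ∀ z ∈ (chartAt ℂ i).target, (chartAt ℂ i).symm z ∉ K → q z = 0) :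
    IntegrableOn q (chartAt ℂ i).target := by
  have hC : IsCompact (chartAt ℂ i '' K) :=
    hK.isCompact.image_of_continuousOn ((chartAt ℂ i).continuousOn.mono hKi)
  have hut' : chartAt ℂ i '' K ⊆ (chartAt ℂ i).target := by
    rintro _ ⟨x, hx, rfl⟩
    exact (chartAt ℂ i).map_source (hKi hx)
  exact IntegrableOn.of_forall_sdiff_eq_zero ((hq.mono hut').integrableOn_compact hC)
    (chartAt ℂ i).open_target.measurableSet fun z hz =>
      h0 z hz.1 fun h => hz.2 ⟨_, h, (chartAt ℂ i).right_inv hz.1⟩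

theorem integrableOn_chart {P : X → ℝ} {i : X} (hP : tsupport P ⊆ (chartAt ℂ i).source)
    (hPc : Continuous P) {q : ℂ → ℝ} (hq : ContinuousOn q (chartAt ℂ i).target) :
    IntegrableOn (fun z => P ((chartAt ℂ i).symm z) * q z) (chartAt ℂ i).target :=
  integrableOn_of_eq_zero (isClosed_tsupport P) hP
    ((hPc.comp_continuousOn (chartAt ℂ i).continuousOn_symm).mul hq) fun z _ h => by
      rw [image_eq_zero_of_notMem_tsupport h, zero_mul]

theorem laplacian_sum {ι : Type*} {s : Finset ι} {u : ι → ℂ → ℝ} {z : ℂ}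
    (hu : ∀ j, ContDiffAt ℝ ∞ (u j) z) :
    Δ (fun w => ∑ j ∈ s, u j w) z = ∑ j ∈ s, Δ (u j) z := by
  classical
  have h2 : ∀ {f : ℂ → ℝ}, ContDiffAt ℝ ∞ f z → ContDiffAt ℝ 2 f z := fun h =>
    h.of_le (one_add_one_eq_two (R := ℕ∞ω) ▸ two_le_infty)
  induction s using Finset.induction_on with
  | empty => simp
  | insert a s ha ih =>
    simp only [Finset.sum_insert ha]
    rw [← ih]
    exact (h2 (hu a)).laplacian_add (h2 (ContDiffAt.sum fun j _ => hu j))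

theorem continuousOn_laplacian_chart {v : X → ℝ} (hsm : ∀ x, SmoothFunAt v x) (i : X) :
    ContinuousOn (Δ (fun w => v ((chartAt ℂ i).symm w))) (chartAt ℂ i).target := fun _ hz =>
  (continuousAt_laplacian (SmoothFunAt.contDiffAt_symm hz (hsm _))).continuousWithinAt

namespace ChartPartition

variable (P : ChartPartition X)

theorem tsupport_subset (i : X) : tsupport (P.1 i) ⊆ (chartAt ℂ i).source := P.2 i

theorem smoothFunAt (i x : X) : SmoothFunAt (fun y => P.1 i y) x := (P.1 i).contMDiff x

/-- The indices of the nonzero members of the partition. -/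
def indices : Finset X := P.1.locallyFinite.finite_nonempty_of_compact.toFinset

theorem eq_zero_of_notMem {i : X} (hi : i ∉ P.indices) (x : X) : P.1 i x = 0 := by
  by_contra h
  exact hi ((Set.Finite.mem_toFinset _).2 ⟨x, h⟩)

theorem sum_eq_one (x : X) : ∑ i ∈ P.indices, P.1 i x = 1 := by
  rw [← P.1.sum_eq_one (Set.mem_univ x)]
  refine (finsum_eq_sum_of_support_subset _ fun i hi => ?_).symm
  by_contra h
  exact hi (P.eq_zero_of_notMem (by simpa using h) x)

theorem finsum_integral_eq (q : X → ℂ → ℝ) :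
    ∑ᶠ i : X, ∫ z in (chartAt ℂ i).target, P.1 i ((chartAt ℂ i).symm z) * q i z =
      ∑ i ∈ P.indices, ∫ z in (chartAt ℂ i).target, P.1 i ((chartAt ℂ i).symm z) * q i z := by
  refine finsum_eq_sum_of_support_subset _ fun i hi => ?_
  by_contra h
  refine hi ?_
  simp [P.eq_zero_of_notMem (by simpa using h : i ∉ P.indices)]

/-- **Stokes' theorem** for the Laplacian of a smooth function on a compact Riemann surface. -/
theorem sum_integral_laplacian_eq_zero {v : X → ℝ} (hv : ∀ x, SmoothFunAt v x) :
    ∑ i ∈ P.indices, ∫ z in (chartAt ℂ i).target, P.1 i ((chartAt ℂ i).symm z) *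
      Δ (fun w => v ((chartAt ℂ i).symm w)) z = 0 := by
  -- A second copy of the partition cuts `v` into pieces supported in single charts. The integral of
  -- `P i * Δ (u j)` is moved from chart `i` to chart `j`, where summing over `i` removes `P`.
  let u : X → X → ℝ := fun j x => P.1 j x * v x
  have hu : ∀ j x, SmoothFunAt (u j) x := fun j x => (P.smoothFunAt j x).mul (hv x)
  have hut : ∀ j, tsupport (u j) ⊆ (chartAt ℂ j).source := fun j =>
    (tsupport_mul_subset_left (f := fun x => P.1 j x) (g := v)).trans (P.tsupport_subset j)
  have hvu : v = fun x => ∑ j ∈ P.indices, u j x := by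
    ext x
    rw [← Finset.sum_mul, P.sum_eq_one, one_mul]
  have hsum : ∀ i, ∀ z ∈ (chartAt ℂ i).target, Δ (fun w => v ((chartAt ℂ i).symm w)) z =
      ∑ j ∈ P.indices, Δ (fun w => u j ((chartAt ℂ i).symm w)) z := by
    intro i z hz
    rw [hvu]
    exact laplacian_sum fun j => SmoothFunAt.contDiffAt_symm hz (hu j _)
  have hint : ∀ i j, IntegrableOn (fun z => P.1 i ((chartAt ℂ i).symm z) *
      Δ (fun w => u j ((chartAt ℂ i).symm w)) z) (chartAt ℂ i).target := fun i j =>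
    integrableOn_chart (P.tsupport_subset i) (P.1 i).contMDiff.continuous (continuousOn_laplacian_chart (hu j) i)
  have hint' : ∀ i j, IntegrableOn (fun z => P.1 i ((chartAt ℂ j).symm z) *
      Δ (fun w => u j ((chartAt ℂ j).symm w)) z) (chartAt ℂ j).target := by
    intro i j
    refine integrableOn_of_eq_zero (isClosed_tsupport (u j)) (hut j)
      (((P.1 i).contMDiff.continuous.comp_continuousOn (chartAt ℂ j).continuousOn_symm).mul
        (continuousOn_laplacian_chart (hu j) j)) fun z hz h => ?_
    rw [laplacian_eq_zero_of_notMem_tsupport hz h, mul_zero]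
  calc _ = ∑ i ∈ P.indices, ∑ j ∈ P.indices, ∫ z in (chartAt ℂ i).target,
        P.1 i ((chartAt ℂ i).symm z) * Δ (fun w => u j ((chartAt ℂ i).symm w)) z := by
        refine Finset.sum_congr rfl fun i _ => ?_
        rw [← integral_finsetSum _ fun j _ => hint i j]
        refine setIntegral_congr_fun (chartAt ℂ i).open_target.measurableSet fun z hz => ?_
        simp only [hsum i z hz, Finset.mul_sum]
    _ = ∑ i ∈ P.indices, ∑ j ∈ P.indices, ∫ z in (chartAt ℂ j).target,
        P.1 i ((chartAt ℂ j).symm z) * Δ (fun w => u j ((chartAt ℂ j).symm w)) z :=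
        Finset.sum_congr rfl fun i _ => Finset.sum_congr rfl fun j _ =>
          integral_laplacian_chart_change (P.tsupport_subset i) (hut j) (hu j)
    _ = ∑ j ∈ P.indices, ∫ z in (chartAt ℂ j).target,
        Δ (fun w => u j ((chartAt ℂ j).symm w)) z := by
        rw [Finset.sum_comm]
        refine Finset.sum_congr rfl fun j _ => ?_
        rw [← integral_finsetSum _ fun i _ => hint' i j]
        refine setIntegral_congr_fun (chartAt ℂ j).open_target.measurableSet fun z hz => ?_
        simp only [← Finset.sum_mul, P.sum_eq_one, one_mul]
    _ = 0 := Finset.sum_eq_zero fun j _ => integral_chart_laplacian_eq_zero (hut j) (hu j)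

end ChartPartition

end Stokes

/-! ### The regular part of `Δ log f` for a function with analytic zeros -/

section Inequality

open Laplacian InnerProductSpace MeasureTheory

variable {X : Type*} [TopologicalSpace X] [ChartedSpace ℂ X] [IsManifold 𝓘(ℂ) ω X] [T2Space X]
  [CompactSpace X]

/-- By compactness an infinite zero set would accumulate somewhere. -/
theorem finite_of_eventually_ne {f : X → ℝ} (h : ∀ x, ∀ᶠ y in 𝓝[≠] x, f y ≠ 0) :
    {x | f x = 0}.Finite := by
  by_contra hinf
  obtain ⟨x, hx⟩ := Set.Infinite.exists_accPt_principal hinf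
  rw [accPt_iff_frequently_nhdsNE] at hx
  obtain ⟨y, h1, h2⟩ := (hx.and_eventually (h x)).exists
  exact h2 h1

/-- If `f` is locally `|m|² g` with `m` holomorphic and `g` positive, the regular part of the
distribution `Δ log f` has nonpositive integral. -/
theorem ChartPartition.sum_integral_nonpos (P : ChartPartition X) {f : X → ℝ} {D : X → ℂ → ℝ}
    (hloc : ∀ x, ∃ (m : X → ℂ) (g : X → ℝ), HolFunAt m x ∧ (∀ᶠ y in 𝓝[≠] x, m y ≠ 0) ∧
      SmoothFunAt g x ∧ 0 < g x ∧ ∀ᶠ y in 𝓝 x, f y = Complex.normSq (m y) * g y ∧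
        ∀ i, y ∈ (chartAt ℂ i).source → D i (chartAt ℂ i y) =
          Δ (fun w => Real.log (g ((chartAt ℂ i).symm w))) (chartAt ℂ i y)) :
    ∑ i ∈ P.indices, ∫ z in (chartAt ℂ i).target, P.1 i ((chartAt ℂ i).symm z) * D i z ≤ 0 := by
  have : IsManifold 𝓘(ℝ, ℂ) ∞ X := isManifold_real
  have hfsm : ∀ x, SmoothFunAt f x := by
    intro x
    obtain ⟨m, g, hm, -, hg, -, h⟩ := hloc x
    have h1 : SmoothFunAt (fun y => Complex.normSq (m y)) x := by
      have h2 : ContDiff ℝ ∞ (fun z : ℂ => Complex.normSq z) := by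
        simp only [Complex.normSq_eq_norm_sq]
        exact contDiff_norm_sq ℝ
      exact (h2.contDiffAt.contMDiffAt).comp x (contMDiffAt_real hm)
    exact (h1.mul hg).congr_of_eventuallyEq (h.mono fun y hy => hy.1)
  have hfnn : ∀ x, 0 ≤ f x := by
    intro x
    obtain ⟨m, g, -, -, -, hg0, h⟩ := hloc x
    rw [h.self_of_nhds.1]
    exact mul_nonneg (Complex.normSq_nonneg _) hg0.le
  have hfin : {x | f x = 0}.Finite := by
    refine finite_of_eventually_ne fun x => ?_
    obtain ⟨m, g, -, hm0, hg, hg0, h⟩ := hloc x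
    filter_upwards [hm0, h.filter_mono nhdsWithin_le_nhds,
      (hg.continuousAt.eventually (lt_mem_nhds hg0)).filter_mono nhdsWithin_le_nhds]
      with y h1 h2 h3
    rw [h2.1]
    exact mul_ne_zero (by simpa using h1) h3.ne'
  -- Near every point, zeros of `f` included, `D i` is the Laplacian of the smooth function `log g`.
  have hDc : ∀ i, ContinuousOn (D i) (chartAt ℂ i).target := by
    intro i z hz
    obtain ⟨m, g, -, -, hg, hg0, h⟩ := hloc ((chartAt ℂ i).symm z)
    have h1 : ContinuousAt (Δ (fun w => Real.log (g ((chartAt ℂ i).symm w)))) z :=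
      continuousAt_laplacian ((SmoothFunAt.contDiffAt_symm hz hg).log hg0.ne')
    refine (h1.congr ?_).continuousWithinAt
    filter_upwards [eventually_mem_source hz h, (chartAt ℂ i).open_target.mem_nhds hz]
      with w h2 h3
    have := h2.2 i ((chartAt ℂ i).map_target h3)
    rw [(chartAt ℂ i).right_inv h3] at this
    exact this.symm
  -- Where `m` does not vanish, `log |m|²` is harmonic, so `log g` and `log f` have the same
  -- Laplacian.
  have hDi : ∀ i, ∀ z ∈ (chartAt ℂ i).target, f ((chartAt ℂ i).symm z) ≠ 0 →
      D i z = Δ (fun w => Real.log (f ((chartAt ℂ i).symm w))) z := by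
    intro i z hz hfz
    obtain ⟨m, g, hm, -, hg, hg0, h⟩ := hloc ((chartAt ℂ i).symm z)
    have h1 := h.self_of_nhds.2 i ((chartAt ℂ i).map_target hz)
    rw [(chartAt ℂ i).right_inv hz] at h1
    have hm' := hm.analyticAt ((chartAt ℂ i).map_target hz)
    rw [(chartAt ℂ i).right_inv hz] at hm'
    have hm0 : m ((chartAt ℂ i).symm z) ≠ 0 := fun h0 => hfz (by
      rw [h.self_of_nhds.1, h0, map_zero, zero_mul])
    rw [h1, ← laplacian_log_normSq_mul hm' hm0 (SmoothFunAt.contDiffAt_symm hz hg) hg0]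
    refine laplacian_congr ?_
    filter_upwards [eventually_mem_source hz h] with w hw
    rw [hw.1]
  have hae : ∀ i, ∀ᵐ z ∂(volume.restrict (chartAt ℂ i).target),
      z ∈ (chartAt ℂ i).target ∧ f ((chartAt ℂ i).symm z) ≠ 0 := by
    intro i
    have h1 : (chartAt ℂ i '' {x | f x = 0}).Finite := hfin.image _
    have h2 : ∀ᵐ z ∂(volume.restrict (chartAt ℂ i).target), z ∉ chartAt ℂ i '' {x | f x = 0} :=
      ae_restrict_of_ae (measure_eq_zero_iff_ae_notMem.1 (h1.measure_zero volume))
    filter_upwards [h2, ae_restrict_mem (chartAt ℂ i).open_target.measurableSet] with z h3 h4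
    exact ⟨h4, fun h5 => h3 ⟨_, h5, (chartAt ℂ i).right_inv h4⟩⟩
  let ε : ℕ → ℝ := fun n => 1 / ((n : ℝ) + 1)
  have hε : ∀ n, 0 < ε n := fun n => Nat.one_div_pos_of_nat
  have hε0 : Filter.Tendsto ε Filter.atTop (𝓝 0) := tendsto_one_div_add_atTop_nhds_zero_nat
  -- The lower bound for `Δ log (f + ε n)` from `le_laplacian_log_add`, in a form that stays
  -- continuous across the zeros of `f`.
  let G : ℕ → X → ℂ → ℝ := fun n i z =>
    f ((chartAt ℂ i).symm z) / (f ((chartAt ℂ i).symm z) + ε n) * D i z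
  have hfc : Continuous f := continuous_iff_continuousAt.2 fun x => (hfsm x).continuousAt
  have hGc : ∀ n i, ContinuousOn (G n i) (chartAt ℂ i).target := by
    intro n i
    have h1 := hfc.comp_continuousOn (chartAt ℂ i).continuousOn_symm
    refine (h1.div (h1.add continuousOn_const) fun z _ => ?_).mul (hDc i)
    exact (add_pos_of_nonneg_of_pos (hfnn _) (hε n)).ne'
  have hle : ∀ n, ∑ i ∈ P.indices, ∫ z in (chartAt ℂ i).target,
      P.1 i ((chartAt ℂ i).symm z) * G n i z ≤ 0 := by
    intro n
    have hv : ∀ x, SmoothFunAt (fun x => Real.log (f x + ε n)) x := by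
      intro x
      have h1 : ContDiffAt ℝ ∞ (fun t : ℝ => Real.log (t + ε n)) (f x) :=
        (contDiffAt_id.add contDiffAt_const).log (add_pos_of_nonneg_of_pos (hfnn _) (hε n)).ne'
      exact h1.contMDiffAt.comp x (hfsm x)
    -- By Stokes, the right-hand `0` is the integral of `Δ log (f + ε n)`.
    rw [← P.sum_integral_laplacian_eq_zero hv]
    refine Finset.sum_le_sum fun i _ => ?_
    refine integral_mono_ae
      (integrableOn_chart (P.tsupport_subset i) (P.1 i).contMDiff.continuous (hGc n i))
      (integrableOn_chart (P.tsupport_subset i) (P.1 i).contMDiff.continuous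
        (continuousOn_laplacian_chart hv i)) ?_
    filter_upwards [hae i] with z hz
    refine mul_le_mul_of_nonneg_left ?_ (P.1.nonneg i _)
    simp only [G]
    rw [hDi i z hz.1 hz.2]
    exact le_laplacian_log_add (SmoothFunAt.contDiffAt_symm hz.1 (hfsm _))
      ((hfnn _).lt_of_ne' hz.2) (hε n)
  refine le_of_tendsto (x := Filter.atTop) (f := fun n => ∑ i ∈ P.indices,
    ∫ z in (chartAt ℂ i).target, P.1 i ((chartAt ℂ i).symm z) * G n i z)
    (tendsto_finsetSum _ fun i _ => ?_) (Filter.Eventually.of_forall hle)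
  -- The factor `f / (f + ε n)` lies in `[0, 1]` and tends to `1` off the finite zero set of `f`.
  refine tendsto_integral_of_dominated_convergence
    (fun z => ‖P.1 i ((chartAt ℂ i).symm z) * D i z‖)
    (fun n => (integrableOn_chart (P.tsupport_subset i) (P.1 i).contMDiff.continuous
      (hGc n i)).aestronglyMeasurable)
    (integrableOn_chart (P.tsupport_subset i) (P.1 i).contMDiff.continuous (hDc i)).norm
    (fun n => Filter.Eventually.of_forall fun z => ?_) ?_
  · simp only [G, norm_mul]
    refine mul_le_mul_of_nonneg_left ?_ (norm_nonneg (P.1 i ((chartAt ℂ i).symm z)))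
    refine mul_le_of_le_one_left (norm_nonneg (D i z)) ?_
    have h1 := hfnn ((chartAt ℂ i).symm z)
    have h2 := hε n
    rw [Real.norm_of_nonneg (by positivity), div_le_one (by positivity)]
    linarith
  · filter_upwards [hae i] with z hz
    refine Filter.Tendsto.const_mul _ ?_
    have h1 : Filter.Tendsto (fun n => f ((chartAt ℂ i).symm z) /
        (f ((chartAt ℂ i).symm z) + ε n)) Filter.atTop (𝓝 1) := by
      have h2 := (hε0.const_add (f ((chartAt ℂ i).symm z)))
      rw [add_zero] at h2
      have h3 := (tendsto_const_nhds (x := f ((chartAt ℂ i).symm z))).div h2 hz.2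
      rwa [div_self hz.2] at h3
    simpa using h1.mul_const (D i z)

end Inequality

/-! ### Gram determinants and degrees -/

section Gram

open Laplacian InnerProductSpace MeasureTheory

variable {X : Type*} [TopologicalSpace X] [ChartedSpace ℂ X]
  {F : Type*} [NormedAddCommGroup F] [NormedSpace ℂ F]
  {E : X → Type*} [TopologicalSpace (TotalSpace F E)]
  [∀ x, AddCommGroup (E x)] [∀ x, Module ℂ (E x)] [∀ x, TopologicalSpace (E x)]
  [FiberBundle F E]

namespace HermitianMetric

variable (h : HermitianMetric F E)

/-- The Gram determinant of a family of vectors in a fibre. -/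
def gram {ι : Type*} [Fintype ι] [DecidableEq ι] {x : X} (v : ι → E x) : ℝ :=
  (Matrix.det (Matrix.of fun i j => h.inner x (v i) (v j))).re

/-- The Gram matrix `G` becomes `Cᴴ G C`. -/
theorem gram_change {ι : Type*} [Fintype ι] [DecidableEq ι] {x : X} (v : ι → E x)
    (C : Matrix ι ι ℂ) :
    h.gram (fun a => ∑ b, C b a • v b) = Complex.normSq C.det * h.gram v := by
  have h1 : (Matrix.of fun i j => h.inner x (∑ b, C b i • v b) (∑ b, C b j • v b)) =
      C.conjTranspose * (Matrix.of fun i j => h.inner x (v i) (v j)) * C := by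
    ext i j
    simp only [Matrix.of_apply, Matrix.mul_apply, Matrix.conjTranspose_apply, map_sum, map_smulₛₗ,
      LinearMap.sum_apply, LinearMap.smul_apply, smul_eq_mul, Finset.sum_mul, RingHom.id_apply,
      Complex.star_def, Finset.mul_sum]
    exact Finset.sum_congr rfl fun b _ => Finset.sum_congr rfl fun c _ => by ring
  rw [gram, h1, Matrix.det_mul, Matrix.det_mul, Matrix.det_conjTranspose, gram, mul_right_comm,
    Complex.star_def, ← Complex.normSq_eq_conj_mul_self, Complex.re_ofReal_mul]

theorem gram_reindex {ι κ : Type*} [Fintype ι] [DecidableEq ι] [Fintype κ] [DecidableEq κ] {x : X}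
    (v : ι → E x) (e : κ ≃ ι) : h.gram (fun a => v (e a)) = h.gram v := by
  rw [gram, gram, ← Matrix.det_submatrix_equiv_self e]
  rfl

theorem gram_pos {ι : Type*} [Fintype ι] [DecidableEq ι] {x : X} {v : ι → E x}
    (hv : LinearIndependent ℂ v) : 0 < h.gram v := by
  open scoped ComplexOrder in
  have h1 : (Matrix.of fun i j => h.inner x (v i) (v j)).PosDef := by
    refine Matrix.PosDef.of_dotProduct_mulVec_pos ?_ fun c hc => ?_
    · ext i j
      simp only [Matrix.conjTranspose_apply, Matrix.of_apply]
      exact h.conj_symm x _ _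
    · have h2 : star c ⬝ᵥ (Matrix.of fun i j => h.inner x (v i) (v j)).mulVec c =
          h.inner x (∑ i, c i • v i) (∑ i, c i • v i) := by
        simp only [dotProduct, Matrix.mulVec, Matrix.of_apply, map_sum, map_smulₛₗ,
          LinearMap.sum_apply, LinearMap.smul_apply, smul_eq_mul, Finset.mul_sum, RingHom.id_apply,
          Complex.star_def, Pi.star_apply]
        rw [Finset.sum_comm]
        exact Finset.sum_congr rfl fun b _ => Finset.sum_congr rfl fun c _ => by ring
      have h3 : ∑ i, c i • v i ≠ 0 := fun h0 =>
        hc (funext (Fintype.linearIndependent_iff.1 hv c h0))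
      rw [h2, Complex.lt_def]
      refine ⟨h.pos x _ h3, ?_⟩
      have h4 := h.conj_symm x (∑ i, c i • v i) (∑ i, c i • v i)
      exact (Complex.conj_eq_iff_im.1 h4).symm
  exact (Complex.lt_def.1 h1.det_pos).1

variable [IsManifold 𝓘(ℂ) ω X] [VectorBundle ℂ F E] [ContMDiffVectorBundle ω F E 𝓘(ℂ)]

theorem smoothFunAt_gram {ι : Type*} [Fintype ι] [DecidableEq ι] {s : ι → ∀ y, E y} {x : X}
    (hs : ∀ i, HolAt F (s i) x) : SmoothFunAt (fun y => h.gram fun i => s i y) x := by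
  have hin : ∀ i j, ContMDiffAt 𝓘(ℝ, ℂ) 𝓘(ℝ, ℂ) ∞ (fun y => h.inner y (s i y) (s j y)) x := by
    intro i j
    obtain ⟨U, hU, hUo, hx⟩ := eventually_nhds_iff.1 ((hs i).eventually.and (hs j).eventually)
    exact (h.smooth U (s i) (s j) hUo (fun y hy => (hU y hy).1.contMDiffWithinAt)
      (fun y hy => (hU y hy).2.contMDiffWithinAt)).contMDiffAt (hUo.mem_nhds hx)
  have hmul : ContDiff ℝ ∞ (fun p : ℂ × ℂ => p.1 * p.2) := contDiff_mul
  have hprod : ∀ (S : Finset ι) (c : ι → X → ℂ), (∀ i, ContMDiffAt 𝓘(ℝ, ℂ) 𝓘(ℝ, ℂ) ∞ (c i) x) →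
      ContMDiffAt 𝓘(ℝ, ℂ) 𝓘(ℝ, ℂ) ∞ (fun y => ∏ i ∈ S, c i y) x := by
    intro S c hc
    induction S using Finset.induction_on with
    | empty => simpa using contMDiffAt_const
    | insert a S ha ih =>
      simp only [Finset.prod_insert ha]
      exact (hmul.contDiffAt.contMDiffAt).comp x ((hc a).prodMk_space ih)
  have hdet : ContMDiffAt 𝓘(ℝ, ℂ) 𝓘(ℝ, ℂ) ∞
      (fun y => Matrix.det (Matrix.of fun i j => h.inner y (s i y) (s j y))) x := by
    simp only [Matrix.det_apply', Matrix.of_apply]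
    refine ContMDiffAt.sum fun σ _ => ?_
    exact (hmul.contDiffAt.contMDiffAt).comp x
      (contMDiffAt_const.prodMk_space (hprod _ _ fun i => hin _ _))
  exact (Complex.reCLM.contDiff.contDiffAt.contMDiffAt).comp x hdet

variable [FiniteDimensional ℂ F]

/-- The Chern density can be computed with any frame. -/
theorem chernDensity_eq {r : ℕ} {W : HolSubbundle F E r} {ι : Type*} [Fintype ι] [DecidableEq ι]
    {s : ι → ∀ y, E y} {x : X} (hs : IsFrameAt F W.carrier s x) (hcard : Fintype.card ι = r)
    {i : X} (hi : x ∈ (chartAt ℂ i).source) :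
    chernDensity h W i (chartAt ℂ i x) = -(1 / (4 * Real.pi)) *
      Δ (fun w => Real.log (h.gram fun a => s a ((chartAt ℂ i).symm w))) (chartAt ℂ i x) := by
  let e : Fin r ≃ ι := (Fintype.equivFinOfCardEq hcard).symm
  -- The frame chosen in `chernDensity` differs from `s` by `C`, which multiplies the Gram
  -- determinant by `|det C|²`; the logarithm of that factor is harmonic.
  obtain ⟨C, hC, hC0, hCs⟩ := (hs.reindex e).exists_matrix (W.isFrameAt x)
  rw [chernDensity, (chartAt ℂ i).left_inv hi]
  congr 1
  have hsm := SmoothFunAt.contDiffAt hi (h.smoothFunAt_gram hs.holAt)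
  have hpos : 0 < h.gram fun a => s a x := h.gram_pos hs.basis.self_of_nhds.1
  have hdet := (HolFunAt.det hC).analyticAt hi
  have hx : (chartAt ℂ i).symm (chartAt ℂ i x) = x := (chartAt ℂ i).left_inv hi
  rw [← laplacian_log_normSq_mul hdet (by rwa [hx]) hsm (by rwa [hx])]
  refine laplacian_congr ?_
  have h1 : ∀ᶠ w in 𝓝 (chartAt ℂ i x), ∀ a, W.frame x a ((chartAt ℂ i).symm w) =
      ∑ b, C ((chartAt ℂ i).symm w) b a • s (e b) ((chartAt ℂ i).symm w) :=
    eventually_mem_source ((chartAt ℂ i).map_source hi)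
      (U := {y | ∀ a, W.frame x a y = ∑ b, C y b a • s (e b) y}) (by rw [hx]; exact hCs)
  filter_upwards [h1] with w hw
  have h2 : gramDet h (W.frame x) ((chartAt ℂ i).symm w) =
      h.gram fun a => W.frame x a ((chartAt ℂ i).symm w) := rfl
  rw [h2]
  simp only [hw]
  rw [h.gram_change (fun b => s (e b) ((chartAt ℂ i).symm w)),
    h.gram_reindex (fun b => s b ((chartAt ℂ i).symm w)) e]

/-- By definition the density at each point uses a frame chosen at that point. Near `z` all of them
can be replaced by the one chosen at `z`, which leaves the Laplacian of a single smooth function. -/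
theorem continuousOn_chernDensity {r : ℕ} (W : HolSubbundle F E r) (i : X) :
    ContinuousOn (chernDensity h W i) (chartAt ℂ i).target := by
  intro z hz
  have hs := W.isFrameAt ((chartAt ℂ i).symm z)
  have h1 : ContDiffAt ℝ ∞ (fun w => Real.log (h.gram fun a =>
      W.frame ((chartAt ℂ i).symm z) a ((chartAt ℂ i).symm w))) z :=
    (SmoothFunAt.contDiffAt_symm hz (h.smoothFunAt_gram hs.holAt)).log
      (h.gram_pos hs.basis.self_of_nhds.1).ne'
  refine ContinuousAt.continuousWithinAt (ContinuousAt.congr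
    ((continuousAt_laplacian h1).const_mul (-(1 / (4 * Real.pi)))) ?_)
  filter_upwards [eventually_mem_source hz hs.eventually, (chartAt ℂ i).open_target.mem_nhds hz]
    with w h2 h3
  have h4 := h.chernDensity_eq h2 (by simp) ((chartAt ℂ i).map_target h3)
  rw [(chartAt ℂ i).right_inv h3] at h4
  exact h4.symm

end HermitianMetric

end Gram

/-! ### The degree inequality for the saturated kernel and image -/

section Comparison

open Laplacian InnerProductSpace MeasureTheory

variable {X : Type*} [TopologicalSpace X] [ChartedSpace ℂ X]
  {F : Type*} [NormedAddCommGroup F] [NormedSpace ℂ F]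
  {E : X → Type*} [TopologicalSpace (TotalSpace F E)]
  [∀ x, AddCommGroup (E x)] [∀ x, Module ℂ (E x)] [∀ x, TopologicalSpace (E x)]
  [FiberBundle F E]

/-- A basis of `V` whose first part spans `K`. -/
def IsAdapted {V : Type*} [AddCommGroup V] [Module ℂ V] {r m : ℕ} (K : Submodule ℂ V)
    (v : Fin r ⊕ Fin m → V) : Prop :=
  LinearIndependent ℂ v ∧ Submodule.span ℂ (Set.range v) = ⊤ ∧
    Submodule.span ℂ (Set.range fun a => v (Sum.inl a)) = K

namespace HermitianMetric

variable (h : HermitianMetric F E)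

/-- For a linear map `τ` on a fibre, the ratio of the Gram determinants of
`v₁, …, v_r`, of `τ w₁, …, τ w_m` and of the basis `v₁, …, v_r, w₁, …, w_m`. -/
def gramRatio {r m : ℕ} {x : X} (τ : E x →ₗ[ℂ] E x) (v : Fin r ⊕ Fin m → E x) : ℝ :=
  h.gram (fun a => v (Sum.inl a)) * h.gram (fun a => τ (v (Sum.inr a))) / h.gram v

/-- Two adapted bases differ by a block triangular matrix with diagonal blocks `A'` and `D'`. As `τ`
kills the contribution of `B'`, numerator and denominator both gain the factor `|det A'|² |det
D'|²`. -/
theorem gramRatio_eq {r m : ℕ} {x : X} {τ : E x →ₗ[ℂ] E x} {K : Submodule ℂ (E x)}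
    (hK : ∀ v ∈ K, τ v = 0) {v v' : Fin r ⊕ Fin m → E x} (hv : IsAdapted K v)
    (hv' : IsAdapted K v') : h.gramRatio τ v' = h.gramRatio τ v := by
  obtain ⟨hli, hsp, hvK⟩ := hv
  obtain ⟨hli', hsp', hvK'⟩ := hv'
  have h1 : ∀ a, ∃ c : Fin r → ℂ, ∑ b, c b • v (Sum.inl b) = v' (Sum.inl a) := fun a =>
    (Submodule.mem_span_range_iff_exists_fun ℂ).1 (by
      rw [hvK, ← hvK']; exact Submodule.subset_span ⟨a, rfl⟩)
  have h2 : ∀ a, ∃ c : Fin r ⊕ Fin m → ℂ, ∑ b, c b • v b = v' (Sum.inr a) := fun a =>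
    (Submodule.mem_span_range_iff_exists_fun ℂ).1 (by rw [hsp]; trivial)
  choose A hA using h1
  choose B hB using h2
  let A' : Matrix (Fin r) (Fin r) ℂ := Matrix.of fun b a => A a b
  let B' : Matrix (Fin r) (Fin m) ℂ := Matrix.of fun b a => B a (Sum.inl b)
  let D' : Matrix (Fin m) (Fin m) ℂ := Matrix.of fun b a => B a (Sum.inr b)
  let C := Matrix.fromBlocks A' B' 0 D'
  have hC : v' = fun a => ∑ b, C b a • v b := by
    funext a
    rw [Fintype.sum_sum_type]
    rcases a with a | a
    · simp [C, A', ← hA]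
    · simp only [C, Matrix.fromBlocks_apply₁₂, Matrix.fromBlocks_apply₂₂, B', D', Matrix.of_apply]
      rw [← hB, Fintype.sum_sum_type]
  have hτ0 : ∀ b, τ (v (Sum.inl b)) = 0 := fun b =>
    hK _ (hvK ▸ Submodule.subset_span ⟨b, rfl⟩)
  have hg1 : h.gram (fun a => v' (Sum.inl a)) =
      Complex.normSq A'.det * h.gram (fun a => v (Sum.inl a)) := by
    rw [← h.gram_change (fun a => v (Sum.inl a)) A']
    simp only [← hA]
    rfl
  have hg2 : h.gram (fun a => τ (v' (Sum.inr a))) =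
      Complex.normSq D'.det * h.gram (fun a => τ (v (Sum.inr a))) := by
    rw [← h.gram_change (fun a => τ (v (Sum.inr a))) D']
    congr 1
    ext a
    rw [← hB, map_sum, Fintype.sum_sum_type]
    simp [D', hτ0]
  have hg3 : h.gram v' = Complex.normSq A'.det * Complex.normSq D'.det * h.gram v := by
    rw [← map_mul, ← Matrix.det_fromBlocks_zero₂₁ A' B' D', ← h.gram_change v C, ← hC]
  have hpos := h.gram_pos hli
  have hne : Complex.normSq A'.det * Complex.normSq D'.det ≠ 0 := fun h0 => by
    have := h.gram_pos hli'
    rw [hg3, h0, zero_mul] at this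
    exact this.false
  rw [gramRatio, gramRatio, hg1, hg2, hg3, mul_mul_mul_comm, mul_div_mul_left _ _ hne]

open Classical in
/-- The function on `X` whose value at `x` is the ratio `gramRatio` for any basis of the fibre at
`x` adapted to `K x`. -/
def comparison (r m : ℕ) (τ : ∀ x, E x →ₗ[ℂ] E x) (K : ∀ x, Submodule ℂ (E x)) (x : X) : ℝ :=
  if H : ∃ v : Fin r ⊕ Fin m → E x, IsAdapted (K x) v then h.gramRatio (τ x) H.choose else 0

theorem comparison_eq {r m : ℕ} {τ : ∀ x, E x →ₗ[ℂ] E x} {K : ∀ x, Submodule ℂ (E x)} {x : X}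
    (hK : ∀ v ∈ K x, τ x v = 0) {v : Fin r ⊕ Fin m → E x} (hv : IsAdapted (K x) v) :
    h.comparison r m τ K x = h.gramRatio (τ x) v := by
  have H : ∃ v : Fin r ⊕ Fin m → E x, IsAdapted (K x) v := ⟨v, hv⟩
  rw [comparison, dif_pos H]
  exact h.gramRatio_eq hK hv H.choose_spec

end HermitianMetric

variable [IsManifold 𝓘(ℂ) ω X] [VectorBundle ℂ F E] [ContMDiffVectorBundle ω F E 𝓘(ℂ)]
  [FiniteDimensional ℂ F] [T2Space X] [CompactSpace X]

omit [T2Space X] [CompactSpace X] [FiniteDimensional ℂ F] [VectorBundle ℂ F E]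
  [ContMDiffVectorBundle ω F E 𝓘(ℂ)] [IsManifold 𝓘(ℂ) ω X] [FiberBundle F E] in
theorem integral_sub_add_eq {μ : Measure ℂ} {a b c : ℂ → ℝ} (ha : Integrable a μ)
    (hb : Integrable b μ) (hc : Integrable c μ) :
    ∫ z, (a z + b z - c z) ∂μ = (∫ z, a z ∂μ) + (∫ z, b z ∂μ) - ∫ z, c z ∂μ := by
  rw [← integral_add ha hb]
  exact integral_sub (ha.add hb) hc

/-- The Chern numbers of the saturated kernel and image of an endomorphism of `E` add up to at
least the Chern number of `E`. -/
theorem chernNumber_le_add (h : HermitianMetric F E) (P : ChartPartition X)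
    {τ : ∀ x, E x →ₗ[ℂ] E x} {r m : ℕ} (hτ : ∀ x, HasSmithFormAt F τ r m x)
    {n : ℕ} {W : HolSubbundle F E n} (hW : ∀ x, W.carrier x = ⊤) (hn : r + m = n) :
    chernNumber h P W ≤ chernNumber h P (kerBundle hτ) + chernNumber h P (rangeBundle hτ) := by
  -- The factor `-4π` undoes the normalisation of `chernDensity`, so that `D` is `Δ log g` in the
  -- local form `f = |m|² g`.
  let D : X → ℂ → ℝ := fun i z => -(4 * Real.pi) * (chernDensity h (kerBundle hτ) i z +
    chernDensity h (rangeBundle hτ) i z - chernDensity h W i z)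
  have key := P.sum_integral_nonpos (f := h.comparison r m τ (kerBundle hτ).carrier) (D := D) ?_
  · have hint : ∀ {k : ℕ} (V : HolSubbundle F E k) (i : X), IntegrableOn (fun z =>
        P.1 i ((chartAt ℂ i).symm z) * chernDensity h V i z) (chartAt ℂ i).target := fun V i =>
      integrableOn_chart (P.tsupport_subset i) (P.1 i).contMDiff.continuous
        (h.continuousOn_chernDensity V i)
    have h1 : ∀ i, ∫ z in (chartAt ℂ i).target, P.1 i ((chartAt ℂ i).symm z) * D i z =
        -(4 * Real.pi) * ((∫ z in (chartAt ℂ i).target, P.1 i ((chartAt ℂ i).symm z) *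
            chernDensity h (kerBundle hτ) i z) +
          (∫ z in (chartAt ℂ i).target, P.1 i ((chartAt ℂ i).symm z) *
            chernDensity h (rangeBundle hτ) i z) -
          ∫ z in (chartAt ℂ i).target, P.1 i ((chartAt ℂ i).symm z) * chernDensity h W i z) := by
      intro i
      rw [← integral_sub_add_eq (hint _ i) (hint _ i) (hint _ i), ← integral_const_mul]
      congr 1
      ext z
      simp only [D]
      ring
    simp only [h1] at key
    rw [← Finset.mul_sum, Finset.sum_sub_distrib, Finset.sum_add_distrib] at key
    rw [chernNumber, chernNumber, chernNumber, P.finsum_integral_eq, P.finsum_integral_eq,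
      P.finsum_integral_eq]
    have hpi := Real.pi_pos
    have h2 := nonneg_of_mul_nonpos_right (a := -(4 * Real.pi)) key (by linarith)
    linarith
  · intro x
    obtain ⟨v, p, d, hv, hp, hvp⟩ := hτ x
    obtain ⟨hK, hI, -⟩ := HasSmithFormAt.eventually_saturation hv hp hvp
    -- The vectors `v` form an adapted basis with `τ (v (inr a)) = z ^ d a • p (inr a)`. Pulling the
    -- powers out of the Gram determinant of the images leaves a positive ratio of Gram determinants
    -- of frames.
    refine ⟨fun y => ∏ a, (chartAt ℂ x y - chartAt ℂ x x) ^ d a,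
      fun y => h.gram (fun a => v (Sum.inl a) y) * h.gram (fun a => p (Sum.inr a) y) /
        h.gram (fun a => v a y), ?_, ?_, ?_, ?_, ?_⟩
    · refine HolFunAt.prod fun a _ => ?_
      have : AnalyticAt ℂ (fun z => (z - chartAt ℂ x x) ^ d a) (chartAt ℂ x x) := by fun_prop
      exact holFunAt_comp_chart (mem_chart_source ℂ x) this
    · filter_upwards [eventually_chart_ne x] with y hy
      exact Finset.prod_ne_zero_iff.2 fun a _ => pow_ne_zero _ hy
    · have h1 : ContDiffAt ℝ ∞ (fun t : ℝ => t⁻¹) (h.gram fun a => v a x) :=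
        contDiffAt_inv ℝ (h.gram_pos hv.basis.self_of_nhds.1).ne'
      simp only [div_eq_mul_inv]
      exact ((h.smoothFunAt_gram hK.holAt).mul (h.smoothFunAt_gram hI.holAt)).mul
        (h1.contMDiffAt.comp x (h.smoothFunAt_gram hv.holAt))
    · exact div_pos (mul_pos (h.gram_pos hK.basis.self_of_nhds.1)
        (h.gram_pos hI.basis.self_of_nhds.1)) (h.gram_pos hv.basis.self_of_nhds.1)
    · filter_upwards [hv.eventually, hK.eventually, hI.eventually, hvp] with y h1 h2 h3 h4
      constructor
      · have had : IsAdapted ((kerBundle hτ).carrier y) fun a => v a y :=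
          ⟨h1.basis.self_of_nhds.1, h1.basis.self_of_nhds.2, h2.basis.self_of_nhds.2⟩
        have hker : ∀ u ∈ (kerBundle hτ).carrier y, τ y u = 0 := by
          have : (kerBundle hτ).carrier y ≤ LinearMap.ker (τ y) := by
            rw [← had.2.2, Submodule.span_le]
            rintro _ ⟨a, rfl⟩
            exact h4.1 a
          exact fun u hu => this hu
        rw [h.comparison_eq hker had, HermitianMetric.gramRatio]
        have h5 : (fun a => τ y (v (Sum.inr a) y)) = fun a => ∑ b, (Matrix.diagonal
            fun a => (chartAt ℂ x y - chartAt ℂ x x) ^ d a) b a • p (Sum.inr b) y := by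
          ext a
          rw [h4.2 a, Finset.sum_eq_single a (fun b _ hb => by rw [Matrix.diagonal_apply_ne _ hb, zero_smul])
            (by simp), Matrix.diagonal_apply_eq]
        rw [h5, h.gram_change (fun b => p (Sum.inr b) y), Matrix.det_diagonal]
        ring
      · intro i hi
        have hWv : IsFrameAt F W.carrier v y :=
          h1.congr (Filter.Eventually.of_forall fun y => (hW y).symm)
        simp only [D]
        rw [h.chernDensity_eq (W := kerBundle hτ) h2 (by simp) hi,
          h.chernDensity_eq (W := rangeBundle hτ) h3 (by simp) hi,
          h.chernDensity_eq hWv (by simpa using hn) hi]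
        have hinf : ∀ {ι : Type} [Fintype ι] [DecidableEq ι] {V : ∀ x, Submodule ℂ (E x)}
            {s : ι → ∀ y, E y}, IsFrameAt F V s y → ContDiffAt ℝ 2
              (fun w => Real.log (h.gram fun a => s a ((chartAt ℂ i).symm w))) (chartAt ℂ i y) := by
          intro ι _ _ V s hs
          refine ((SmoothFunAt.contDiffAt hi (h.smoothFunAt_gram hs.holAt)).log ?_).of_le
            (one_add_one_eq_two (R := ℕ∞ω) ▸ two_le_infty)
          rw [(chartAt ℂ i).left_inv hi]
          exact (h.gram_pos hs.basis.self_of_nhds.1).ne'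
        have h6 : Δ (fun w => Real.log (h.gram (fun a => v (Sum.inl a) ((chartAt ℂ i).symm w)) *
              h.gram (fun a => p (Sum.inr a) ((chartAt ℂ i).symm w)) /
              h.gram (fun a => v a ((chartAt ℂ i).symm w)))) (chartAt ℂ i y) =
            Δ ((fun w => Real.log (h.gram (fun a => v (Sum.inl a) ((chartAt ℂ i).symm w)))) +
              (fun w => Real.log (h.gram (fun a => p (Sum.inr a) ((chartAt ℂ i).symm w)))) -
              fun w => Real.log (h.gram (fun a => v a ((chartAt ℂ i).symm w)))) (chartAt ℂ i y) := by
          have hx : (chartAt ℂ i).symm (chartAt ℂ i y) = y := (chartAt ℂ i).left_inv hi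
          refine laplacian_congr (eventually_mem_source ((chartAt ℂ i).map_source hi) (U :=
            {y | Real.log (h.gram (fun a => v (Sum.inl a) y) * h.gram (fun a => p (Sum.inr a) y) /
              h.gram (fun a => v a y)) = Real.log (h.gram (fun a => v (Sum.inl a) y)) +
              Real.log (h.gram (fun a => p (Sum.inr a) y)) -
              Real.log (h.gram (fun a => v a y))}) ?_)
          rw [hx]
          filter_upwards [h1.basis, h2.basis, h3.basis] with y k1 k2 k3
          have l1 := h.gram_pos k1.1
          have l2 := h.gram_pos k2.1
          have l3 := h.gram_pos k3.1
          rw [Real.log_div (mul_pos l2 l3).ne' l1.ne', Real.log_mul l2.ne' l3.ne']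
        have h7 : ContDiffAt ℝ 2
            ((fun w => Real.log (h.gram (fun a => v (Sum.inl a) ((chartAt ℂ i).symm w)))) +
              fun w => Real.log (h.gram (fun a => p (Sum.inr a) ((chartAt ℂ i).symm w))))
            (chartAt ℂ i y) := (hinf h2).add (hinf h3)
        rw [h6, h7.laplacian_sub (hinf h1), (hinf h2).laplacian_add (hinf h3)]
        have hpi := Real.pi_pos.ne'
        field_simp
        ring

end Comparison

/-! ### Stable bundle pairs are simple -/

section Determinant

variable {X : Type*} [TopologicalSpace X] [ChartedSpace ℂ X]
  {F : Type*} [NormedAddCommGroup F] [NormedSpace ℂ F] [FiniteDimensional ℂ F]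
  {E : X → Type*} [TopologicalSpace (TotalSpace F E)]
  [∀ x, AddCommGroup (E x)] [∀ x, Module ℂ (E x)] [∀ x, TopologicalSpace (E x)]
  [FiberBundle F E] [VectorBundle ℂ F E] [ContMDiffVectorBundle ω F E 𝓘(ℂ)]

/-- The determinant of an endomorphism in terms of a basis `e` and its dual basis `l`. -/
theorem det_eq_of_dual {V ι : Type*} [AddCommGroup V] [Module ℂ V] [Fintype ι] [DecidableEq ι]
    {e : ι → V} {l : ι → V →ₗ[ℂ] ℂ} (h1 : ∀ i j, l i (e j) = if i = j then 1 else 0)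
    (h2 : ∀ v, v = ∑ i, l i v • e i) (f : V →ₗ[ℂ] V) :
    LinearMap.det f = (Matrix.of fun i j => l i (f (e j))).det := by
  let b : Module.Basis ι ℂ V := .ofEquivFun
    { toFun := fun v i => l i v
      map_add' := fun v w => by ext i; simp
      map_smul' := fun c v => by ext i; simp
      invFun := fun c => ∑ i, c i • e i
      left_inv := fun v => (h2 v).symm
      right_inv := fun c => by ext i; simp [h1] }
  have hb : ∀ i, b i = e i := fun i => by
    simp [b, Module.Basis.coe_ofEquivFun, Pi.single_apply]
  rw [← LinearMap.det_toMatrix b]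
  congr 1
  ext i j
  rw [LinearMap.toMatrix_apply, hb]
  rfl

theorem HolEndAt.holFunAt_det {τ : ∀ x, E x →ₗ[ℂ] E x} {x : X} (hτ : HolEndAt F τ x) :
    HolFunAt (fun y => LinearMap.det (τ y)) x := by
  obtain ⟨e, l, he, hl, h⟩ := exists_frame_dual F E x
  refine ContMDiffAt.congr_of_eventuallyEq (HolFunAt.det
    (C := fun y => Matrix.of fun i j => l i y (τ y (e j y))) fun i j => hl i _ (hτ _ (he j))) ?_
  filter_upwards [h] with y hy using det_eq_of_dual hy.1 hy.2 _

/-- On a compact connected Riemann surface the determinant of a holomorphic endomorphism is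
constant. -/
theorem det_eq_of_holEndAt [IsManifold 𝓘(ℂ) ω X] [CompactSpace X] [ConnectedSpace X]
    {τ : ∀ x, E x →ₗ[ℂ] E x} (hτ : ∀ x, HolEndAt F τ x) (x y : X) :
    LinearMap.det (τ x) = LinearMap.det (τ y) := by
  have : IsManifold 𝓘(ℂ) 1 X := IsManifold.of_le (n := ω) le_top
  have h : MDifferentiable 𝓘(ℂ) 𝓘(ℂ) fun x => LinearMap.det (τ x) :=
    fun x => (hτ x).holFunAt_det.mdifferentiableAt (by simp)
  exact h.apply_eq_of_compactSpace x y

theorem HasSmithFormAt.eq_zero {τ : ∀ x, E x →ₗ[ℂ] E x} {r : ℕ} {x : X}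
    (h : HasSmithFormAt F τ r 0 x) : τ x = 0 := by
  obtain ⟨v, p, d, hv, -, hvp⟩ := h
  refine LinearMap.ext_on_range hv.basis.self_of_nhds.2 fun a => ?_
  rcases a with a | a
  · exact hvp.self_of_nhds.1 a
  · exact a.elim0

/-- With `r = 0` the generic rank would be full, and `τ` would be invertible at some point near `x`.
-/
theorem HasSmithFormAt.pos_of_det_eq_zero [T1Space X] [IsManifold 𝓘(ℂ) ω X] {τ : ∀ x, E x →ₗ[ℂ] E x} {r m : ℕ} {x : X}
    (h : HasSmithFormAt F τ r m x) (hrm : r + m = Module.finrank ℂ F)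
    (hdet : ∀ y, LinearMap.det (τ y) = 0) : 0 < r := by
  by_contra hr
  have := neBot_nhdsNE x
  obtain ⟨y, hy⟩ := h.finrank_range.exists
  have := finiteDimensional_fiber F E y
  have h1 : LinearMap.range (τ y) = ⊤ :=
    Submodule.eq_top_of_finrank_eq (by rw [hy, finrank_fiber F E y]; omega)
  have h2 := LinearMap.bot_lt_ker_of_det_eq_zero (hdet y)
  rw [LinearMap.ker_eq_bot_iff_range_eq_top.2 h1] at h2
  exact lt_irrefl _ h2

end Determinant

namespace BundlePair

variable {X : Type*} [TopologicalSpace X] [T2Space X] [CompactSpace X]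
  [ChartedSpace ℂ X] [IsManifold 𝓘(ℂ) ω X]
  {F : Type*} [NormedAddCommGroup F] [NormedSpace ℂ F] [FiniteDimensional ℂ F]
  {E : X → Type*} [TopologicalSpace (TotalSpace F E)]
  [∀ x, AddCommGroup (E x)] [∀ x, Module ℂ (E x)] [∀ x, TopologicalSpace (E x)]
  [∀ x, IsTopologicalAddGroup (E x)] [∀ x, ContinuousSMul ℂ (E x)]
  [FiberBundle F E] [VectorBundle ℂ F E] [ContMDiffVectorBundle ω F E 𝓘(ℂ)]
  {Q : BundlePair F E}

/-- `hk` serves to enumerate the singular points; at each of them invariance provides exponents for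
`W`. Stability can then be applied to `W`. -/
theorem Invariant.exists_hasType {r n N : ℕ} {W : HolSubbundle F E r} (hW : Q.Invariant W)
    {W' : HolSubbundle F E n} {z : Fin N → X} {k : Fin N → Fin n → ℤ} (hk : Q.HasType W' z k) :
    ∃ l, Q.HasType W z l := by
  choose l hl using fun j =>
    hW.exists_hasExponentsAt (p := z j) (hk.range_eq ▸ Set.mem_range_self j)
  exact ⟨l, hk.injective, hk.range_eq, hl⟩

/-- The `t`-degree of `E` is at most the sum of the `t`-degrees of the saturated kernel and image
of a holomorphic endomorphism commuting with `ρ`. -/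
theorem tDegree_le_add {τ : ∀ x, E x →ₗ[ℂ] E x} {r m N : ℕ}
    (hτ : ∀ x, HasSmithFormAt F τ r m x) (hrm : r + m = Module.finrank ℂ F)
    (hcomm : ∀ x ∉ Q.sing, ∀ v, τ x (Q.ρ x v) = Q.ρ x (τ x v))
    {z : Fin N → X} {k : Fin N → Fin (Module.finrank ℂ F) → ℤ} {lK : Fin N → Fin r → ℤ}
    {lI : Fin N → Fin m → ℤ} (hk : Q.HasType (HolSubbundle.full F E) z k)
    (hK : Q.HasType (kerBundle hτ) z lK) (hI : Q.HasType (rangeBundle hτ) z lI)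
    (t : Fin N → ℝ) (T : ℝ) :
    tDegree t T (HolSubbundle.full F E) k ≤
      tDegree t T (kerBundle hτ) lK + tDegree t T (rangeBundle hτ) lI := by
  have hsum : ∑ j, ((∑ a, k j a : ℤ) : ℝ) * t j =
      ∑ j, ((∑ a, lK j a : ℤ) : ℝ) * t j + ∑ j, ((∑ a, lI j a : ℤ) : ℝ) * t j := by
    rw [← Finset.sum_add_distrib]
    refine Finset.sum_congr rfl fun j _ => ?_
    rw [sum_exponents_eq (hτ (z j)) hcomm (K := kerBundle hτ) (I := rangeBundle hτ) rfl rfl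
      (W := HolSubbundle.full F E) (fun _ => rfl) (hK.exponents j) (hI.exponents j)
      (hk.exponents j), Int.cast_add, add_mul]
  -- All three degrees unfold to Chern numbers for the same chosen metric and partition of unity, so
  -- independence of these choices plays no role.
  have hdeg : (HolSubbundle.full F E).degree ≤
      (kerBundle hτ).degree + (rangeBundle hτ).degree :=
    chernNumber_le_add _ _ hτ (fun _ => rfl) hrm
  rw [tDegree, tDegree, tDegree, hsum, add_div]
  linarith

/-- If `E` is `t`-stable, a holomorphic endomorphism commuting with `ρ` whose determinant vanishes
identically is zero. -/
theorem IsStable.eq_zero_of_det_eq_zero [ConnectedSpace X] {N : ℕ} {t : Fin N → ℝ} {T : ℝ}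
    {z : Fin N → X} {k : Fin N → Fin (Module.finrank ℂ F) → ℤ} (hQ : Q.IsStable t T z k)
    (hk : Q.HasType (HolSubbundle.full F E) z k) {τ : ∀ x, E x →ₗ[ℂ] E x}
    (hτ : ∀ x, HolEndAt F τ x) (hcomm : ∀ x ∉ Q.sing, ∀ v, τ x (Q.ρ x v) = Q.ρ x (τ x v))
    (hdet : ∀ x, LinearMap.det (τ x) = 0) (x : X) : τ x = 0 := by
  obtain ⟨r, m, hrm, h⟩ := exists_forall_hasSmithFormAt hτ
  have hr := (h x).pos_of_det_eq_zero hrm hdet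
  rcases Nat.eq_zero_or_pos m with rfl | hm
  · exact (h x).eq_zero
  exfalso
  have hK : Q.Invariant (kerBundle h) := invariant_of_saturation rfl fun x hx v hv => by
    rw [LinearMap.mem_ker] at hv ⊢
    rw [hcomm x hx, hv, map_zero]
  have hI : Q.Invariant (rangeBundle h) := by
    refine invariant_of_saturation rfl ?_
    rintro x hx _ ⟨v, rfl⟩
    exact ⟨Q.ρ x v, hcomm x hx v⟩
  obtain ⟨lK, hlK⟩ := hK.exists_hasType hk
  obtain ⟨lI, hlI⟩ := hI.exists_hasType hk
  -- Both subbundles are proper, as `r` and `m` are positive and add up to the rank of `E`. The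
  -- slope of `E` would be at most a weighted mean of two strictly smaller slopes.
  have h1 := hQ r hr (by omega) _ hK lK hlK
  have h2 := hQ m hm (by omega) _ hI lI hlI
  have h3 := tDegree_le_add h hrm hcomm hk hlK hlI t T
  have hr' : (0 : ℝ) < r := by exact_mod_cast hr
  have hm' : (0 : ℝ) < m := by exact_mod_cast hm
  have hn : ((Module.finrank ℂ F : ℕ) : ℝ) = r + m := by exact_mod_cast hrm.symm
  have h4 : tDegree t T (HolSubbundle.full F E) k =
      tSlope t T (HolSubbundle.full F E) k * (r + m) := by
    rw [tSlope, hn, div_mul_cancel₀ _ (by positivity)]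
  rw [tSlope, div_lt_iff₀ hr'] at h1
  rw [tSlope, div_lt_iff₀ hm'] at h2
  linarith

end BundlePair

end BundlePairs

end

theorem mainTheorem3
    {X : Type*} [TopologicalSpace X] [T2Space X] [CompactSpace X] [ConnectedSpace X]
    [ChartedSpace ℂ X] [IsManifold 𝓘(ℂ) ω X]
    {F : Type*} [NormedAddCommGroup F] [NormedSpace ℂ F] [FiniteDimensional ℂ F]
    {E : X → Type*} [TopologicalSpace (TotalSpace F E)]
    [∀ x, AddCommGroup (E x)] [∀ x, Module ℂ (E x)] [∀ x, TopologicalSpace (E x)]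
    [∀ x, IsTopologicalAddGroup (E x)] [∀ x, ContinuousSMul ℂ (E x)]
    [FiberBundle F E] [VectorBundle ℂ F E] [ContMDiffVectorBundle ω F E 𝓘(ℂ)]
    (Q : BundlePairs.BundlePair F E)
    {N : ℕ} (z : Fin N → X) (k : Fin N → Fin (Module.finrank ℂ F) → ℤ)
    (hk : Q.HasType (BundlePairs.HolSubbundle.full F E) z k)
    (t : Fin N → ℝ) (T : ℝ) (hT : 0 < T) (ht_pos : ∀ j, 0 < t j) (ht_mono : Monotone t)
    (ht_le : ∀ j, t j ≤ T)
    (hstable : Q.IsStable t T z k) :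
    Q.IsSimple := by
  intro σ hσ hcomm
  obtain ⟨x₀⟩ := (inferInstance : Nonempty X)
  -- An eigenvalue needs a nonzero fibre; in rank zero any scalar works.
  rcases subsingleton_or_nontrivial (E x₀) with h | h
  · have hF : Module.finrank ℂ F = 0 := by
      rw [← BundlePairs.finrank_fiber F E x₀, Module.finrank_zero_of_subsingleton]
    refine ⟨0, fun x => ContinuousLinearMap.ext fun v => ?_⟩
    have := BundlePairs.finiteDimensional_fiber F E x
    have : Subsingleton (E x) :=
      Module.finrank_zero_iff.1 ((BundlePairs.finrank_fiber F E x).trans hF)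
    exact Subsingleton.elim _ _
  have := BundlePairs.finiteDimensional_fiber F E x₀
  -- An eigenvalue at the single point `x₀` is enough: `det (σ - c)` is constant on `X` and vanishes
  -- there.
  obtain ⟨c, hc⟩ := Module.End.exists_eigenvalue (σ x₀).toLinearMap
  let τ : ∀ x, E x →ₗ[ℂ] E x := fun x => (σ x).toLinearMap - c • LinearMap.id
  have hτ : ∀ x, BundlePairs.HolEndAt F τ x := fun x s hs =>
    (BundlePairs.IsHolEndOn.holEndAt hσ Filter.univ_mem s hs).sub
      (BundlePairs.HolAt.smul (c := fun _ => c) contMDiffAt_const hs)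
  have hτ₀ : LinearMap.det (τ x₀) = 0 := by
    obtain ⟨v, hv⟩ := hc.exists_hasEigenvector
    by_contra h0
    refine hv.2 ((LinearMap.equivOfDetNeZero _ h0).injective ?_)
    rw [map_zero]
    exact sub_eq_zero.2 hv.apply_eq_smul
  have hcommτ : ∀ x ∉ Q.sing, ∀ v, τ x (Q.ρ x v) = Q.ρ x (τ x v) := by
    intro x hx v
    have h1 : σ x (Q.ρ x v) = Q.ρ x (σ x v) := DFunLike.congr_fun (hcomm x hx) v
    simp [τ, h1]
  refine ⟨c, fun x => ContinuousLinearMap.ext fun v => sub_eq_zero.1 ?_⟩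
  exact LinearMap.congr_fun (hstable.eq_zero_of_det_eq_zero hk hτ hcommτ
    (fun x => (BundlePairs.det_eq_of_holEndAt hτ x x₀).trans hτ₀) x) v
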